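/- **Setting.** All functions and parameters are real. Let $T,U\subseteq\mathbb R$ be nonempty open intervals. Consider the equations $$u_t=f(t)\,u_{yy}-k(u)\,u_x,\qquad t\in T,\ u\in U, \tag{A}$$ where $f$ is smooth and nonvanishing on $T$, and $k$ is smooth and nonlinear on $U$ ($k_{uu}\not\equiv0$), and the equations $$u_t=f(t)\,u_{yy}-g(t)\,[K(u)]_x,\qquad t\in T,\ u\in U, \tag{B}$$ where $f,g$ are smooth and nonvanishing on $T$, and $K$ is smooth on $U$ with nonlinear derivative $k=K_u$ ($K_{uuu}\not\equiv0$). For open intervals $X,Y$, the maximal Lie invariance algebra $A^{\max}$ of an equation $\Delta=0$ on $T\times X\times Y\times U$ consists of all vector fields $Q=\tau\partial_t+\xi\partial_x+\eta\partial_y+\theta\partial_u$, with $\tau,\xi,\eta,\theta$ smooth functions of $(t,x,y,u)\in T\times X\times Y\times U$, such that the second prolongation satisfies $Q^{(2)}\Delta=0$ at all second-order jets with $\Delta=0$. The equivalence group $G^\sim$ of class (A) consists of the transformations $$\tilde t=\varepsilon_1t+\varepsilon_0,\quad \tilde x=\delta_1x+\delta_2t+\delta_3,\quad \tilde y=\delta_4y+\delta_5,\quad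 \tilde u=\delta_6u+\delta_7,\quad \tilde f(\tilde t)=\tfrac{\delta_4^2}{\varepsilon_1}f(t),\quad \tilde k(\tilde u)=\tfrac1{\varepsilon_1}(\delta_1k(u)+\delta_2)$$ with constants $\varepsilon_0,\varepsilon_1,\delta_1,\dots,\delta_7$, $\delta_1\delta_4\delta_6\varepsilon_1\neq0$ (the intervals $T,U$ being mapped accordingly). The generalized extended equivalence group $\hat G^\sim$ of class (B) consists of the transformations $$\tilde t=\vartheta(t),\quad \tilde x=\delta_1x+\delta_2\!\int\! g\,dt+\delta_3,\quad \tilde y=\delta_4y+\delta_5,\quad \tilde u=\delta_6u+\delta_7,$$ $$\tilde f(\tilde t)=\tfrac{\delta_4^2}{\vartheta_t}f(t),\quad \tilde g(\tilde t)=\tfrac{\varepsilon_1}{\vartheta_t}g(t),\quad \tilde K(\tilde u)=\tfrac{\delta_6}{\varepsilon_1}(\delta_1K(u)+\delta_2u+\varepsilon_2)$$ with constants $\delta_i,\varepsilon_i$, $\delta_1\delta_4\delta_6\varepsilon_1\neq0$, and $\vartheta$ smooth with $\vartheta_t\ne0$ on $T$. **The list.** A *case* is a pair consisting of a value of $k$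 and a value of $f$ among $$k\in\{\text{arbitrary},\ u^n\ (n\neq0,1),\ e^u,\ \ln u\},\qquad f\in\{\text{arbitrary},\ \epsilon t^\rho\ (\rho\ne0),\ \epsilon e^t,\ 1\},\qquad \epsilon=\pm1 .$$ Here $t^\rho$ is considered for $t>0$, $\ln u$ for $u>0$, and $u^n$ for $u>0$ (or on any interval if $n$ is a natural number); "arbitrary" means: not equivalent to an equation of the class with one of the other listed values. With each case we associate a list of vector fields. It contains $\partial_x,\ \partial_y$; furthermore, * for $k=u^n$: $n x\partial_x+u\partial_u$; for $k=e^u$: $x\partial_x+\partial_u$; for $k=\ln u$: $t\partial_x+u\partial_u$; for arbitrary $k$: nothing; * for $f=\epsilon t^\rho$: $2t\partial_t+2x\partial_x+(\rho+1)y\partial_y$; for $f=\epsilon e^t$: $2\partial_t+y\partial_y$; for $f=1$: $\partial_t$ and $2t\partial_t+2x\partial_x+y\partial_y$; for arbitrary $f$: nothing. Thus the lists have 2 to 5 elements. **Theorem.** 1. If an equation (A) belongs to a case of the list, then the associated vector fields form a basis of its maximal Lie invariance algebra, for any $X$ and $Y$. 2. Every equation (A) is $G^\sim$-equivalent to an equation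 of exactly one case of the list (the parameters $n$, $\rho$, $\epsilon$ being uniquely determined as well). 3. If a transformation $\varphi$ from $G^\sim$ maps an equation (A) to an equation of a case of the list, then the pullbacks under $\varphi$ of the associated vector fields form a basis of the maximal Lie invariance algebra of the former equation, for any $X$ and $Y$. In particular, up to $G^\sim$-equivalence, the algebra is larger than $\langle\partial_x,\partial_y\rangle$ only if $k$ or $f$ has one of the special listed forms. 4. For given $T,X,Y,U$, the kernel, i.e. the intersection of the maximal Lie invariance algebras of all equations (A), is $\langle\partial_x,\partial_y\rangle$. 5. Every equation (B) is $\hat G^\sim$-equivalent to an equation with $g=1$ of exactly one case of the list, where the values of $k$ are replaced by those of $K$ as follows: $k=u^n$, $n\ne-1$, by $K=u^{n+1}$; $k=u^{-1}$ by $K=\ln u$; $k=e^u$ by $K=e^u$; $k=\ln u$ by $K=u\ln u$ ("arbitrary" now being understood with respect to $\hat G^\sim$ and equations with $g=1$). 6. If a transformation $\varphi$ from $\hat G^\sim$ maps an equation (B) to such an equation with $g=1$, then the pullbacks under $\varphi$ of the vector fields associated with the case form a basis of the maximal Lie invariance algebra of the equation (B), for any $X$ and $Y$. -/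

import Mathlib

open scoped ContDiff

noncomputable section

namespace Kolmogorov

/-! Points of the space of variables are `z = (t, x, y, u)`, written `z 0, z 1, z 2, z 3`. -/

/-- The space of the variables `(t, x, y, u)`. -/
abbrev Pt := Fin 4 → ℝ

/-- A vector field `τ ∂_t + ξ ∂_x + η ∂_y + θ ∂_u`, given by its coefficients `(τ, ξ, η, θ)`. -/
abbrev VF := Pt → Pt

/-- Points `(z, p, r)` of the second jet space: `z = (t, x, y, u)`, `p i = u_i` are the first and
`r i j = u_{ij}` the second derivatives of `u`, the indices `0, 1, 2` standing for `t, x, y`.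
Only points with symmetric `r` are actual jets. -/
abbrev Jet2 := Pt × (Fin 3 → ℝ) × (Fin 3 → Fin 3 → ℝ)

/-- A nonempty open interval of the real line (bounded or not). -/
def IsOpenInterval (I : Set ℝ) : Prop := IsOpen I ∧ I.OrdConnected ∧ I.Nonempty

/-- The domain `T × X × Y × U` in the space of the variables `(t, x, y, u)`. -/
def box (T X Y U : Set ℝ) : Set Pt := {z | z 0 ∈ T ∧ z 1 ∈ X ∧ z 2 ∈ Y ∧ z 3 ∈ U}

/-! ### Prolongation of vector fields and the infinitesimal invariance criterion -/

/-- The partial derivative of `F` with respect to the `i`-th coordinate. -/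
def pd {m : ℕ} (i : Fin m) (F : (Fin m → ℝ) → ℝ) (z : Fin m → ℝ) : ℝ :=
  fderiv ℝ F z (Pi.single i 1)

/-- The total derivative `D_i = ∂_i + u_i ∂_u` of a function of `(t, x, y, u)`. -/
def totalD (i : Fin 3) (F : Pt → ℝ) (z : Pt) (p : Fin 3 → ℝ) : ℝ :=
  pd i.castSucc F z + p i * pd (Fin.last 3) F z

/-- The total derivative `D_i = ∂_i + u_i ∂_u + ∑_l u_{il} ∂_{u_l}` of a function on the first jet
space. -/
def totalD' (i : Fin 3) (F : Pt → (Fin 3 → ℝ) → ℝ)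
    (z : Pt) (p : Fin 3 → ℝ) (r : Fin 3 → Fin 3 → ℝ) : ℝ :=
  pd i.castSucc (fun w => F w p) z + p i * pd (Fin.last 3) (fun w => F w p) z
    + ∑ l, r i l * pd l (fun q => F z q) p

/-- The coefficients `θ^i = D_i θ - ∑_l (D_i ξ^l) u_l` of the first prolongation, where
`ξ^0, ξ^1, ξ^2 = τ, ξ, η`. -/
def prolong1 (Q : VF) (i : Fin 3) (z : Pt) (p : Fin 3 → ℝ) : ℝ :=
  totalD i (fun w => Q w (Fin.last 3)) z p
    - ∑ l : Fin 3, totalD i (fun w => Q w l.castSucc) z p * p l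

/-- The coefficients `θ^{ij} = D_j θ^i - ∑_l (D_j ξ^l) u_{il}` of the second prolongation. -/
def prolong2 (Q : VF) (i j : Fin 3) (z : Pt) (p : Fin 3 → ℝ) (r : Fin 3 → Fin 3 → ℝ) : ℝ :=
  totalD' j (prolong1 Q i) z p r
    - ∑ l : Fin 3, totalD j (fun w => Q w l.castSucc) z p * r i l

/-- The second prolongation `Q^{(2)}` as a vector field on the second jet space. -/
def prolongation (Q : VF) (J : Jet2) : Jet2 :=
  (Q J.1, fun i => prolong1 Q i J.1 J.2.1, fun i j => prolong2 Q i j J.1 J.2.1 J.2.2)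

/-- The vector field `Q` is smooth on `Ω` and `Q^{(2)} Δ` vanishes at all jets over `Ω` that satisfy
the equation `Δ = 0`. -/
def IsLieSymmetry (Ω : Set Pt) (Δ : Jet2 → ℝ) (Q : VF) : Prop :=
  ContDiffOn ℝ ∞ Q Ω ∧
    ∀ J : Jet2, J.1 ∈ Ω → (∀ i j, J.2.2 i j = J.2.2 j i) → Δ J = 0 →
      fderiv ℝ Δ J (prolongation Q J) = 0

/-- The left-hand side of the equation `u_t - f(t) u_yy + g(t) k(u) u_x = 0`. -/
def kolmogorov (f g k : ℝ → ℝ) (J : Jet2) : ℝ :=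
  J.2.1 0 - f (J.1 0) * J.2.2 2 2 + g (J.1 0) * k (J.1 3) * J.2.1 1

/-- The vector fields in the list `b` are linearly independent on `Ω`, and the vector fields with
the property `S` are exactly those that coincide on `Ω` with a linear combination, with constant
real coefficients, of the fields in `b`. -/
def IsBasisOn (Ω : Set Pt) (S : VF → Prop) (b : List VF) : Prop :=
  LinearIndependent ℝ (fun i : Fin b.length => Ω.domRestrict (b.get i)) ∧
    ∀ Q : VF, S Q ↔ ∃ c : Fin b.length → ℝ, ∀ z ∈ Ω, Q z = ∑ i, c i • b.get i z

/-! ### The vector fields -/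

/-- `∂_t` -/
def dt : VF := fun _ => ![1, 0, 0, 0]
/-- `∂_x` -/
def dx : VF := fun _ => ![0, 1, 0, 0]
/-- `∂_y` -/
def dy : VF := fun _ => ![0, 0, 1, 0]

/-! ### The types of coefficients in the classification list -/

/-- The values of `k` in the list: arbitrary, `u ^ n`, `e ^ u`, `ln u`. -/
inductive KType where
  | arbitrary : KType
  | power (n : ℝ) : KType
  | exp : KType
  | log : KType

/-- The values of `f` in the list: arbitrary, `ε t ^ ρ`, `ε e ^ t` with `ε = ±1`, and `1`. -/
inductive FType where
  | arbitrary : FType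
  | power (ρ : ℝ) (ε : ℤˣ) : FType
  | exp (ε : ℤˣ) : FType
  | one : FType

/-- The function `k` has on `U` the listed form. A power `u ^ n` is considered for `u > 0`, or on any
interval if `n` is a natural number. -/
def KType.Matches : KType → Set ℝ → (ℝ → ℝ) → Prop
  | .arbitrary, _, _ => True
  | .power n, U, k => n ≠ 0 ∧ n ≠ 1 ∧ (U ⊆ Set.Ioi 0 ∨ ∃ m : ℕ, n = m) ∧ ∀ u ∈ U, k u = u ^ n
  | .exp, U, k => ∀ u ∈ U, k u = Real.exp u
  | .log, U, k => U ⊆ Set.Ioi 0 ∧ ∀ u ∈ U, k u = Real.log u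

/-- The function `K` has on `U` the form that corresponds to the listed form of `k`:
`K = u ^ (n + 1)` for `k = u ^ n` with `n ≠ -1`, `K = ln u` for `k = u ^ (-1)`, `K = e ^ u` for
`k = e ^ u`, and `K = u ln u` for `k = ln u`. -/
def KType.MatchesFlux : KType → Set ℝ → (ℝ → ℝ) → Prop
  | .arbitrary, _, _ => True
  | .power n, U, K => n ≠ 0 ∧ n ≠ 1 ∧ (U ⊆ Set.Ioi 0 ∨ ∃ m : ℕ, n = m) ∧
      ∀ u ∈ U, (n ≠ -1 → K u = u ^ (n + 1)) ∧ (n = -1 → K u = Real.log u)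
  | .exp, U, K => ∀ u ∈ U, K u = Real.exp u
  | .log, U, K => U ⊆ Set.Ioi 0 ∧ ∀ u ∈ U, K u = u * Real.log u

/-- The function `f` has on `T` the listed form. -/
def FType.Matches : FType → Set ℝ → (ℝ → ℝ) → Prop
  | .arbitrary, _, _ => True
  | .power ρ ε, T, f => ρ ≠ 0 ∧ T ⊆ Set.Ioi 0 ∧ ∀ t ∈ T, f t = ((ε : ℤ) : ℝ) * t ^ ρ
  | .exp ε, T, f => ∀ t ∈ T, f t = ((ε : ℤ) : ℝ) * Real.exp t
  | .one, T, f => ∀ t ∈ T, f t = 1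

/-- The additional basis elements that are due to the form of `k`. -/
def KType.extension : KType → List VF
  | .arbitrary => []
  | .power n => [fun z => ![0, n * z 1, 0, z 3]]     -- `n x ∂_x + u ∂_u`
  | .exp => [fun z => ![0, z 1, 0, 1]]               -- `x ∂_x + ∂_u`
  | .log => [fun z => ![0, z 0, 0, z 3]]             -- `t ∂_x + u ∂_u`

/-- The additional basis elements that are due to the form of `f`. -/
def FType.extension : FType → List VF
  | .arbitrary => []
  | .power ρ _ =>                        -- `2 t ∂_t + 2 x ∂_x + (ρ + 1) y ∂_y`
      [fun z => ![2 * z 0, 2 * z 1, (ρ + 1) * z 2, 0]]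
  | .exp _ => [fun z => ![2, 0, z 2, 0]] -- `2 ∂_t + y ∂_y`
  | .one =>                              -- `∂_t` and `2 t ∂_t + 2 x ∂_x + y ∂_y`
      [dt, fun z => ![2 * z 0, 2 * z 1, z 2, 0]]

/-- The listed basis of the maximal Lie invariance algebra. -/
def tableBasis (c : KType × FType) : List VF := [dx, dy] ++ c.1.extension ++ c.2.extension

/-! ### The class `u_t = f(t) u_yy - k(u) u_x` and its equivalence group -/

/-- An equation `u_t = f(t) u_yy - k(u) u_x` with `t ∈ T` and `u ∈ U`. -/
structure GaugedEq where
  T : Set ℝ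
  U : Set ℝ
  f : ℝ → ℝ
  k : ℝ → ℝ

/-- `T` and `U` are open intervals, `f` is smooth and nonvanishing on `T`, and `k` is smooth and
nonlinear on `U` (that is, `k_uu` is not identically zero). -/
structure GaugedEq.InClass (e : GaugedEq) : Prop where
  isOpenInterval_T : IsOpenInterval e.T
  isOpenInterval_U : IsOpenInterval e.U
  smooth_f : ContDiffOn ℝ ∞ e.f e.T
  f_ne_zero : ∀ t ∈ e.T, e.f t ≠ 0
  smooth_k : ContDiffOn ℝ ∞ e.k e.U
  nonlinear : ∃ u ∈ e.U, deriv (deriv e.k) u ≠ 0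

/-- `Q` is a Lie symmetry vector field, on `T × X × Y × U`, of the equation `e`. -/
def GaugedEq.IsSymmetry (e : GaugedEq) (X Y : Set ℝ) (Q : VF) : Prop :=
  IsLieSymmetry (box e.T X Y e.U) (kolmogorov e.f (fun _ => 1) e.k) Q

/-- The parameters of a transformation from the equivalence group `G^∼`. -/
structure GaugedTransf where
  (ε₀ ε₁ δ₁ δ₂ δ₃ δ₄ δ₅ δ₆ δ₇ : ℝ)
  ne_zero : δ₁ * δ₄ * δ₆ * ε₁ ≠ 0

/-- The action on the variables `(t, x, y, u)`. -/
def GaugedTransf.map (φ : GaugedTransf) (z : Pt) : Pt :=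
  ![φ.ε₁ * z 0 + φ.ε₀, φ.δ₁ * z 1 + φ.δ₂ * z 0 + φ.δ₃, φ.δ₄ * z 2 + φ.δ₅, φ.δ₆ * z 3 + φ.δ₇]

/-- The transformation `φ` maps the equation `e` to the equation `e'`. -/
structure GaugedTransf.Maps (φ : GaugedTransf) (e e' : GaugedEq) : Prop where
  T_eq : e'.T = (fun t => φ.ε₁ * t + φ.ε₀) '' e.T
  U_eq : e'.U = (fun u => φ.δ₆ * u + φ.δ₇) '' e.U
  f_eq : ∀ t ∈ e.T, e'.f (φ.ε₁ * t + φ.ε₀) = φ.δ₄ ^ 2 / φ.ε₁ * e.f t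
  k_eq : ∀ u ∈ e.U, e'.k (φ.δ₆ * u + φ.δ₇) = 1 / φ.ε₁ * (φ.δ₁ * e.k u + φ.δ₂)

/-- `e` belongs to the case `c` of the list. Here `arbitrary` means that `e` is not `G^∼`-equivalent
to an equation with one of the other listed values of `k` (respectively of `f`). -/
structure GaugedEq.IsOfType (e : GaugedEq) (c : KType × FType) : Prop where
  k_matches : c.1.Matches e.U e.k
  f_matches : c.2.Matches e.T e.f
  k_arbitrary : c.1 = .arbitrary → ∀ (φ : GaugedTransf) (e' : GaugedEq) (κ : KType),
    κ ≠ .arbitrary → φ.Maps e e' → ¬ κ.Matches e'.U e'.k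
  f_arbitrary : c.2 = .arbitrary → ∀ (φ : GaugedTransf) (e' : GaugedEq) (ν : FType),
    ν ≠ .arbitrary → φ.Maps e e' → ¬ ν.Matches e'.T e'.f

/-! ### The class `u_t = f(t) u_yy - g(t) [K(u)]_x` and its equivalence group -/

/-- An equation `u_t = f(t) u_yy - g(t) [K(u)]_x` with `t ∈ T` and `u ∈ U`. -/
structure OrigEq where
  T : Set ℝ
  U : Set ℝ
  f : ℝ → ℝ
  g : ℝ → ℝ
  K : ℝ → ℝ

/-- `T` and `U` are open intervals, `f` and `g` are smooth and nonvanishing on `T`, and `K` is smooth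
on `U` with nonlinear derivative `k = K_u` (that is, `K_uuu` is not identically zero). -/
structure OrigEq.InClass (e : OrigEq) : Prop where
  isOpenInterval_T : IsOpenInterval e.T
  isOpenInterval_U : IsOpenInterval e.U
  smooth_f : ContDiffOn ℝ ∞ e.f e.T
  f_ne_zero : ∀ t ∈ e.T, e.f t ≠ 0
  smooth_g : ContDiffOn ℝ ∞ e.g e.T
  g_ne_zero : ∀ t ∈ e.T, e.g t ≠ 0
  smooth_K : ContDiffOn ℝ ∞ e.K e.U
  nonlinear : ∃ u ∈ e.U, deriv (deriv (deriv e.K)) u ≠ 0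

/-- `Q` is a Lie symmetry vector field, on `T × X × Y × U`, of the equation `e`; note that
`[K(u)]_x = K_u(u) u_x`. -/
def OrigEq.IsSymmetry (e : OrigEq) (X Y : Set ℝ) (Q : VF) : Prop :=
  IsLieSymmetry (box e.T X Y e.U) (kolmogorov e.f e.g (deriv e.K)) Q

/-- The parameters of a transformation from the generalized extended equivalence group: the function
`θ` gives the new time `θ(t)`, and `G` is the antiderivative of `g` that is used. -/
structure OrigTransf where
  (θ G : ℝ → ℝ)
  (δ₁ δ₂ δ₃ δ₄ δ₅ δ₆ δ₇ ε₁ ε₂ : ℝ)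
  ne_zero : δ₁ * δ₄ * δ₆ * ε₁ ≠ 0

/-- The action on the variables `(t, x, y, u)`. -/
def OrigTransf.map (φ : OrigTransf) (z : Pt) : Pt :=
  ![φ.θ (z 0), φ.δ₁ * z 1 + φ.δ₂ * φ.G (z 0) + φ.δ₃, φ.δ₄ * z 2 + φ.δ₅, φ.δ₆ * z 3 + φ.δ₇]

/-- The transformation `φ` is admissible for the equation `e` and maps it to the equation `e'`. -/
structure OrigTransf.Maps (φ : OrigTransf) (e e' : OrigEq) : Prop where
  smooth_θ : ContDiffOn ℝ ∞ φ.θ e.T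
  deriv_θ_ne_zero : ∀ t ∈ e.T, deriv φ.θ t ≠ 0
  hasDerivAt_G : ∀ t ∈ e.T, HasDerivAt φ.G (e.g t) t
  T_eq : e'.T = φ.θ '' e.T
  U_eq : e'.U = (fun u => φ.δ₆ * u + φ.δ₇) '' e.U
  f_eq : ∀ t ∈ e.T, e'.f (φ.θ t) = φ.δ₄ ^ 2 / deriv φ.θ t * e.f t
  g_eq : ∀ t ∈ e.T, e'.g (φ.θ t) = φ.ε₁ / deriv φ.θ t * e.g t
  K_eq : ∀ u ∈ e.U,
    e'.K (φ.δ₆ * u + φ.δ₇) = φ.δ₆ / φ.ε₁ * (φ.δ₁ * e.K u + φ.δ₂ * u + φ.ε₂)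

/-- `e` satisfies the gauge condition `g = 1`. -/
def OrigEq.IsGauged (e : OrigEq) : Prop := ∀ t ∈ e.T, e.g t = 1

/-- `e` satisfies `g = 1` and belongs to the case `c` of the list. Here `arbitrary` means that `e` is
not equivalent, under the generalized extended equivalence group, to an equation with `g = 1` and
one of the other listed values of `K` (respectively of `f`). -/
structure OrigEq.IsOfType (e : OrigEq) (c : KType × FType) : Prop where
  gauged : e.IsGauged
  K_matches : c.1.MatchesFlux e.U e.K
  f_matches : c.2.Matches e.T e.f
  K_arbitrary : c.1 = .arbitrary → ∀ (φ : OrigTransf) (e' : OrigEq) (κ : KType),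
    κ ≠ .arbitrary → φ.Maps e e' → e'.IsGauged → ¬ κ.MatchesFlux e'.U e'.K
  f_arbitrary : c.2 = .arbitrary → ∀ (φ : OrigTransf) (e' : OrigEq) (ν : FType),
    ν ≠ .arbitrary → φ.Maps e e' → e'.IsGauged → ¬ ν.Matches e'.T e'.f

end Kolmogorov

end

/-! The invariance condition is linear in the field and polynomial in the jet variables. Once `u_t`
is eliminated by means of the equation, the remaining derivatives are free, so every coefficient of
the polynomial vanishes; this gives the determining equations (`isLieSymmetry_iff_detEqs`).
Differentiating them in `u` and using that `k` is nonlinear separates the unknowns until only nine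
constants are left (`DetEqs.exists_params`): with `G_t = g`, τ = (c₁ G + c₀) / g, ξ = A G + (B + c₁)
x + ξ₀, η = a y + η₀, θ = φ u + ψ. Here ξ₀ and η₀ are free, which accounts for `∂_x` and `∂_y`, and
the other constants obey two uncoupled conditions, (φ u + ψ) k_u = A + B k and (c₁ G + c₀) (f / g)_t
= (2 a - c₁) f.

The classification is therefore a product of two classifications of ordinary differential equations.
For `k`, any two solutions are proportional (`KSol.exists_eq_mul`), and integrating a nontrivial one
turns `k`, up to affine changes of `u` and of `k`, into a power, an exponential or a logarithm
(`exists_kNF_of_kSol`). The ratio of B to φ is an invariant that tells these forms apart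
(`KNF.unique`). For `f` as a function of the new time `G` the argument is the same
(`TSol.exists_eq_mul`, `exists_fNF_of_tSol`, `FNF.unique`), except that a constant `f` admits a
two-dimensional solution space.

The equivalence groups act on `k` and on `f` by affine changes that can be chosen independently, so
the type of an equation is the pair of the two types. For the class with arbitrary `g`, the time `G`
gives `g = 1`, and the flux `K` is classified through its derivative. Bases are transferred without
transforming jets: the push-forward of a field of the general form is again of that form, with
explicitly transformed constants (`OrigTransf.MapsCoeffs.isBasisOn`). For the kernel, a single
polynomial equation already has no symmetries beyond `∂_x` and `∂_y`. -/

namespace Kolmogorov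

/-! ### Partial derivatives -/

/-- Restriction to a coordinate line turns a partial derivative into an ordinary one, so that the
one-variable rules apply. -/
lemma hasDerivAt_slice {m : ℕ} {F : (Fin m → ℝ) → ℝ} {z : Fin m → ℝ} (i : Fin m)
    (h : DifferentiableAt ℝ F z) :
    HasDerivAt (fun s => F (Function.update z i s)) (pd i F z) (z i) := by
  have h1 : HasFDerivAt F (fderiv ℝ F z) (Function.update z i (z i)) := by
    rw [Function.update_eq_self]; exact h.hasFDerivAt
  exact h1.comp_hasDerivAt (z i) (hasDerivAt_update z i (z i))

lemma pd_eq_of_hasDerivAt {m : ℕ} {F : (Fin m → ℝ) → ℝ} {z : Fin m → ℝ} {i : Fin m} {d : ℝ}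
    (h : DifferentiableAt ℝ F z)
    (h' : HasDerivAt (fun s => F (Function.update z i s)) d (z i)) : pd i F z = d :=
  (hasDerivAt_slice i h).unique h'

lemma contDiffOn_pd {m : ℕ} {F : (Fin m → ℝ) → ℝ} {Ω : Set (Fin m → ℝ)} (hΩ : IsOpen Ω)
    (hF : ContDiffOn ℝ ∞ F Ω) (i : Fin m) : ContDiffOn ℝ ∞ (pd i F) Ω :=
  (hF.fderiv_of_isOpen hΩ (by simp)).clm_apply contDiffOn_const

lemma pd_congr {m : ℕ} {F F' : (Fin m → ℝ) → ℝ} {Ω : Set (Fin m → ℝ)} (hΩ : IsOpen Ω)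
    (h : Set.EqOn F F' Ω) (i : Fin m) : Set.EqOn (pd i F) (pd i F') Ω := fun z hz => by
  unfold pd
  rw [(h.eventuallyEq_of_mem (hΩ.mem_nhds hz)).fderiv_eq]

lemma pd_const {m : ℕ} (i : Fin m) (c : ℝ) (z : Fin m → ℝ) : pd i (fun _ => c) z = 0 := by
  simp [pd]

lemma pd_eq_zero_of_eqOn_const {m : ℕ} {F : (Fin m → ℝ) → ℝ} {Ω : Set (Fin m → ℝ)} {c : ℝ}
    (hΩ : IsOpen Ω) (h : ∀ z ∈ Ω, F z = c) (i : Fin m) : ∀ z ∈ Ω, pd i F z = 0 := fun z hz => by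
  rw [pd_congr hΩ (F' := fun _ => c) h i hz, pd_const]

lemma pd_comm {m : ℕ} {F : (Fin m → ℝ) → ℝ} {Ω : Set (Fin m → ℝ)} (hΩ : IsOpen Ω)
    (hF : ContDiffOn ℝ ∞ F Ω) (i j : Fin m) : ∀ z ∈ Ω, pd i (pd j F) z = pd j (pd i F) z := by
  intro z hz
  have hz' := hF.contDiffAt (hΩ.mem_nhds hz)
  have hs : IsSymmSndFDerivAt ℝ F z := hz'.isSymmSndFDerivAt (by
    simpa using (WithTop.coe_le_coe (α := ℕ∞)).2 (le_top : (2 : ℕ∞) ≤ ⊤))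
  have hd : DifferentiableAt ℝ (fderiv ℝ F) z :=
    ((hF.fderiv_of_isOpen (m := ∞) hΩ (by simp)).contDiffAt (hΩ.mem_nhds hz)).differentiableAt
      (by simp)
  have key : ∀ i j : Fin m, pd i (pd j F) z
      = fderiv ℝ (fderiv ℝ F) z (Pi.single i 1) (Pi.single j 1) := by
    intro i j
    unfold pd
    rw [fderiv_clm_apply hd (by fun_prop)]
    simp
  rw [key, key, hs]

lemma pd_pd_eq_zero {m : ℕ} {F : (Fin m → ℝ) → ℝ} {Ω : Set (Fin m → ℝ)} (hΩ : IsOpen Ω)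
    (hF : ContDiffOn ℝ ∞ F Ω) {i : Fin m} (h : ∀ z ∈ Ω, pd i F z = 0) (j : Fin m) :
    ∀ z ∈ Ω, pd i (pd j F) z = 0 := fun z hz => by
  rw [pd_comm hΩ hF i j z hz, pd_eq_zero_of_eqOn_const hΩ h j z hz]

lemma differentiableAt_of_contDiffOn {E F : Type*} [NormedAddCommGroup E] [NormedSpace ℝ E]
    [NormedAddCommGroup F] [NormedSpace ℝ F] {f : E → F} {Ω : Set E} (hΩ : IsOpen Ω)
    (hf : ContDiffOn ℝ ∞ f Ω) {z : E} (hz : z ∈ Ω) : DifferentiableAt ℝ f z :=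
  (hf.contDiffAt (hΩ.mem_nhds hz)).differentiableAt (by simp)

/-! ### The infinitesimal invariance criterion in terms of partial derivatives -/

lemma prolong1_eq (Q : VF) (i : Fin 3) (z : Pt) (p : Fin 3 → ℝ) :
    prolong1 Q i z p = pd i.castSucc (fun w => Q w 3) z + p i * pd 3 (fun w => Q w 3) z
      - ((pd i.castSucc (fun w => Q w 0) z + p i * pd 3 (fun w => Q w 0) z) * p 0
        + (pd i.castSucc (fun w => Q w 1) z + p i * pd 3 (fun w => Q w 1) z) * p 1
        + (pd i.castSucc (fun w => Q w 2) z + p i * pd 3 (fun w => Q w 2) z) * p 2) := by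
  simp only [prolong1, totalD, Fin.sum_univ_three]
  rfl

lemma fderiv_kolmogorov {f g k : ℝ → ℝ} {J : Jet2} (hf : DifferentiableAt ℝ f (J.1 0))
    (hg : DifferentiableAt ℝ g (J.1 0)) (hk : DifferentiableAt ℝ k (J.1 3)) (V : Jet2) :
    fderiv ℝ (kolmogorov f g k) J V
      = V.2.1 0 - (deriv f (J.1 0) * V.1 0 * J.2.2 2 2 + f (J.1 0) * V.2.2 2 2)
        + ((deriv g (J.1 0) * V.1 0 * k (J.1 3) + g (J.1 0) * (deriv k (J.1 3) * V.1 3)) * J.2.1 1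
          + g (J.1 0) * k (J.1 3) * V.2.1 1) := by
  have hd : DifferentiableAt ℝ (kolmogorov f g k) J := by
    have h0 : DifferentiableAt ℝ (fun J : Jet2 => J.1 0) J := by fun_prop
    have h3 : DifferentiableAt ℝ (fun J : Jet2 => J.1 3) J := by fun_prop
    have hf' : DifferentiableAt ℝ (fun J : Jet2 => f (J.1 0)) J :=
      DifferentiableAt.comp (g := f) (f := fun J : Jet2 => J.1 0) J hf h0
    have hg' : DifferentiableAt ℝ (fun J : Jet2 => g (J.1 0)) J :=
      DifferentiableAt.comp (g := g) (f := fun J : Jet2 => J.1 0) J hg h0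
    have hk' : DifferentiableAt ℝ (fun J : Jet2 => k (J.1 3)) J :=
      DifferentiableAt.comp (g := k) (f := fun J : Jet2 => J.1 3) J hk h3
    have h1 : DifferentiableAt ℝ (fun J : Jet2 => J.2.1 0) J := by fun_prop
    have h2 : DifferentiableAt ℝ (fun J : Jet2 => J.2.1 1) J := by fun_prop
    have h4 : DifferentiableAt ℝ (fun J : Jet2 => J.2.2 2 2) J := by fun_prop
    exact (h1.sub (hf'.mul h4)).add ((hg'.mul hk').mul h2)
  -- The derivative in the direction `V` is computed along the line `J + s V`, where every factor is
  -- a function of the single variable `s`.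
  rw [← hd.lineDeriv_eq_fderiv]
  apply HasDerivAt.deriv
  have l : ∀ a b : ℝ, HasDerivAt (fun s : ℝ => a + s * b) b 0 := fun a b => by
    simpa using ((hasDerivAt_id (0 : ℝ)).mul_const b).const_add a
  have c : ∀ (F : ℝ → ℝ) (a b : ℝ), DifferentiableAt ℝ F a →
      HasDerivAt (fun s : ℝ => F (a + s * b)) (deriv F a * b) 0 := fun F a b h => by
    have h1 : HasDerivAt F (deriv F a) (a + 0 * b) := by simpa using h.hasDerivAt
    exact HasDerivAt.comp (h₂ := F) 0 h1 (l a b)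
  have := ((l (J.2.1 0) (V.2.1 0)).sub ((c f _ (V.1 0) hf).mul (l (J.2.2 2 2) (V.2.2 2 2)))).add
    (((c g _ (V.1 0) hg).mul (c k _ (V.1 3) hk)).mul (l (J.2.1 1) (V.2.1 1)))
  refine HasDerivAt.congr_deriv (f := fun s => kolmogorov f g k (J + s • V)) this ?_
  simp only [Pi.mul_apply, zero_mul, add_zero]

lemma pd_prolong1 {Q : VF} {Ω : Set Pt} (hΩ : IsOpen Ω) (hQ : ContDiffOn ℝ ∞ Q Ω) {z : Pt}
    (hz : z ∈ Ω) (i : Fin 3) (j : Fin 4) (p : Fin 3 → ℝ) :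
    pd j (fun w => prolong1 Q i w p) z
      = pd j (pd i.castSucc (fun w => Q w 3)) z + p i * pd j (pd 3 (fun w => Q w 3)) z
      - ((pd j (pd i.castSucc (fun w => Q w 0)) z + p i * pd j (pd 3 (fun w => Q w 0)) z) * p 0
        + (pd j (pd i.castSucc (fun w => Q w 1)) z + p i * pd j (pd 3 (fun w => Q w 1)) z) * p 1
        + (pd j (pd i.castSucc (fun w => Q w 2)) z + p i * pd j (pd 3 (fun w => Q w 2)) z) * p 2)
      := by
  have hq : ∀ l i, DifferentiableAt ℝ (pd i (fun w => Q w l)) z := fun l i =>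
    differentiableAt_of_contDiffOn hΩ (contDiffOn_pd hΩ (contDiffOn_pi.1 hQ l) i) hz
  have hs := fun l i => hasDerivAt_slice j (hq l i)
  simp only [prolong1_eq]
  apply pd_eq_of_hasDerivAt
  · have := hq
    fun_prop
  · exact (((hs 3 _).add ((hs 3 3).const_mul _)).sub
      (((((hs 0 _).add ((hs 0 3).const_mul _)).mul_const _).add
      (((hs 1 _).add ((hs 1 3).const_mul _)).mul_const _)).add
      (((hs 2 _).add ((hs 2 3).const_mul _)).mul_const _)))

/-- Only the index `y` is needed: the sole second derivative in the equation is `u_yy`. -/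
lemma pd_prolong1_two (Q : VF) (z : Pt) (l : Fin 3) (p : Fin 3 → ℝ) :
    pd l (fun q => prolong1 Q 2 z q) p
      = (if l = 2 then pd 3 (fun w => Q w 3) z - (pd 3 (fun w => Q w 0) z * p 0
          + pd 3 (fun w => Q w 1) z * p 1 + pd 3 (fun w => Q w 2) z * p 2) else 0)
        - (pd 2 (fun w => Q w l.castSucc) z + p 2 * pd 3 (fun w => Q w l.castSucc) z) := by
  simp only [prolong1_eq]
  apply pd_eq_of_hasDerivAt (by fun_prop)
  have d : ∀ m : Fin 3, HasDerivAt (fun s => Function.update p l s m) (if m = l then 1 else 0)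
      (p l) := by
    intro m
    by_cases h : m = l
    · subst h; simpa using hasDerivAt_id' _
    · simpa [h] using hasDerivAt_const _ _
  have := ((hasDerivAt_const (p l) (pd (Fin.castSucc 2) (fun w => Q w 3) z)).add
      ((d 2).mul_const (pd 3 (fun w => Q w 3) z))).sub
    ((((((hasDerivAt_const (p l) (pd (Fin.castSucc 2) (fun w => Q w 0) z)).add
      ((d 2).mul_const (pd 3 (fun w => Q w 0) z))).mul (d 0)).add
    (((hasDerivAt_const (p l) (pd (Fin.castSucc 2) (fun w => Q w 1) z)).add
      ((d 2).mul_const (pd 3 (fun w => Q w 1) z))).mul (d 1)))).add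
    (((hasDerivAt_const (p l) (pd (Fin.castSucc 2) (fun w => Q w 2) z)).add
      ((d 2).mul_const (pd 3 (fun w => Q w 2) z))).mul (d 2)))
  refine HasDerivAt.congr_deriv this ?_
  have e2 : (Fin.castSucc 2 : Fin 4) = 2 := rfl
  fin_cases l <;> (simp [e2]; try ring)

/-- The value of `Q^{(2)} Δ` at a jet, in terms of the partial derivatives of the coefficients. -/
lemma fderiv_kolmogorov_prolongation {f g k : ℝ → ℝ} {Q : VF} {Ω : Set Pt} (hΩ : IsOpen Ω)
    (hQ : ContDiffOn ℝ ∞ Q Ω) {z : Pt} (hz : z ∈ Ω) (hf : DifferentiableAt ℝ f (z 0))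
    (hg : DifferentiableAt ℝ g (z 0)) (hk : DifferentiableAt ℝ k (z 3))
    {a : Fin 4 → Fin 4 → ℝ} (ha : ∀ i l, pd i (fun w => Q w l) z = a i l)
    {b : Fin 4 → Fin 4 → Fin 4 → ℝ} (hb : ∀ i j l, pd i (pd j (fun w => Q w l)) z = b i j l)
    (p : Fin 3 → ℝ) (r : Fin 3 → Fin 3 → ℝ) :
    fderiv ℝ (kolmogorov f g k) (z, p, r) (prolongation Q (z, p, r))
      = (a 0 3 + p 0 * a 3 3 - ((a 0 0 + p 0 * a 3 0) * p 0 + (a 0 1 + p 0 * a 3 1) * p 1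
          + (a 0 2 + p 0 * a 3 2) * p 2))
        - deriv f (z 0) * Q z 0 * r 2 2
        - f (z 0) * (b 2 2 3 + p 2 * b 2 3 3 - ((b 2 2 0 + p 2 * b 2 3 0) * p 0
            + (b 2 2 1 + p 2 * b 2 3 1) * p 1 + (b 2 2 2 + p 2 * b 2 3 2) * p 2)
          + p 2 * (b 3 2 3 + p 2 * b 3 3 3 - ((b 3 2 0 + p 2 * b 3 3 0) * p 0
            + (b 3 2 1 + p 2 * b 3 3 1) * p 1 + (b 3 2 2 + p 2 * b 3 3 2) * p 2))
          + r 2 2 * (a 3 3 - (a 3 0 * p 0 + a 3 1 * p 1 + a 3 2 * p 2))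
          - 2 * (r 2 0 * (a 2 0 + p 2 * a 3 0) + r 2 1 * (a 2 1 + p 2 * a 3 1)
            + r 2 2 * (a 2 2 + p 2 * a 3 2)))
        + (deriv g (z 0) * Q z 0 * k (z 3) + g (z 0) * (deriv k (z 3) * Q z 3)) * p 1
        + g (z 0) * k (z 3) * (a 1 3 + p 1 * a 3 3 - ((a 1 0 + p 1 * a 3 0) * p 0
          + (a 1 1 + p 1 * a 3 1) * p 1 + (a 1 2 + p 1 * a 3 2) * p 2)) := by
  rw [fderiv_kolmogorov hf hg hk]
  have e2 : (Fin.castSucc 2 : Fin 4) = 2 := rfl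
  have e3 : (Fin.last 3 : Fin 4) = 3 := rfl
  simp only [prolongation, prolong2, totalD', totalD, e2, e3, Fin.sum_univ_three,
    pd_prolong1 hΩ hQ hz, pd_prolong1_two]
  simp only [prolong1_eq, Fin.castSucc_zero, Fin.castSucc_one, ha, hb]
  simp
  ring

/-! ### Functions on boxes -/

lemma box_eq_pi (T X Y U : Set ℝ) : box T X Y U = Set.univ.pi ![T, X, Y, U] := by
  ext z
  simp [box, Set.mem_pi, Fin.forall_fin_succ]

lemma isOpen_box {T X Y U : Set ℝ} (hT : IsOpen T) (hX : IsOpen X) (hY : IsOpen Y)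
    (hU : IsOpen U) : IsOpen (box T X Y U) := by
  rw [box_eq_pi]
  refine isOpen_set_pi Set.finite_univ fun i _ => ?_
  fin_cases i <;> assumption

lemma isPreconnected_box {T X Y U : Set ℝ} (hT : T.OrdConnected) (hX : X.OrdConnected)
    (hY : Y.OrdConnected) (hU : U.OrdConnected) : IsPreconnected (box T X Y U) := by
  rw [box_eq_pi]
  refine isPreconnected_univ_pi fun i => ?_
  fin_cases i <;> exact Set.OrdConnected.isPreconnected ‹_›

lemma fderiv_eq_zero_of_pd {m : ℕ} {F : (Fin m → ℝ) → ℝ} {z : Fin m → ℝ}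
    (h : ∀ i, pd i F z = 0) : fderiv ℝ F z = 0 := by
  ext1 v
  have : v = ∑ i, v i • (Pi.single i (1 : ℝ) : Fin m → ℝ) := by
    conv_lhs => rw [pi_eq_sum_univ' v]
  rw [this, map_sum]
  simp only [map_smul]
  exact Finset.sum_eq_zero fun i _ => by rw [show fderiv ℝ F z (Pi.single i 1) = 0 from h i]; simp

lemma exists_eq_const_of_pd_eq_zero {Ω : Set Pt} (hΩ : IsOpen Ω) (hc : IsPreconnected Ω)
    {F : Pt → ℝ} (hF : ContDiffOn ℝ ∞ F Ω)
    (h : ∀ i, ∀ z ∈ Ω, pd i F z = 0) : ∃ c, ∀ z ∈ Ω, F z = c :=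
  hΩ.exists_is_const_of_fderiv_eq_zero hc (hF.differentiableOn (by simp))
    fun z hz => fderiv_eq_zero_of_pd fun i => h i z hz

lemma update_three_mem_box {T X Y U : Set ℝ} {z : Pt} (hz : z ∈ box T X Y U) {s : ℝ}
    (hs : s ∈ U) : Function.update z 3 s ∈ box T X Y U := by
  obtain ⟨h0, h1, h2, h3⟩ := hz
  exact ⟨by simpa using h0, by simpa using h1, by simpa using h2, by simpa using hs⟩

/-- `U` is connected, so a vanishing `u`-derivative means independence of `u`. -/
lemma update_three_eq {T X Y U : Set ℝ} (hT : IsOpen T) (hX : IsOpen X) (hY : IsOpen Y)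
    (hU : IsOpenInterval U) {F : Pt → ℝ} (hF : ContDiffOn ℝ ∞ F (box T X Y U))
    (h : ∀ z ∈ box T X Y U, pd 3 F z = 0) {z : Pt} (hz : z ∈ box T X Y U) {s : ℝ} (hs : s ∈ U) :
    F (Function.update z 3 s) = F z := by
  have hΩ := isOpen_box hT hX hY hU.1
  have hd : ∀ s ∈ U, HasDerivAt (fun s => F (Function.update z 3 s)) 0 s := by
    intro s hs
    have hm := update_three_mem_box hz hs
    have := hasDerivAt_slice 3 (differentiableAt_of_contDiffOn hΩ hF hm)
    simpa [h _ hm] using this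
  have := hU.1.is_const_of_deriv_eq_zero hU.2.1.isPreconnected
    (fun s hs => (hd s hs).differentiableAt.differentiableWithinAt)
    (fun s hs => (hd s hs).deriv) hs hz.2.2.2
  simpa using this

/-- A function that is affine with respect to `u` vanishes if it vanishes for all `u` from a
nonempty open set. -/
lemma eq_zero_of_mul_eq_zero {T X Y U : Set ℝ} (hT : IsOpen T) (hX : IsOpen X) (hY : IsOpen Y)
    (hU : IsOpenInterval U) {F : Pt → ℝ} (hF : ContDiffOn ℝ ∞ F (box T X Y U))
    (h : ∀ z ∈ box T X Y U, pd 3 (pd 3 F) z = 0) {w : ℝ → ℝ} (hw : ContinuousOn w U) {u₀ : ℝ}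
    (hu₀ : u₀ ∈ U) (hwu : w u₀ ≠ 0) (hwF : ∀ z ∈ box T X Y U, w (z 3) * F z = 0) :
    ∀ z ∈ box T X Y U, F z = 0 := by
  have hΩ := isOpen_box hT hX hY hU.1
  have hev : ∀ᶠ s in nhds u₀, s ∈ U ∧ w s ≠ 0 :=
    Filter.Eventually.and (hU.1.mem_nhds hu₀) ((hw.continuousAt (hU.1.mem_nhds hu₀)).eventually_ne hwu)
  have h0 : ∀ z ∈ box T X Y U, ∀ s ∈ U, w s ≠ 0 → F (Function.update z 3 s) = 0 := by
    intro z hz s hs hws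
    have := hwF _ (update_three_mem_box hz hs)
    simpa [hws] using this
  -- Near `u₀` the weight is nonzero, so `F` vanishes there along the `u`-line and `F_u = 0` at
  -- `u₀`. As `F_u` does not depend on `u`, it vanishes on the whole line.
  have h1 : ∀ z ∈ box T X Y U, pd 3 F z = 0 := by
    intro z hz
    have hm := update_three_mem_box hz hu₀
    rw [← update_three_eq hT hX hY hU (contDiffOn_pd hΩ hF 3) h hz hu₀]
    apply pd_eq_of_hasDerivAt (differentiableAt_of_contDiffOn hΩ hF hm)
    have : HasDerivAt (fun _ : ℝ => (0 : ℝ)) 0 u₀ := hasDerivAt_const _ _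
    rw [Function.update_self]
    refine this.congr_of_eventuallyEq ?_
    filter_upwards [hev] with s hs
    simpa using h0 z hz s hs.1 hs.2
  intro z hz
  rw [← update_three_eq hT hX hY hU hF h1 hz hu₀, h0 z hz u₀ hu₀ hwu]

/-- `F` has the partial derivative `d` with respect to the `i`-th coordinate at `z`. -/
def HasPd (i : Fin 4) (F : Pt → ℝ) (d : ℝ) (z : Pt) : Prop :=
  HasDerivAt (fun s => F (Function.update z i s)) d (z i)

/-! ### Rules of differentiation along coordinate lines -/

namespace HasPd
variable {i : Fin 4} {F F' : Pt → ℝ} {d d' : ℝ} {z : Pt}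

lemma add (h : HasPd i F d z) (h' : HasPd i F' d' z) : HasPd i (fun w => F w + F' w) (d + d') z :=
  HasDerivAt.add h h'

lemma sub (h : HasPd i F d z) (h' : HasPd i F' d' z) : HasPd i (fun w => F w - F' w) (d - d') z :=
  HasDerivAt.sub h h'

lemma mul (h : HasPd i F d z) (h' : HasPd i F' d' z) :
    HasPd i (fun w => F w * F' w) (d * F' z + F z * d') z := by
  have := HasDerivAt.mul h h'
  simp only [Function.update_eq_self] at this
  exact this

lemma const_mul (c : ℝ) (h : HasPd i F d z) : HasPd i (fun w => c * F w) (c * d) z :=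
  HasDerivAt.const_mul c h

lemma const (c : ℝ) (i : Fin 4) (z : Pt) : HasPd i (fun _ => c) 0 z := hasDerivAt_const _ _

lemma coord {f : ℝ → ℝ} (h : HasDerivAt f d (z i)) : HasPd i (fun w => f (w i)) d z := by
  simpa [HasPd] using h

lemma coord_ne {f : ℝ → ℝ} {j : Fin 4} (h : j ≠ i) : HasPd i (fun w => f (w j)) 0 z := by
  simpa [HasPd, h] using hasDerivAt_const _ _

lemma congr {Ω : Set Pt} (hΩ : IsOpen Ω) (h : Set.EqOn F F' Ω) (hz : z ∈ Ω)
    (hF : HasPd i F d z) : HasPd i F' d z := by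
  refine HasDerivAt.congr_of_eventuallyEq hF ?_
  have hc : ContinuousAt (fun s => Function.update z i s) (z i) :=
    (hasDerivAt_update z i (z i)).continuousAt
  have := hc.preimage_mem_nhds (by simpa using hΩ.mem_nhds hz)
  filter_upwards [this] with s hs using (h hs).symm

/-- The device for differentiating an identity on `Ω`: both sides are differentiated by the rules
above, and the results agree by uniqueness of the derivative. -/
lemma unique_of_eqOn {Ω : Set Pt} (hΩ : IsOpen Ω) (h : Set.EqOn F F' Ω) (hz : z ∈ Ω)
    (hF : HasPd i F d z) (hF' : HasPd i F' d' z) : d = d' :=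
  HasDerivAt.unique (hF.congr hΩ h hz) hF'

lemma of_contDiffOn {Ω : Set Pt} (hΩ : IsOpen Ω) (hF : ContDiffOn ℝ ∞ F Ω) (hz : z ∈ Ω) :
    HasPd i F (pd i F z) z := hasDerivAt_slice i (differentiableAt_of_contDiffOn hΩ hF hz)

lemma pd_eq (h : DifferentiableAt ℝ F z) (h' : HasPd i F d z) : pd i F z = d :=
  pd_eq_of_hasDerivAt h h'

end HasPd

/-! ### The determining equations -/

/-- The determining equations for the Lie symmetries of `u_t = f(t) u_yy - g(t) k(u) u_x`. -/
structure DetEqs (Ω : Set Pt) (f g k : ℝ → ℝ) (Q : VF) : Prop where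
  τ_y : ∀ z ∈ Ω, pd 2 (fun w => Q w 0) z = 0
  τ_u : ∀ z ∈ Ω, pd 3 (fun w => Q w 0) z = 0
  ξ_y : ∀ z ∈ Ω, pd 2 (fun w => Q w 1) z = 0
  ξ_u : ∀ z ∈ Ω, pd 3 (fun w => Q w 1) z = 0
  η_u : ∀ z ∈ Ω, pd 3 (fun w => Q w 2) z = 0
  θ_uu : ∀ z ∈ Ω, pd 3 (pd 3 (fun w => Q w 3)) z = 0
  coeff_u_yy : ∀ z ∈ Ω, f (z 0) * pd 0 (fun w => Q w 0) z + deriv f (z 0) * Q z 0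
    + g (z 0) * k (z 3) * f (z 0) * pd 1 (fun w => Q w 0) z
      = 2 * f (z 0) * pd 2 (fun w => Q w 2) z
  coeff_u_x : ∀ z ∈ Ω, g (z 0) * deriv k (z 3) * Q z 3 = pd 0 (fun w => Q w 1) z
    + g (z 0) * k (z 3) * (pd 1 (fun w => Q w 1) z - pd 0 (fun w => Q w 0) z)
    - deriv g (z 0) * Q z 0 * k (z 3) - (g (z 0) * k (z 3)) ^ 2 * pd 1 (fun w => Q w 0) z
  coeff_u_y : ∀ z ∈ Ω, pd 0 (fun w => Q w 2) z + g (z 0) * k (z 3) * pd 1 (fun w => Q w 2) z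
    = f (z 0) * (pd 2 (pd 2 (fun w => Q w 2)) z - 2 * pd 2 (pd 3 (fun w => Q w 3)) z)
  coeff_one : ∀ z ∈ Ω, pd 0 (fun w => Q w 3) z - f (z 0) * pd 2 (pd 2 (fun w => Q w 3)) z
    + g (z 0) * k (z 3) * pd 1 (fun w => Q w 3) z = 0

/-- Since `u_t` can be expressed through the other derivatives, the jets with `Δ = 0` are
parametrised by free variables, and the criterion is a polynomial identity in them. Evaluation at a
few small jets extracts its coefficients. -/
lemma isLieSymmetry_iff_detEqs {Ω : Set Pt} (hΩ : IsOpen Ω) {f g k : ℝ → ℝ}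
    (hf : ∀ z ∈ Ω, DifferentiableAt ℝ f (z 0)) (hg : ∀ z ∈ Ω, DifferentiableAt ℝ g (z 0))
    (hk : ∀ z ∈ Ω, DifferentiableAt ℝ k (z 3)) (hf0 : ∀ z ∈ Ω, f (z 0) ≠ 0) (Q : VF) :
    IsLieSymmetry Ω (kolmogorov f g k) Q ↔ ContDiffOn ℝ ∞ Q Ω ∧ DetEqs Ω f g k Q := by
  refine and_congr_right fun hQ => ?_
  have hQi : ∀ l, ContDiffOn ℝ ∞ (fun w => Q w l) Ω := fun l => contDiffOn_pi.1 hQ l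
  have formula := fun z (hz : z ∈ Ω) => fderiv_kolmogorov_prolongation hΩ hQ hz (hf z hz) (hg z hz)
    (hk z hz) (a := fun i l => pd i (fun w => Q w l) z) (fun _ _ => rfl)
    (b := fun i j l => pd i (pd j (fun w => Q w l)) z) (fun _ _ _ => rfl)
  have zz : ∀ l i, (∀ z ∈ Ω, pd i (fun w => Q w l) z = 0) → ∀ j, ∀ z ∈ Ω,
      pd j (pd i (fun w => Q w l)) z = 0 := fun l i h j => pd_eq_zero_of_eqOn_const hΩ h j
  constructor
  · intro H
    -- Test jets: `u_x = p1`, `u_y = p2`, `u_yy = R`, `u_ty = r0`, `u_xy = r1`, with `u_t`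
    -- determined by the equation. The derivatives `u_tt`, `u_tx`, `u_xx` do not occur in the
    -- criterion and are set to zero.
    have key : ∀ z (hz : z ∈ Ω) (p1 p2 R r0 r1 : ℝ), _ := fun z hz p1 p2 R r0 r1 =>
      (formula z hz ![f (z 0) * R - g (z 0) * k (z 3) * p1, p1, p2]
        ![![0, 0, r0], ![0, 0, r1], ![r0, r1, R]]).symm.trans
        (H (z, ![f (z 0) * R - g (z 0) * k (z 3) * p1, p1, p2],
          ![![0, 0, r0], ![0, 0, r1], ![r0, r1, R]]) hz
          (by intro i j; fin_cases i <;> fin_cases j <;> rfl)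
          (by simp [kolmogorov]))
    simp only [Matrix.cons_val] at key
    -- The difference of two test jets isolates one coefficient, here that of `u_ty`; with `u_y = 1`
    -- the same difference yields `τ_u`.
    have τ_y : ∀ z ∈ Ω, pd 2 (fun w => Q w 0) z = 0 := fun z hz => by
      have h1 := key z hz 0 0 0 1 0
      have h2 := key z hz 0 0 0 0 0
      have : f (z 0) * pd 2 (fun w => Q w 0) z = 0 := by linear_combination (h1 - h2) / 2
      simpa [hf0 z hz] using this
    have τ_u : ∀ z ∈ Ω, pd 3 (fun w => Q w 0) z = 0 := fun z hz => by
      have h1 := key z hz 0 1 0 1 0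
      have h2 := key z hz 0 1 0 0 0
      have : f (z 0) * pd 3 (fun w => Q w 0) z = 0 := by
        linear_combination (h1 - h2) / 2 - f (z 0) * τ_y z hz
      simpa [hf0 z hz] using this
    have ξ_y : ∀ z ∈ Ω, pd 2 (fun w => Q w 1) z = 0 := fun z hz => by
      have h1 := key z hz 0 0 0 0 1
      have h2 := key z hz 0 0 0 0 0
      have : f (z 0) * pd 2 (fun w => Q w 1) z = 0 := by linear_combination (h1 - h2) / 2
      simpa [hf0 z hz] using this
    have ξ_u : ∀ z ∈ Ω, pd 3 (fun w => Q w 1) z = 0 := fun z hz => by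
      have h1 := key z hz 0 1 0 0 1
      have h2 := key z hz 0 1 0 0 0
      have : f (z 0) * pd 3 (fun w => Q w 1) z = 0 := by
        linear_combination (h1 - h2) / 2 - f (z 0) * ξ_y z hz
      simpa [hf0 z hz] using this
    have key2 : ∀ z (hz : z ∈ Ω) (p1 p2 R : ℝ), _ := fun z hz p1 p2 R => key z hz p1 p2 R 0 0
    have s1 : ∀ z ∈ Ω, ∀ j, pd j (pd 2 (fun w => Q w 0)) z = 0 := fun z hz j => zz _ _ τ_y j z hz
    have s2 : ∀ z ∈ Ω, ∀ j, pd j (pd 3 (fun w => Q w 0)) z = 0 := fun z hz j => zz _ _ τ_u j z hz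
    have s3 : ∀ z ∈ Ω, ∀ j, pd j (pd 2 (fun w => Q w 1)) z = 0 := fun z hz j => zz _ _ ξ_y j z hz
    have s4 : ∀ z ∈ Ω, ∀ j, pd j (pd 3 (fun w => Q w 1)) z = 0 := fun z hz j => zz _ _ ξ_u j z hz
    simp +contextual only [τ_y, τ_u, ξ_y, ξ_u, s1, s2, s3, s4, mul_zero, add_zero, zero_add,
      zero_mul] at key2
    -- The mixed second difference in `u_y` and `u_yy` isolates the coefficient of their product.
    have η_u : ∀ z ∈ Ω, pd 3 (fun w => Q w 2) z = 0 := fun z hz => by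
      have h1 := key2 z hz 0 1 1
      have h2 := key2 z hz 0 1 0
      have h3 := key2 z hz 0 0 1
      have h4 := key2 z hz 0 0 0
      have : f (z 0) * pd 3 (fun w => Q w 2) z = 0 := by
        linear_combination (h1 - h2 - h3 + h4) / 2
      simpa [hf0 z hz] using this
    have s5 : ∀ z ∈ Ω, ∀ j, pd j (pd 3 (fun w => Q w 2)) z = 0 := fun z hz j => zz _ _ η_u j z hz
    have s6 : ∀ z ∈ Ω, pd 3 (pd 2 (fun w => Q w 2)) z = 0 := fun z hz =>
      pd_pd_eq_zero hΩ (hQi 2) η_u 2 z hz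
    simp +contextual only [η_u, s5, s6, mul_zero, add_zero,
      zero_mul, sub_zero] at key2
    refine ⟨τ_y, τ_u, ξ_y, ξ_u, η_u, fun z hz => ?_, fun z hz => ?_, fun z hz => ?_,
      fun z hz => ?_, fun z hz => ?_⟩
    -- The values at `u_y = 1, -1, 0` give the coefficient of `u_y ^ 2` as a second difference; the
    -- coefficient of `u_y` is obtained below as a central difference.
    · have h1 := key2 z hz 0 1 0
      have h2 := key2 z hz 0 (-1) 0
      have h3 := key2 z hz 0 0 0
      have : f (z 0) * pd 3 (pd 3 (fun w => Q w 3)) z = 0 := by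
        linear_combination -(h1 + h2 - 2 * h3) / 2
      simpa [hf0 z hz] using this
    · have h1 := key2 z hz 0 0 1
      have h3 := key2 z hz 0 0 0
      linear_combination -(h1 - h3)
    · have h1 := key2 z hz 1 0 0
      have h3 := key2 z hz 0 0 0
      linear_combination (h1 - h3)
    · have h1 := key2 z hz 0 1 0
      have h2 := key2 z hz 0 (-1) 0
      linear_combination -(h1 - h2) / 2 + f (z 0) * pd_comm hΩ (hQi 3) 2 3 z hz
    · linear_combination key2 z hz 0 0 0
  · intro D ⟨z, p, r⟩ hz hr h0
    have hz : z ∈ Ω := hz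
    rw [formula z hz]
    have h0 : p 0 = f (z 0) * r 2 2 - g (z 0) * k (z 3) * p 1 := by
      simp only [kolmogorov] at h0
      linear_combination h0
    simp only [D.τ_y z hz, D.τ_u z hz, D.ξ_y z hz, D.ξ_u z hz, D.η_u z hz, D.θ_uu z hz,
      zz _ _ D.τ_y _ z hz, zz _ _ D.τ_u _ z hz, zz _ _ D.ξ_y _ z hz, zz _ _ D.ξ_u _ z hz,
      zz _ _ D.η_u _ z hz, pd_pd_eq_zero hΩ (hQi 2) D.η_u 2 z hz,
      pd_comm hΩ (hQi 3) 3 2 z hz, h0]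
    -- What is left of the criterion is the combination of the last four determining equations with
    -- the monomials `u_yy`, `u_x`, `u_y` and `1`.
    linear_combination (-r 2 2) * D.coeff_u_yy z hz + p 1 * D.coeff_u_x z hz
      - p 2 * D.coeff_u_y z hz + D.coeff_one z hz

/-! ### Solution of the determining equations -/

/-- `(φ u + ψ) k_u = A + B k` on `U`. -/
def KSol (U : Set ℝ) (k : ℝ → ℝ) (φ ψ A B : ℝ) : Prop :=
  ∀ u ∈ U, (φ * u + ψ) * deriv k u = A + B * k u

/-- `σ (f / g)_t = (2 a - c₁) f` on `T` for `σ = c₁ G + c₀`. -/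
def FSol (T : Set ℝ) (f g G : ℝ → ℝ) (c₀ c₁ a : ℝ) : Prop :=
  ∀ t ∈ T, (c₁ * G t + c₀) * deriv (fun s => f s / g s) t = (2 * a - c₁) * f t

/-- The general form of a Lie symmetry vector field; `G` is an antiderivative of `g`. -/
noncomputable def symField (g G : ℝ → ℝ) (ξ₀ η₀ φ ψ A B c₀ c₁ a : ℝ) : VF := fun z =>
  ![(c₁ * G (z 0) + c₀) / g (z 0), A * G (z 0) + (B + c₁) * z 1 + ξ₀, a * z 2 + η₀, φ * z 3 + ψ]

/-- Assumptions on the coefficients of `u_t = f(t) u_yy - g(t) k(u) u_x`; `G` is an antiderivative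
of `g`. -/
structure Coeffs (T U : Set ℝ) (f g G k : ℝ → ℝ) : Prop where
  isOpenInterval_T : IsOpenInterval T
  isOpenInterval_U : IsOpenInterval U
  smooth_f : ContDiffOn ℝ ∞ f T
  f_ne_zero : ∀ t ∈ T, f t ≠ 0
  smooth_g : ContDiffOn ℝ ∞ g T
  g_ne_zero : ∀ t ∈ T, g t ≠ 0
  hasDerivAt_G : ∀ t ∈ T, HasDerivAt G (g t) t
  smooth_k : ContDiffOn ℝ ∞ k U
  nonlinear : ∃ u ∈ U, deriv (deriv k) u ≠ 0

lemma contDiffOn_deriv {s : Set ℝ} (hs : IsOpen s) {f : ℝ → ℝ} (hf : ContDiffOn ℝ ∞ f s) :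
    ContDiffOn ℝ ∞ (deriv f) s := hf.deriv_of_isOpen hs (by simp)

lemma exists_deriv_ne_zero {U : Set ℝ} (hU : IsOpen U) {k : ℝ → ℝ}
    (h : ∃ u ∈ U, deriv (deriv k) u ≠ 0) : ∃ u ∈ U, deriv k u ≠ 0 := by
  by_contra! h'
  obtain ⟨u, hu, hne⟩ := h
  apply hne
  have : deriv k =ᶠ[nhds u] fun _ => 0 := by
    filter_upwards [hU.mem_nhds hu] with v hv using h' v hv
  rw [this.deriv_eq, deriv_const]

lemma Coeffs.contDiffOn_G {T U : Set ℝ} {f g G k : ℝ → ℝ} (H : Coeffs T U f g G k) :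
    ContDiffOn ℝ ∞ G T := by
  rw [contDiffOn_infty_iff_deriv_of_isOpen H.isOpenInterval_T.1]
  exact ⟨fun t ht => (H.hasDerivAt_G t ht).differentiableAt.differentiableWithinAt,
    H.smooth_g.congr fun t ht => (H.hasDerivAt_G t ht).deriv⟩

lemma contDiffOn_coord {T : Set ℝ} {f : ℝ → ℝ} (hf : ContDiffOn ℝ ∞ f T) {Ω : Set Pt} {i : Fin 4}
    (h : ∀ z ∈ Ω, z i ∈ T) : ContDiffOn ℝ ∞ (fun z : Pt => f (z i)) Ω :=
  ContDiffOn.comp (g := f) (f := fun z : Pt => z i) hf (by fun_prop) h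

/-- The parameters satisfy the equations that make `symField` a symmetry. -/
structure SymParams (T U : Set ℝ) (f g G k : ℝ → ℝ) (φ ψ A B c₀ c₁ a : ℝ) : Prop where
  kSol : KSol U k φ ψ A B
  fSol : FSol T f g G c₀ c₁ a

/-- Every unknown is at most affine in `u`, whereas `k` is nonlinear, so `u`-derivatives of the
determining equations and their consequences split them further. All coefficients of `Q` thereby
become affine in `x`, `y`, `u` and `G`, up to the factor `1 / g` in `τ`. The two equations that
survive are the conditions in `SymParams`. -/
lemma DetEqs.exists_params {T X Y U : Set ℝ} {f g G k : ℝ → ℝ} (H : Coeffs T U f g G k)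
    (hX : IsOpenInterval X) (hY : IsOpenInterval Y) {Q : VF}
    (hQ : ContDiffOn ℝ ∞ Q (box T X Y U)) (D : DetEqs (box T X Y U) f g k Q) :
    ∃ ξ₀ η₀ φ ψ A B c₀ c₁ a, SymParams T U f g G k φ ψ A B c₀ c₁ a ∧
      ∀ z ∈ box T X Y U, Q z = symField g G ξ₀ η₀ φ ψ A B c₀ c₁ a z := by
  have hT := H.isOpenInterval_T
  have hU := H.isOpenInterval_U
  set Ω := box T X Y U with hΩdef
  have hΩ : IsOpen Ω := isOpen_box hT.1 hX.1 hY.1 hU.1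
  have hΩc : IsPreconnected Ω := isPreconnected_box hT.2.1 hX.2.1 hY.2.1 hU.2.1
  have m0 : ∀ z ∈ Ω, z 0 ∈ T := fun z hz => hz.1
  have m3 : ∀ z ∈ Ω, z 3 ∈ U := fun z hz => hz.2.2.2
  have hQi : ∀ l, ContDiffOn ℝ ∞ (fun w => Q w l) Ω := fun l => contDiffOn_pi.1 hQ l
  obtain ⟨v₀, hv₀, hkv⟩ := exists_deriv_ne_zero hU.1 H.nonlinear
  obtain ⟨u₀, hu₀, hku⟩ := H.nonlinear
  have smk' := contDiffOn_deriv hU.1 H.smooth_k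
  have smk'' := contDiffOn_deriv hU.1 smk'
  have smg' := contDiffOn_deriv hT.1 H.smooth_g
  have smf' := contDiffOn_deriv hT.1 H.smooth_f
  have g0 : ∀ z ∈ Ω, g (z 0) ≠ 0 := fun z hz => H.g_ne_zero _ (m0 z hz)
  have f0 : ∀ z ∈ Ω, f (z 0) ≠ 0 := fun z hz => H.f_ne_zero _ (m0 z hz)
  have dk : ∀ z ∈ Ω, HasDerivAt k (deriv k (z 3)) (z 3) := fun z hz =>
    (differentiableAt_of_contDiffOn hU.1 H.smooth_k (m3 z hz)).hasDerivAt
  have dk' : ∀ z ∈ Ω, HasDerivAt (deriv k) (deriv (deriv k) (z 3)) (z 3) := fun z hz =>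
    (differentiableAt_of_contDiffOn hU.1 smk' (m3 z hz)).hasDerivAt
  have dg : ∀ z ∈ Ω, HasDerivAt g (deriv g (z 0)) (z 0) := fun z hz =>
    (differentiableAt_of_contDiffOn hT.1 H.smooth_g (m0 z hz)).hasDerivAt
  have dG : ∀ z ∈ Ω, HasDerivAt G (g (z 0)) (z 0) := fun z hz => H.hasDerivAt_G _ (m0 z hz)
  -- The separation tool: `k_u F = 0` with `F` affine in `u` implies `F = 0`, because `k_u` is
  -- nonzero near `v₀`.
  have vanish : ∀ {F : Pt → ℝ}, ContDiffOn ℝ ∞ F Ω → (∀ z ∈ Ω, pd 3 (pd 3 F) z = 0) →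
      (∀ z ∈ Ω, deriv k (z 3) * F z = 0) → ∀ z ∈ Ω, F z = 0 := fun hF h2 h =>
    eq_zero_of_mul_eq_zero hT.1 hX.1 hY.1 hU hF h2 smk'.continuousOn hv₀ hkv h
  have aff : ∀ {F : Pt → ℝ}, (∀ z ∈ Ω, pd 3 F z = 0) → ∀ z ∈ Ω, pd 3 (pd 3 F) z = 0 := fun h =>
    pd_eq_zero_of_eqOn_const hΩ h 3
  have hp : ∀ {F : Pt → ℝ} (i : Fin 4) {z : Pt}, ContDiffOn ℝ ∞ F Ω → z ∈ Ω →
      HasPd i F (pd i F z) z := fun i z hF hz => HasPd.of_contDiffOn hΩ hF hz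
  have hp0 : ∀ {F : Pt → ℝ} {i : Fin 4} {z : Pt}, ContDiffOn ℝ ∞ F Ω →
      (∀ z ∈ Ω, pd i F z = 0) → z ∈ Ω → HasPd i F 0 z := fun {F i z} hF h hz =>
    h z hz ▸ HasPd.of_contDiffOn hΩ hF hz
  have sp : ∀ {F : Pt → ℝ} (i : Fin 4), ContDiffOn ℝ ∞ F Ω → ContDiffOn ℝ ∞ (pd i F) Ω :=
    fun i hF => contDiffOn_pd hΩ hF i
  have zs : ∀ {F : Pt → ℝ} {i : Fin 4}, ContDiffOn ℝ ∞ F Ω → (∀ z ∈ Ω, pd i F z = 0) →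
      ∀ j, ∀ z ∈ Ω, pd i (pd j F) z = 0 := fun hF h j => pd_pd_eq_zero hΩ hF h j
  -- `τ_x = 0`
  have τ_x : ∀ z ∈ Ω, pd 1 (fun w => Q w 0) z = 0 := by
    refine vanish (sp 1 (hQi 0)) (aff (zs (hQi 0) D.τ_u 1)) fun z hz => ?_
    -- In the equation from `u_yy` only the factor `k` depends on `u`, so its `u`-derivative leaves
    -- a single term.
    have h := HasPd.unique_of_eqOn hΩ (fun z hz => D.coeff_u_yy z hz) hz
      ((((HasPd.coord_ne (f := f) (i := 3) (j := 0) (by decide)).mul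
        (hp0 (sp 0 (hQi 0)) (zs (hQi 0) D.τ_u 0) hz)).add
        ((HasPd.coord_ne (f := deriv f) (i := 3) (j := 0) (by decide)).mul
          (hp0 (hQi 0) D.τ_u hz))).add
        ((((HasPd.coord_ne (f := g) (i := 3) (j := 0) (by decide)).mul
          (HasPd.coord (f := k) (i := 3) (dk z hz))).mul
          (HasPd.coord_ne (f := f) (i := 3) (j := 0) (by decide))).mul
          (hp0 (sp 1 (hQi 0)) (zs (hQi 0) D.τ_u 1) hz)))
      (((HasPd.coord_ne (f := f) (i := 3) (j := 0) (by decide)).const_mul 2).mul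
        (hp0 (sp 2 (hQi 2)) (zs (hQi 2) D.η_u 2) hz))
    have : g (z 0) * f (z 0) * (deriv k (z 3) * pd 1 (fun w => Q w 0) z) = 0 := by
      linear_combination h
    simpa [g0 z hz, f0 z hz] using this
  -- `η_yy = 0`
  have η_yy : ∀ z ∈ Ω, pd 2 (pd 2 (fun w => Q w 2)) z = 0 := fun z hz => by
    have h := HasPd.unique_of_eqOn hΩ (fun z hz => D.coeff_u_yy z hz) hz
      ((((HasPd.coord_ne (f := f) (i := 2) (j := 0) (by decide)).mul
        (hp0 (sp 0 (hQi 0)) (zs (hQi 0) D.τ_y 0) hz)).add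
        ((HasPd.coord_ne (f := deriv f) (i := 2) (j := 0) (by decide)).mul
          (hp0 (hQi 0) D.τ_y hz))).add
        ((((HasPd.coord_ne (f := g) (i := 2) (j := 0) (by decide)).mul
          (HasPd.coord_ne (f := k) (i := 2) (j := 3) (by decide))).mul
          (HasPd.coord_ne (f := f) (i := 2) (j := 0) (by decide))).mul
          (hp0 (sp 1 (hQi 0)) (zs (hQi 0) D.τ_y 1) hz)))
      (((HasPd.coord_ne (f := f) (i := 2) (j := 0) (by decide)).const_mul 2).mul
        (hp 2 (sp 2 (hQi 2)) hz))
    have : f (z 0) * pd 2 (pd 2 (fun w => Q w 2)) z = 0 := by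
      linear_combination -h / 2
    simpa [f0 z hz] using this
  have θ_uu' : ∀ i, ∀ z ∈ Ω, pd 3 (pd i (pd 3 (fun w => Q w 3))) z = 0 := fun i =>
    zs (sp 3 (hQi 3)) D.θ_uu i
  have θ_uu'' : ∀ i, ∀ z ∈ Ω, pd 3 (pd 3 (pd i (fun w => Q w 3))) z = 0 := fun i z hz => by
    rw [pd_congr hΩ (fun z hz => pd_comm hΩ (hQi 3) 3 i z hz) 3 hz, θ_uu' i z hz]
  have η_yy' : ∀ i, ∀ z ∈ Ω, pd i (pd 2 (pd 2 (fun w => Q w 2))) z = 0 := fun i =>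
    pd_eq_zero_of_eqOn_const hΩ η_yy i
  -- `η_x = 0`
  have η_x : ∀ z ∈ Ω, pd 1 (fun w => Q w 2) z = 0 := by
    refine vanish (sp 1 (hQi 2)) (aff (zs (hQi 2) D.η_u 1)) fun z hz => ?_
    have h := HasPd.unique_of_eqOn hΩ (fun z hz => D.coeff_u_y z hz) hz
      ((hp0 (sp 0 (hQi 2)) (zs (hQi 2) D.η_u 0) hz).add
        (((HasPd.coord_ne (f := g) (i := 3) (j := 0) (by decide)).mul
          (HasPd.coord (f := k) (i := 3) (dk z hz))).mul
          (hp0 (sp 1 (hQi 2)) (zs (hQi 2) D.η_u 1) hz)))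
      ((HasPd.coord_ne (f := f) (i := 3) (j := 0) (by decide)).mul
        ((hp0 (sp 2 (sp 2 (hQi 2))) (η_yy' 3) hz).sub
          ((hp0 (sp 2 (sp 3 (hQi 3))) (θ_uu' 2) hz).const_mul 2)))
    have : g (z 0) * (deriv k (z 3) * pd 1 (fun w => Q w 2) z) = 0 := by
      linear_combination h
    simpa [g0 z hz] using this
  -- the equation for `θ`, with `B = ξ_x - τ_t - τ g_t / g`
  set Bf : Pt → ℝ := fun z => pd 1 (fun w => Q w 1) z - pd 0 (fun w => Q w 0) z
    - Q z 0 * (deriv g (z 0) / g (z 0)) with hBf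
  have sB : ContDiffOn ℝ ∞ Bf Ω := ((sp 1 (hQi 1)).sub (sp 0 (hQi 0))).sub
    ((hQi 0).mul (contDiffOn_coord (smg'.div H.smooth_g H.g_ne_zero) m0))
  have E2 : ∀ z ∈ Ω, g (z 0) * deriv k (z 3) * Q z 3
      = pd 0 (fun w => Q w 1) z + g (z 0) * k (z 3) * Bf z := fun z hz => by
    rw [D.coeff_u_x z hz, τ_x z hz, hBf]
    have := g0 z hz
    field_simp
    ring
  have B_y : ∀ z ∈ Ω, pd 2 Bf z = 0 := fun z hz => by
    refine HasPd.pd_eq (differentiableAt_of_contDiffOn hΩ sB hz) ?_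
    have := ((hp0 (sp 1 (hQi 1)) (zs (hQi 1) D.ξ_y 1) hz).sub
      (hp0 (sp 0 (hQi 0)) (zs (hQi 0) D.τ_y 0) hz)).sub
      ((hp0 (hQi 0) D.τ_y hz).mul
        (HasPd.coord_ne (f := fun t => deriv g t / g t) (i := 2) (j := 0) (by decide)))
    simpa using this
  have B_u : ∀ z ∈ Ω, pd 3 Bf z = 0 := fun z hz => by
    refine HasPd.pd_eq (differentiableAt_of_contDiffOn hΩ sB hz) ?_
    have := ((hp0 (sp 1 (hQi 1)) (zs (hQi 1) D.ξ_u 1) hz).sub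
      (hp0 (sp 0 (hQi 0)) (zs (hQi 0) D.τ_u 0) hz)).sub
      ((hp0 (hQi 0) D.τ_u hz).mul
        (HasPd.coord_ne (f := fun t => deriv g t / g t) (i := 3) (j := 0) (by decide)))
    simpa using this
  clear_value Bf
  -- `θ_y = 0`
  have θ_y : ∀ z ∈ Ω, pd 2 (fun w => Q w 3) z = 0 := by
    refine vanish (sp 2 (hQi 3)) (θ_uu'' 2) fun z hz => ?_
    have h := HasPd.unique_of_eqOn hΩ E2 hz
      (((HasPd.coord_ne (f := g) (i := 2) (j := 0) (by decide)).mul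
        (HasPd.coord_ne (f := deriv k) (i := 2) (j := 3) (by decide))).mul (hp 2 (hQi 3) hz))
      ((hp0 (sp 0 (hQi 1)) (zs (hQi 1) D.ξ_y 0) hz).add
        (((HasPd.coord_ne (f := g) (i := 2) (j := 0) (by decide)).mul
        (HasPd.coord_ne (f := k) (i := 2) (j := 3) (by decide))).mul (hp0 sB B_y hz)))
    have : g (z 0) * (deriv k (z 3) * pd 2 (fun w => Q w 3) z) = 0 := by
      linear_combination h
    simpa [g0 z hz] using this
  have η_t : ∀ z ∈ Ω, pd 0 (fun w => Q w 2) z = 0 := fun z hz => by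
    linear_combination D.coeff_u_y z hz - g (z 0) * k (z 3) * η_x z hz + f (z 0) * η_yy z hz
      - 2 * f (z 0) * zs (hQi 3) θ_y 3 z hz
  have E4 : ∀ z ∈ Ω, pd 0 (fun w => Q w 3) z + g (z 0) * k (z 3) * pd 1 (fun w => Q w 3) z = 0 :=
    fun z hz => by
    linear_combination D.coeff_one z hz + f (z 0) * pd_eq_zero_of_eqOn_const hΩ θ_y 2 z hz
  have kk : ∀ z ∈ Ω, HasPd 3 (fun w => g (w 0) * k (w 3)) (g (z 0) * deriv k (z 3)) z :=
    fun z hz => by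
    simpa using (HasPd.coord_ne (f := g) (i := 3) (j := 0) (z := z) (by decide)).mul
        (HasPd.coord (f := k) (i := 3) (dk z hz))
  have kk' : ∀ z ∈ Ω, HasPd 3 (fun w => g (w 0) * deriv k (w 3)) (g (z 0) * deriv (deriv k) (z 3)) z
      := fun z hz => by
    simpa using (HasPd.coord_ne (f := g) (i := 3) (j := 0) (z := z) (by decide)).mul
        (HasPd.coord (f := deriv k) (i := 3) (dk' z hz))
  -- `θ_ux = - B_x`
  have E2x : ∀ z ∈ Ω, g (z 0) * deriv k (z 3) * pd 1 (fun w => Q w 3) z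
      = pd 1 (pd 0 (fun w => Q w 1)) z + g (z 0) * k (z 3) * pd 1 Bf z := fun z hz => by
    have h := HasPd.unique_of_eqOn hΩ E2 hz
      (((HasPd.coord_ne (f := g) (i := 1) (j := 0) (by decide)).mul
        (HasPd.coord_ne (f := deriv k) (i := 1) (j := 3) (by decide))).mul (hp 1 (hQi 3) hz))
      ((hp 1 (sp 0 (hQi 1)) hz).add
        (((HasPd.coord_ne (f := g) (i := 1) (j := 0) (by decide)).mul
        (HasPd.coord_ne (f := k) (i := 1) (j := 3) (by decide))).mul (hp 1 sB hz)))
    linear_combination h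
  -- The `u`-derivative of `E4`, in which `g k_u θ_x` is replaced by means of `E2x`.
  have E4u : ∀ z ∈ Ω, pd 0 (pd 3 (fun w => Q w 3)) z + pd 1 (pd 0 (fun w => Q w 1)) z
      + g (z 0) * k (z 3) * (pd 1 (pd 3 (fun w => Q w 3)) z + pd 1 Bf z) = 0 := fun z hz => by
    have h := HasPd.unique_of_eqOn (F' := fun _ => 0) hΩ E4 hz
      ((hp 3 (sp 0 (hQi 3)) hz).add ((kk z hz).mul (hp 3 (sp 1 (hQi 3)) hz))) (hasDerivAt_const _ _)
    rw [pd_comm hΩ (hQi 3) 3 0 z hz, pd_comm hΩ (hQi 3) 3 1 z hz] at h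
    linear_combination h - E2x z hz
  have u1 : ∀ z ∈ Ω, pd 3 (pd 1 (pd 0 (fun w => Q w 1))) z = 0 :=
    zs (sp 0 (hQi 1)) (zs (hQi 1) D.ξ_u 0) 1
  have sC : ContDiffOn ℝ ∞ (fun z => pd 1 (pd 3 (fun w => Q w 3)) z + pd 1 Bf z) Ω :=
    (sp 1 (sp 3 (hQi 3))).add (sp 1 sB)
  have C_u : ∀ z ∈ Ω, pd 3 (fun z => pd 1 (pd 3 (fun w => Q w 3)) z + pd 1 Bf z) z = 0 :=
    fun z hz => by
    refine HasPd.pd_eq (differentiableAt_of_contDiffOn hΩ sC hz) ?_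
    simpa using (hp0 (sp 1 (sp 3 (hQi 3))) (θ_uu' 1) hz).add (hp0 (sp 1 sB) (zs sB B_u 1) hz)
  have θ_ux : ∀ z ∈ Ω, pd 1 (pd 3 (fun w => Q w 3)) z + pd 1 Bf z = 0 := by
    refine vanish sC (aff C_u) fun z hz => ?_
    have h := HasPd.unique_of_eqOn (F' := fun _ => 0) hΩ E4u hz
      (((hp0 (sp 0 (sp 3 (hQi 3))) (θ_uu' 0) hz).add (hp0 (sp 1 (sp 0 (hQi 1))) u1 hz)).add
        ((kk z hz).mul (hp0 sC C_u hz))) (hasDerivAt_const _ _)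
    have : g (z 0) * (deriv k (z 3) * (pd 1 (pd 3 (fun w => Q w 3)) z + pd 1 Bf z)) = 0 := by
      linear_combination h
    simpa [g0 z hz] using this
  -- `B_x = 0`, `B_t = - ξ_tx`
  have E2t : ∀ z ∈ Ω, deriv g (z 0) * pd 0 (fun w => Q w 1) z
      - g (z 0) * pd 0 (pd 0 (fun w => Q w 1)) z
      - (g (z 0) * k (z 3)) * (g (z 0) * (pd 1 (pd 0 (fun w => Q w 1)) z + pd 0 Bf z))
      - (g (z 0) * k (z 3)) * (g (z 0) * k (z 3)) * (g (z 0) * pd 1 Bf z) = 0 := fun z hz => by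
    have h := HasPd.unique_of_eqOn hΩ E2 hz
      (((HasPd.coord (f := g) (i := 0) (dg z hz)).mul
        (HasPd.coord_ne (f := deriv k) (i := 0) (j := 3) (by decide))).mul (hp 0 (hQi 3) hz))
      ((hp 0 (sp 0 (hQi 1)) hz).add
        (((HasPd.coord (f := g) (i := 0) (dg z hz)).mul
        (HasPd.coord_ne (f := k) (i := 0) (j := 3) (by decide))).mul (hp 0 sB hz)))
    -- From the `t`-derivative of `E2` the unknowns `θ`, `θ_t` and `θ_x` are eliminated by `E2`,
    -- `E4` and `E2x` respectively.
    linear_combination g (z 0) * h - deriv g (z 0) * E2 z hz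
      - g (z 0) ^ 2 * deriv k (z 3) * E4 z hz + g (z 0) ^ 2 * k (z 3) * E2x z hz
  have ξ_tu : ∀ z ∈ Ω, pd 3 (pd 0 (fun w => Q w 1)) z = 0 := zs (hQi 1) D.ξ_u 0
  have sM : ContDiffOn ℝ ∞ (fun z => g (z 0) * (pd 1 (pd 0 (fun w => Q w 1)) z + pd 0 Bf z)) Ω :=
    (contDiffOn_coord H.smooth_g m0).mul ((sp 1 (sp 0 (hQi 1))).add (sp 0 sB))
  have sN : ContDiffOn ℝ ∞ (fun z => g (z 0) * pd 1 Bf z) Ω :=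
    (contDiffOn_coord H.smooth_g m0).mul (sp 1 sB)
  have M_u : ∀ z ∈ Ω, HasPd 3 (fun z => g (z 0) * (pd 1 (pd 0 (fun w => Q w 1)) z + pd 0 Bf z)) 0 z
      := fun z hz => by
    simpa using (HasPd.coord_ne (f := g) (i := 3) (j := 0) (by decide)).mul
      ((hp0 (sp 1 (sp 0 (hQi 1))) u1 hz).add (hp0 (sp 0 sB) (zs sB B_u 0) hz))
  have N_u : ∀ z ∈ Ω, HasPd 3 (fun z => g (z 0) * pd 1 Bf z) 0 z := fun z hz => by
    simpa using (HasPd.coord_ne (f := g) (i := 3) (j := 0) (by decide)).mul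
      (hp0 (sp 1 sB) (zs sB B_u 1) hz)
  -- `E2t` is quadratic in `g k`, with coefficients independent of `u`. Its `u`-derivative is taken
  -- here; one more gives the leading coefficient `g B_x`.
  have E2tu : ∀ z ∈ Ω, (g (z 0) * deriv k (z 3))
      * (g (z 0) * (pd 1 (pd 0 (fun w => Q w 1)) z + pd 0 Bf z)
        + 2 * ((g (z 0) * k (z 3)) * (g (z 0) * pd 1 Bf z))) = 0 := fun z hz => by
    have h := HasPd.unique_of_eqOn (F' := fun _ => 0) hΩ E2t hz
      (((((HasPd.coord_ne (f := deriv g) (i := 3) (j := 0) (by decide)).mul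
        (hp0 (sp 0 (hQi 1)) ξ_tu hz)).sub
        ((HasPd.coord_ne (f := g) (i := 3) (j := 0) (by decide)).mul
        (hp0 (sp 0 (sp 0 (hQi 1))) (zs (sp 0 (hQi 1)) ξ_tu 0) hz))).sub
        ((kk z hz).mul (M_u z hz))).sub (((kk z hz).mul (kk z hz)).mul (N_u z hz)))
      (hasDerivAt_const _ _)
    linear_combination -h
  have B_x : ∀ z ∈ Ω, pd 1 Bf z = 0 := by
    refine eq_zero_of_mul_eq_zero hT.1 hX.1 hY.1 hU (sp 1 sB) (aff (zs sB B_u 1))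
      (w := fun u => deriv k u ^ 3) (smk'.continuousOn.pow 3) hv₀ (pow_ne_zero 3 hkv)
      fun z hz => ?_
    have h := HasPd.unique_of_eqOn (F' := fun _ => 0) hΩ E2tu hz
      ((kk' z hz).mul ((M_u z hz).add (((kk z hz).mul (N_u z hz)).const_mul 2)))
      (hasDerivAt_const _ _)
    -- Multiplication by `k_u` makes it possible to cancel the term with `k_uu` by means of `E2tu`;
    -- this is the origin of the weight `k_u ^ 3`.
    have : 2 * g (z 0) ^ 4 * (deriv k (z 3) ^ 3 * pd 1 Bf z) = 0 := by
      linear_combination g (z 0) * deriv k (z 3) * h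
        - g (z 0) * deriv (deriv k) (z 3) * E2tu z hz
    simpa [g0 z hz] using this
  -- `θ_x = 0`
  have θ_x : ∀ z ∈ Ω, pd 1 (fun w => Q w 3) z = 0 := by
    have e : ∀ z ∈ Ω, pd 3 (pd 1 (fun w => Q w 3)) z = 0 := fun z hz => by
      rw [pd_comm hΩ (hQi 3) 3 1 z hz]
      linear_combination θ_ux z hz - B_x z hz
    -- As `θ_x` no longer depends on `u` and `B_x = 0`, the `u`-derivative of `E2x` reads `k_uu θ_x
    -- = 0`. This is where `k_uu` itself, and not just `k_u`, must not vanish identically.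
    refine eq_zero_of_mul_eq_zero hT.1 hX.1 hY.1 hU (sp 1 (hQi 3)) (aff e)
      (w := deriv (deriv k)) smk''.continuousOn hu₀ hku fun z hz => ?_
    have h := HasPd.unique_of_eqOn hΩ E2x hz
      ((kk' z hz).mul (hp0 (sp 1 (hQi 3)) e hz))
      ((hp0 (sp 1 (sp 0 (hQi 1))) u1 hz).add
        ((kk z hz).mul (hp0 (sp 1 sB) (zs sB B_u 1) hz)))
    have : g (z 0) * (deriv (deriv k) (z 3) * pd 1 (fun w => Q w 3) z) = 0 := by
      linear_combination h + g (z 0) * deriv k (z 3) * B_x z hz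
    simpa [g0 z hz] using this
  have θ_t : ∀ z ∈ Ω, pd 0 (fun w => Q w 3) z = 0 := fun z hz => by
    linear_combination E4 z hz - g (z 0) * k (z 3) * θ_x z hz
  have ξ_tx : ∀ z ∈ Ω, pd 1 (pd 0 (fun w => Q w 1)) z = 0 := fun z hz => by
    linear_combination -E2x z hz + g (z 0) * deriv k (z 3) * θ_x z hz
      - g (z 0) * k (z 3) * B_x z hz
  have B_t : ∀ z ∈ Ω, pd 0 Bf z = 0 := by
    refine vanish (sp 0 sB) (aff (zs sB B_u 0)) fun z hz => ?_
    have : g (z 0) ^ 2 * (deriv k (z 3) * pd 0 Bf z) = 0 := by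
      linear_combination E2tu z hz - g (z 0) ^ 2 * deriv k (z 3) * ξ_tx z hz
        - 2 * g (z 0) ^ 3 * k (z 3) * deriv k (z 3) * B_x z hz
    simpa [g0 z hz] using this
  have ξ_tt : ∀ z ∈ Ω, g (z 0) * pd 0 (pd 0 (fun w => Q w 1)) z
      = deriv g (z 0) * pd 0 (fun w => Q w 1) z := fun z hz => by
    linear_combination -E2t z hz - g (z 0) ^ 2 * k (z 3) * (ξ_tx z hz + B_t z hz)
      - (g (z 0) * k (z 3)) ^ 2 * g (z 0) * B_x z hz
  have hc : ∀ {F : Pt → ℝ}, ContDiffOn ℝ ∞ F Ω → (∀ i, ∀ z ∈ Ω, HasPd i F 0 z) →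
      ∃ c, ∀ z ∈ Ω, F z = c := fun hF h =>
    exists_eq_const_of_pd_eq_zero hΩ hΩc hF fun i z hz =>
      HasPd.pd_eq (differentiableAt_of_contDiffOn hΩ hF hz) (h i z hz)
  have sG := contDiffOn_coord H.contDiffOn_G m0
  have sx : ∀ i, ContDiffOn ℝ ∞ (fun z : Pt => z i) Ω := fun i => by fun_prop
  have hid : ∀ (i : Fin 4) (z : Pt), HasPd i (fun z => z i) 1 z := fun i z =>
    HasPd.coord (f := fun s => s) (hasDerivAt_id' _)
  have hne : ∀ {i j : Fin 4} (z : Pt), j ≠ i → HasPd i (fun z => z j) 0 z := fun z h =>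
    HasPd.coord_ne (f := fun s => s) h
  have gne : ∀ {i : Fin 4} (z : Pt) (f : ℝ → ℝ), 0 ≠ i → HasPd i (fun z => f (z 0)) 0 z :=
    fun z f h => HasPd.coord_ne h
  -- `θ`
  obtain ⟨φ, hφ⟩ : ∃ φ, ∀ z ∈ Ω, pd 3 (fun w => Q w 3) z = φ := by
    refine hc (sp 3 (hQi 3)) fun i z hz => hp0 (sp 3 (hQi 3)) ?_ hz
    fin_cases i
    exacts [zs (hQi 3) θ_t 3, zs (hQi 3) θ_x 3, zs (hQi 3) θ_y 3, D.θ_uu]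
  obtain ⟨ψ, hψ⟩ : ∃ ψ, ∀ z ∈ Ω, Q z 3 - φ * z 3 = ψ := by
    refine hc ((hQi 3).sub (contDiffOn_const.mul (sx 3))) fun i z hz => ?_
    fin_cases i
    · simpa using (hp0 (hQi 3) θ_t hz).sub ((hne z (by decide)).const_mul φ)
    · simpa using (hp0 (hQi 3) θ_x hz).sub ((hne z (by decide)).const_mul φ)
    · simpa using (hp0 (hQi 3) θ_y hz).sub ((hne z (by decide)).const_mul φ)
    · simpa [hφ z hz] using (hp 3 (hQi 3) hz).sub ((hid 3 z).const_mul φ)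
  -- `η`
  obtain ⟨a, ha⟩ : ∃ a, ∀ z ∈ Ω, pd 2 (fun w => Q w 2) z = a := by
    refine hc (sp 2 (hQi 2)) fun i z hz => hp0 (sp 2 (hQi 2)) ?_ hz
    fin_cases i
    exacts [zs (hQi 2) η_t 2, zs (hQi 2) η_x 2, η_yy, zs (hQi 2) D.η_u 2]
  obtain ⟨η₀, hη₀⟩ : ∃ η₀, ∀ z ∈ Ω, Q z 2 - a * z 2 = η₀ := by
    refine hc ((hQi 2).sub (contDiffOn_const.mul (sx 2))) fun i z hz => ?_
    fin_cases i
    · simpa using (hp0 (hQi 2) η_t hz).sub ((hne z (by decide)).const_mul a)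
    · simpa using (hp0 (hQi 2) η_x hz).sub ((hne z (by decide)).const_mul a)
    · simpa [ha z hz] using (hp 2 (hQi 2) hz).sub ((hid 2 z).const_mul a)
    · simpa using (hp0 (hQi 2) D.η_u hz).sub ((hne z (by decide)).const_mul a)
  -- `A`, `B`
  obtain ⟨B, hB⟩ : ∃ B, ∀ z ∈ Ω, Bf z = B := by
    refine hc sB fun i z hz => hp0 sB ?_ hz
    fin_cases i
    exacts [B_t, B_x, B_y, B_u]
  have sg : ContDiffOn ℝ ∞ (fun t => (g t)⁻¹) T := H.smooth_g.inv H.g_ne_zero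
  -- The relation `ξ_tt` states that `ξ_t / g` has zero `t`-derivative.
  obtain ⟨A, hA⟩ : ∃ A, ∀ z ∈ Ω, pd 0 (fun w => Q w 1) z * (g (z 0))⁻¹ = A := by
    refine hc ((sp 0 (hQi 1)).mul (contDiffOn_coord sg m0)) fun i z hz => ?_
    fin_cases i
    · have := (hp 0 (sp 0 (hQi 1)) hz).mul
        (HasPd.coord (f := fun t => (g t)⁻¹) ((dg z hz).inv (g0 z hz)))
      refine HasDerivAt.congr_deriv this ?_
      have := g0 z hz
      field_simp
      linear_combination ξ_tt z hz
    · simpa using (hp0 (sp 0 (hQi 1)) ξ_tx hz).mul (gne z (fun t => (g t)⁻¹) (by decide))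
    · simpa using (hp0 (sp 0 (hQi 1)) (zs (hQi 1) D.ξ_y 0) hz).mul
        (gne z (fun t => (g t)⁻¹) (by decide))
    · simpa using (hp0 (sp 0 (hQi 1)) ξ_tu hz).mul (gne z (fun t => (g t)⁻¹) (by decide))
  have hA' : ∀ z ∈ Ω, pd 0 (fun w => Q w 1) z = A * g (z 0) := fun z hz => by
    rw [← hA z hz]
    have := g0 z hz
    field_simp
  -- `τ`, `ξ`
  have τ_tx : ∀ z ∈ Ω, pd 1 (pd 0 (fun w => Q w 0)) z = 0 := zs (hQi 0) τ_x 0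
  have hB' : ∀ z ∈ Ω, pd 1 (fun w => Q w 1) z = B + pd 0 (fun w => Q w 0) z
      + Q z 0 * (deriv g (z 0) / g (z 0)) := fun z hz => by
    have h := hB z hz
    rw [hBf] at h
    linear_combination h
  obtain ⟨e, he⟩ : ∃ e, ∀ z ∈ Ω, pd 1 (fun w => Q w 1) z = e := by
    refine hc (sp 1 (hQi 1)) fun i z hz => hp0 (sp 1 (hQi 1)) ?_ hz
    fin_cases i
    · intro z hz
      exact (pd_comm hΩ (hQi 1) 0 1 z hz).trans (ξ_tx z hz)
    · intro z hz
      have h := HasPd.unique_of_eqOn hΩ hB' hz (hp 1 (sp 1 (hQi 1)) hz)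
        (((HasPd.const B 1 z).add (hp0 (sp 0 (hQi 0)) τ_tx hz)).add
          ((hp0 (hQi 0) τ_x hz).mul (gne z (fun t => deriv g t / g t) (by decide))))
      simpa using h
    exacts [zs (hQi 1) D.ξ_y 1, zs (hQi 1) D.ξ_u 1]
  -- By `hB'`, `(τ g)_t = (ξ_x - B) g`. With `c₁ = ξ_x - B`, the function `τ g - c₁ G` is constant.
  obtain ⟨c₁, rfl⟩ : ∃ c₁, e = B + c₁ := ⟨e - B, by ring⟩
  obtain ⟨c₀, hc₀⟩ : ∃ c₀, ∀ z ∈ Ω, Q z 0 * g (z 0) - c₁ * G (z 0) = c₀ := by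
    refine hc (((hQi 0).mul (contDiffOn_coord H.smooth_g m0)).sub (contDiffOn_const.mul sG))
      fun i z hz => ?_
    fin_cases i
    · have := ((hp 0 (hQi 0) hz).mul (HasPd.coord (f := g) (dg z hz))).sub
        ((HasPd.coord (f := G) (dG z hz)).const_mul c₁)
      refine HasDerivAt.congr_deriv this ?_
      have h := hB' z hz
      rw [he z hz] at h
      have := g0 z hz
      field_simp at h
      linear_combination -h
    · simpa using ((hp0 (hQi 0) τ_x hz).mul (gne z g (by decide))).sub
        ((gne z G (by decide)).const_mul c₁)
    · simpa using ((hp0 (hQi 0) D.τ_y hz).mul (gne z g (by decide))).sub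
        ((gne z G (by decide)).const_mul c₁)
    · simpa using ((hp0 (hQi 0) D.τ_u hz).mul (gne z g (by decide))).sub
        ((gne z G (by decide)).const_mul c₁)
  obtain ⟨ξ₀, hξ₀⟩ : ∃ ξ₀, ∀ z ∈ Ω, Q z 1 - A * G (z 0) - (B + c₁) * z 1 = ξ₀ := by
    refine hc (((hQi 1).sub (contDiffOn_const.mul sG)).sub (contDiffOn_const.mul (sx 1)))
      fun i z hz => ?_
    fin_cases i
    · simpa [hA' z hz] using ((hp 0 (hQi 1) hz).sub ((HasPd.coord (f := G) (dG z hz)).const_mul A)).sub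
        ((hne z (by decide)).const_mul (B + c₁))
    · simpa [he z hz] using ((hp 1 (hQi 1) hz).sub ((gne z G (by decide)).const_mul A)).sub
        ((hid 1 z).const_mul (B + c₁))
    · simpa using ((hp0 (hQi 1) D.ξ_y hz).sub ((gne z G (by decide)).const_mul A)).sub
        ((hne z (by decide)).const_mul (B + c₁))
    · simpa using ((hp0 (hQi 1) D.ξ_u hz).sub ((gne z G (by decide)).const_mul A)).sub
        ((hne z (by decide)).const_mul (B + c₁))
  obtain ⟨t₁, ht₁⟩ := hT.2.2
  obtain ⟨x₁, hx₁⟩ := hX.2.2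
  obtain ⟨y₁, hy₁⟩ := hY.2.2
  refine ⟨ξ₀, η₀, φ, ψ, A, B, c₀, c₁, a, ⟨fun u hu => ?_, fun t ht => ?_⟩, fun z hz => ?_⟩
  · have hz : (![t₁, x₁, y₁, u] : Pt) ∈ Ω := ⟨ht₁, hx₁, hy₁, hu⟩
    have h := E2 _ hz
    rw [hA' _ hz, hB _ hz] at h
    have h' := hψ _ hz
    have h0 := g0 _ hz
    simp only [Matrix.cons_val] at h h' h0
    have : g t₁ * ((φ * u + ψ) * deriv k u - (A + B * k u)) = 0 := by
      linear_combination h - g t₁ * deriv k u * h'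
    linear_combination (mul_eq_zero.1 this).resolve_left h0
  · have hz : (![t, x₁, y₁, u₀] : Pt) ∈ Ω := ⟨ht, hx₁, hy₁, hu₀⟩
    have h := D.coeff_u_yy _ hz
    have h1 := hB' _ hz
    have h2 := hc₀ _ hz
    rw [ha _ hz, τ_x _ hz] at h
    rw [he _ hz] at h1
    simp only [Matrix.cons_val] at h h1 h2
    have h0 := H.g_ne_zero t ht
    have hd := ((differentiableAt_of_contDiffOn hT.1 H.smooth_f ht).hasDerivAt.div
      (differentiableAt_of_contDiffOn hT.1 H.smooth_g ht).hasDerivAt h0).deriv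
    change deriv (fun s => f s / g s) t = _ at hd
    rw [hd]
    have h3 : c₁ * G t + c₀ = Q ![t, x₁, y₁, u₀] 0 * g t := by linear_combination -h2
    rw [h3]
    have h4 : pd 0 (fun w => Q w 0) ![t, x₁, y₁, u₀]
        = c₁ - Q ![t, x₁, y₁, u₀] 0 * (deriv g t / g t) := by linear_combination -h1
    rw [h4] at h
    field_simp at h ⊢
    linear_combination h
  · have h0 := g0 z hz
    ext i
    fin_cases i
    · simp only [symField, Fin.zero_eta, Matrix.cons_val]
      rw [eq_div_iff h0]
      linear_combination hc₀ z hz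
    · simp only [symField, Fin.mk_one, Matrix.cons_val]
      linear_combination hξ₀ z hz
    · simp only [symField, Fin.reduceFinMk, Matrix.cons_val]
      linear_combination hη₀ z hz
    · simp only [symField, Fin.reduceFinMk, Matrix.cons_val]
      linear_combination hψ z hz

/-- Direct substitution: the `u_yy` equation becomes the condition on `f`, the `u_x` equation
becomes the condition on `k`, and the others hold identically. -/
lemma isLieSymmetry_of_params {T X Y U : Set ℝ} {f g G k : ℝ → ℝ} (H : Coeffs T U f g G k)
    (hX : IsOpenInterval X) (hY : IsOpenInterval Y) {Q : VF} {ξ₀ η₀ φ ψ A B c₀ c₁ a : ℝ}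
    (P : SymParams T U f g G k φ ψ A B c₀ c₁ a)
    (hQ : ∀ z ∈ box T X Y U, Q z = symField g G ξ₀ η₀ φ ψ A B c₀ c₁ a z) :
    ContDiffOn ℝ ∞ Q (box T X Y U) ∧ DetEqs (box T X Y U) f g k Q := by
  have hT := H.isOpenInterval_T
  have hU := H.isOpenInterval_U
  set Ω := box T X Y U with hΩdef
  have hΩ : IsOpen Ω := isOpen_box hT.1 hX.1 hY.1 hU.1
  have m0 : ∀ z ∈ Ω, z 0 ∈ T := fun z hz => hz.1
  have m3 : ∀ z ∈ Ω, z 3 ∈ U := fun z hz => hz.2.2.2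
  have g0 : ∀ z ∈ Ω, g (z 0) ≠ 0 := fun z hz => H.g_ne_zero _ (m0 z hz)
  have sG := H.contDiffOn_G
  have dg : ∀ z ∈ Ω, HasDerivAt g (deriv g (z 0)) (z 0) := fun z hz =>
    (differentiableAt_of_contDiffOn hT.1 H.smooth_g (m0 z hz)).hasDerivAt
  have sτ : ContDiffOn ℝ ∞ (fun t => (c₁ * G t + c₀) / g t) T :=
    ((contDiffOn_const.mul sG).add contDiffOn_const).div H.smooth_g H.g_ne_zero
  have dτ : ∀ z ∈ Ω, HasDerivAt (fun t => (c₁ * G t + c₀) / g t)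
      ((c₁ * g (z 0) * g (z 0) - (c₁ * G (z 0) + c₀) * deriv g (z 0)) / g (z 0) ^ 2) (z 0) :=
    fun z hz => (((H.hasDerivAt_G _ (m0 z hz)).const_mul c₁).add_const c₀).div (dg z hz) (g0 z hz)
  have q0 : ∀ z ∈ Ω, (c₁ * G (z 0) + c₀) / g (z 0) = Q z 0 := fun z hz => by rw [hQ z hz]; rfl
  have q1 : ∀ z ∈ Ω, A * G (z 0) + (B + c₁) * z 1 + ξ₀ = Q z 1 := fun z hz => by rw [hQ z hz]; rfl
  have q2 : ∀ z ∈ Ω, a * z 2 + η₀ = Q z 2 := fun z hz => by rw [hQ z hz]; rfl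
  have q3 : ∀ z ∈ Ω, φ * z 3 + ψ = Q z 3 := fun z hz => by rw [hQ z hz]; rfl
  have sx : ∀ i, ContDiffOn ℝ ∞ (fun z : Pt => z i) Ω := fun i => by fun_prop
  have s0 : ContDiffOn ℝ ∞ (fun w => Q w 0) Ω :=
    (contDiffOn_coord sτ m0).congr fun z hz => (q0 z hz).symm
  have s1 : ContDiffOn ℝ ∞ (fun w => Q w 1) Ω :=
    (((contDiffOn_const.mul (contDiffOn_coord sG m0)).add (contDiffOn_const.mul (sx 1))).add
      contDiffOn_const).congr fun z hz => (q1 z hz).symm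
  have s2 : ContDiffOn ℝ ∞ (fun w => Q w 2) Ω :=
    ((contDiffOn_const.mul (sx 2)).add contDiffOn_const).congr fun z hz => (q2 z hz).symm
  have s3 : ContDiffOn ℝ ∞ (fun w => Q w 3) Ω :=
    ((contDiffOn_const.mul (sx 3)).add contDiffOn_const).congr fun z hz => (q3 z hz).symm
  have hid : ∀ (i : Fin 4) (z : Pt), HasPd i (fun z => z i) 1 z := fun i z =>
    HasPd.coord (f := fun s => s) (hasDerivAt_id' _)
  have hne : ∀ {i j : Fin 4} (z : Pt), j ≠ i → HasPd i (fun z => z j) 0 z := fun z h =>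
    HasPd.coord_ne (f := fun s => s) h
  have key : ∀ {F F' : Pt → ℝ} {i : Fin 4} {d : ℝ} {z : Pt}, ContDiffOn ℝ ∞ F' Ω →
      Set.EqOn F F' Ω → z ∈ Ω → HasPd i F d z → pd i F' z = d := fun hF h hz hd =>
    HasPd.pd_eq (differentiableAt_of_contDiffOn hΩ hF hz) (hd.congr hΩ h hz)
  have p0 : ∀ z ∈ Ω, pd 0 (fun w => Q w 0) z = _ := fun z hz =>
    key s0 q0 hz (HasPd.coord (f := fun t => (c₁ * G t + c₀) / g t) (dτ z hz))
  have p0' : ∀ i, 0 ≠ i → ∀ z ∈ Ω, pd i (fun w => Q w 0) z = 0 := fun i hi z hz =>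
    key s0 q0 hz (HasPd.coord_ne (f := fun t => (c₁ * G t + c₀) / g t) hi)
  have p1 : ∀ z ∈ Ω, pd 0 (fun w => Q w 1) z = A * g (z 0) := fun z hz => by
    have := ((HasPd.coord (f := G) (H.hasDerivAt_G _ (m0 z hz))).const_mul A).add
      ((hne (i := 0) (j := 1) z (by decide)).const_mul (B + c₁)) |>.add (HasPd.const ξ₀ 0 z)
    simpa using key s1 q1 hz this
  have p1x : ∀ z ∈ Ω, pd 1 (fun w => Q w 1) z = B + c₁ := fun z hz => by
    have := ((HasPd.coord_ne (f := G) (i := 1) (j := 0) (by decide)).const_mul A).add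
      ((hid 1 z).const_mul (B + c₁)) |>.add (HasPd.const ξ₀ 1 z)
    simpa using key s1 q1 hz this
  have p1' : ∀ i, 0 ≠ i → 1 ≠ i → ∀ z ∈ Ω, pd i (fun w => Q w 1) z = 0 := fun i hi hi' z hz => by
    have := ((HasPd.coord_ne (f := G) (i := i) (j := 0) hi).const_mul A).add
      ((hne z hi').const_mul (B + c₁)) |>.add (HasPd.const ξ₀ i z)
    simpa using key s1 q1 hz this
  have p2 : ∀ z ∈ Ω, pd 2 (fun w => Q w 2) z = a := fun z hz => by
    simpa using key s2 q2 hz (((hid 2 z).const_mul a).add (HasPd.const η₀ 2 z))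
  have p2' : ∀ i, 2 ≠ i → ∀ z ∈ Ω, pd i (fun w => Q w 2) z = 0 := fun i hi z hz => by
    simpa using key s2 q2 hz (((hne z hi).const_mul a).add (HasPd.const η₀ i z))
  have p3 : ∀ z ∈ Ω, pd 3 (fun w => Q w 3) z = φ := fun z hz => by
    simpa using key s3 q3 hz (((hid 3 z).const_mul φ).add (HasPd.const ψ 3 z))
  have p3' : ∀ i, 3 ≠ i → ∀ z ∈ Ω, pd i (fun w => Q w 3) z = 0 := fun i hi z hz => by
    simpa using key s3 q3 hz (((hne z hi).const_mul φ).add (HasPd.const ψ i z))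
  refine ⟨contDiffOn_pi.2 fun i => ?_, p0' 2 (by decide), p0' 3 (by decide),
    p1' 2 (by decide) (by decide), p1' 3 (by decide) (by decide), p2' 3 (by decide),
    pd_eq_zero_of_eqOn_const hΩ p3 3, fun z hz => ?_, fun z hz => ?_, fun z hz => ?_,
    fun z hz => ?_⟩
  · fin_cases i
    exacts [s0, s1, s2, s3]
  · have h := P.fSol _ (m0 z hz)
    have hd := ((differentiableAt_of_contDiffOn hT.1 H.smooth_f (m0 z hz)).hasDerivAt.div
      (dg z hz) (g0 z hz)).deriv
    change deriv (fun s => f s / g s) (z 0) = _ at hd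
    rw [hd] at h
    rw [p0 z hz, p2 z hz, p0' 1 (by decide) z hz, ← q0 z hz]
    have := g0 z hz
    field_simp at h ⊢
    linear_combination h
  · have h := P.kSol _ (m3 z hz)
    rw [p0 z hz, p1 z hz, p1x z hz, p0' 1 (by decide) z hz, ← q0 z hz, ← q3 z hz]
    have := g0 z hz
    field_simp
    linear_combination g (z 0) ^ 2 * h
  · rw [p2' 0 (by decide) z hz, p2' 1 (by decide) z hz, pd_eq_zero_of_eqOn_const hΩ p2 2 z hz,
      pd_eq_zero_of_eqOn_const hΩ p3 2 z hz]
    simp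
  · rw [p3' 0 (by decide) z hz, p3' 1 (by decide) z hz,
      pd_eq_zero_of_eqOn_const hΩ (p3' 2 (by decide)) 2 z hz]
    simp

/-- The general form of the Lie symmetries of `u_t = f(t) u_yy - g(t) k(u) u_x`. -/
theorem isLieSymmetry_iff {T X Y U : Set ℝ} {f g G k : ℝ → ℝ} (H : Coeffs T U f g G k)
    (hX : IsOpenInterval X) (hY : IsOpenInterval Y) (Q : VF) :
    IsLieSymmetry (box T X Y U) (kolmogorov f g k) Q ↔
      ∃ ξ₀ η₀ φ ψ A B c₀ c₁ a, SymParams T U f g G k φ ψ A B c₀ c₁ a ∧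
        ∀ z ∈ box T X Y U, Q z = symField g G ξ₀ η₀ φ ψ A B c₀ c₁ a z := by
  have hT := H.isOpenInterval_T
  have hU := H.isOpenInterval_U
  rw [isLieSymmetry_iff_detEqs (isOpen_box hT.1 hX.1 hY.1 hU.1)
    (fun z hz => differentiableAt_of_contDiffOn hT.1 H.smooth_f hz.1)
    (fun z hz => differentiableAt_of_contDiffOn hT.1 H.smooth_g hz.1)
    (fun z hz => differentiableAt_of_contDiffOn hU.1 H.smooth_k hz.2.2.2)
    (fun z hz => H.f_ne_zero _ hz.1)]
  constructor
  · rintro ⟨hQ, D⟩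
    exact D.exists_params H hX hY hQ
  · rintro ⟨ξ₀, η₀, φ, ψ, A, B, c₀, c₁, a, P, h⟩
    exact isLieSymmetry_of_params H hX hY P h

/-- The parameters of a symmetry are determined by its values on a box. -/
lemma symField_eq_zero {T X Y U : Set ℝ} {f g G k : ℝ → ℝ} (H : Coeffs T U f g G k)
    (hX : IsOpenInterval X) (hY : IsOpenInterval Y) {ξ₀ η₀ φ ψ A B c₀ c₁ a : ℝ}
    (h : ∀ z ∈ box T X Y U, symField g G ξ₀ η₀ φ ψ A B c₀ c₁ a z = 0) :
    ξ₀ = 0 ∧ η₀ = 0 ∧ φ = 0 ∧ ψ = 0 ∧ A = 0 ∧ B = 0 ∧ c₀ = 0 ∧ c₁ = 0 ∧ a = 0 := by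
  have two : ∀ {I : Set ℝ}, IsOpenInterval I → ∃ s ∈ I, ∃ t ∈ I, s < t := fun {I} hI => by
    obtain ⟨s, hs⟩ := hI.2.2
    obtain ⟨t, ht, hI'⟩ := (mem_nhdsGT_iff_exists_Ioo_subset' (lt_add_one s)).1
      (mem_nhdsWithin_of_mem_nhds (hI.1.mem_nhds hs))
    refine ⟨s, hs, (s + t) / 2, hI' ⟨?_, ?_⟩, ?_⟩ <;> linarith [Set.mem_Ioi.1 ht]
  obtain ⟨t, ht, t', ht', htt⟩ := two H.isOpenInterval_T
  obtain ⟨x, hx, x', hx', hxx⟩ := two hX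
  obtain ⟨y, hy, y', hy', hyy⟩ := two hY
  obtain ⟨u, hu, u', hu', huu⟩ := two H.isOpenInterval_U
  -- Rolle's theorem: `G_t = g` has no zeros. Two values of each of `G`, `x`, `y`, `u` then
  -- determine the affine coefficients.
  have hG : G t ≠ G t' := fun hG => by
    obtain ⟨s, hs, hs'⟩ := exists_hasDerivAt_eq_zero (f := G) (f' := g) htt
      (H.contDiffOn_G.continuousOn.mono (H.isOpenInterval_T.2.1.out ht ht')) hG
      (fun s hs => H.hasDerivAt_G s (H.isOpenInterval_T.2.1.out ht ht' ⟨hs.1.le, hs.2.le⟩))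
    exact H.g_ne_zero s (H.isOpenInterval_T.2.1.out ht ht' ⟨hs.1.le, hs.2.le⟩) hs'
  have key : ∀ t ∈ T, ∀ x ∈ X, ∀ y ∈ Y, ∀ u ∈ U, c₁ * G t + c₀ = 0 ∧
      A * G t + (B + c₁) * x + ξ₀ = 0 ∧ a * y + η₀ = 0 ∧ φ * u + ψ = 0 := by
    intro t ht x hx y hy u hu
    have h1 := h ![t, x, y, u] ⟨ht, hx, hy, hu⟩
    have e0 := congrFun h1 0
    have e1 := congrFun h1 1
    have e2 := congrFun h1 2
    have e3 := congrFun h1 3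
    simp only [symField, Matrix.cons_val, Pi.zero_apply] at e0 e1 e2 e3
    exact ⟨(div_eq_zero_iff.1 e0).resolve_right (H.g_ne_zero t ht), e1, e2, e3⟩
  obtain ⟨a1, a2, a3, a4⟩ := key t ht x hx y hy u hu
  obtain ⟨b1, b2, -, -⟩ := key t' ht' x hx y hy u hu
  obtain ⟨-, d2, d3, d4⟩ := key t ht x' hx' y' hy' u' hu'
  have lin : ∀ {m p q : ℝ}, p ≠ q → m * (p - q) = 0 → m = 0 := fun hpq h =>
    (mul_eq_zero.1 h).resolve_right (sub_ne_zero.2 hpq)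
  have hc₁ : c₁ = 0 := lin hG (by linear_combination a1 - b1)
  have hA : A = 0 := lin hG (by linear_combination a2 - b2)
  have hB : B + c₁ = 0 := lin hxx.ne (by linear_combination a2 - d2)
  have ha : a = 0 := lin hyy.ne (by linear_combination a3 - d3)
  have hφ : φ = 0 := lin huu.ne (by linear_combination a4 - d4)
  subst hc₁ hA ha hφ
  obtain rfl : B = 0 := by linarith
  refine ⟨?_, ?_, rfl, ?_, rfl, rfl, ?_, rfl, rfl⟩ <;> linarith

/-! ### Solutions of `(φ u + ψ) k_u = A + B k` -/

lemma exists_ne_mem_of_mem_nhds {s : Set ℝ} {x : ℝ} (h : s ∈ nhds x) : ∃ y ∈ s, y ≠ x :=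
  (infinite_of_mem_nhds x h).nontrivial.exists_ne x

section
variable {U : Set ℝ} {k : ℝ → ℝ}

lemma hasDerivAt_of_smooth (hU : IsOpen U) (hk : ContDiffOn ℝ ∞ k U) {u : ℝ} (hu : u ∈ U) :
    HasDerivAt k (deriv k u) u := (differentiableAt_of_contDiffOn hU hk hu).hasDerivAt

lemma deriv_eqOn_of_eqOn (hU : IsOpen U) {h : ℝ → ℝ} (e : Set.EqOn k h U) {u d : ℝ} (hu : u ∈ U)
    (hd : HasDerivAt h d u) : deriv k u = d :=
  (hd.congr_of_eventuallyEq (e.eventuallyEq_of_mem (hU.mem_nhds hu))).deriv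

lemma exists_eq_const_of_deriv (hU : IsOpenInterval U) (h : ∀ u ∈ U, HasDerivAt k 0 u) :
    ∃ C, ∀ u ∈ U, k u = C :=
  hU.1.exists_is_const_of_deriv_eq_zero hU.2.1.isPreconnected
    (fun u hu => (h u hu).differentiableAt.differentiableWithinAt) (fun u hu => (h u hu).deriv)

lemma deriv_deriv_eq_zero_of_affine (hU : IsOpen U) {a b : ℝ} (h : ∀ u ∈ U, k u = a * u + b) :
    ∀ u ∈ U, deriv (deriv k) u = 0 := by
  have h1 : ∀ u ∈ U, deriv k u = a := fun u hu => deriv_eqOn_of_eqOn hU h hu (by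
    simpa using ((hasDerivAt_id' u).const_mul a).add_const b)
  exact fun u hu => deriv_eqOn_of_eqOn hU h1 hu (hasDerivAt_const _ _)

/-- Differentiation removes the constant `A`. -/
lemma KSol.deriv_eq {φ ψ A B : ℝ} (h : KSol U k φ ψ A B) (hU : IsOpen U)
    (hk : ContDiffOn ℝ ∞ k U) {u : ℝ} (hu : u ∈ U) :
    φ * deriv k u + (φ * u + ψ) * deriv (deriv k) u = B * deriv k u := by
  have h1 := (((hasDerivAt_id' u).const_mul φ).add_const ψ).mul
    (hasDerivAt_of_smooth hU (contDiffOn_deriv hU hk) hu)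
  have h2 := ((hasDerivAt_of_smooth hU hk hu).const_mul B).const_add A
  have h3 : (fun u => (φ * u + ψ) * deriv k u) =ᶠ[nhds u] fun u => A + B * k u :=
    Set.EqOn.eventuallyEq_of_mem h (hU.mem_nhds hu)
  have := (h1.congr_of_eventuallyEq h3.symm).unique h2
  linear_combination this

lemma KSol.sub_mul {φ ψ A B φ' ψ' A' B' : ℝ} (h : KSol U k φ ψ A B) (h' : KSol U k φ' ψ' A' B')
    (s : ℝ) : KSol U k (φ' - s * φ) (ψ' - s * ψ) (A' - s * A) (B' - s * B) := fun u hu => by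
  linear_combination h' u hu - s * h u hu

lemma KSol.eq_zero {A B : ℝ} (h : KSol U k 0 0 A B) (hU : IsOpen U) (hk : ContDiffOn ℝ ∞ k U)
    (hn : ∃ u ∈ U, deriv (deriv k) u ≠ 0) : A = 0 ∧ B = 0 := by
  obtain ⟨u, hu, hne⟩ := exists_deriv_ne_zero hU hn
  have h1 := h.deriv_eq hU hk hu
  simp only [zero_mul, add_zero] at h1
  obtain rfl : B = 0 := (mul_eq_zero.1 h1.symm).resolve_right hne
  have := h u hu
  simp only [zero_mul, add_zero] at this
  exact ⟨this.symm, rfl⟩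

/-- Let `D` be the determinant. Eliminating `k_uu` from the two differentiated relations gives `D =
B (φ' u + ψ') - B' (φ u + ψ)` wherever `k_u ≠ 0`. Comparing two such points shows that this affine
function has no linear term. If `D ≠ 0`, it follows that `φ = B` and `φ' = B'`, so the
differentiated relations become `(φ u + ψ) k_uu = 0` and `(φ' u + ψ') k_uu = 0`. At a point with
`k_uu ≠ 0` both affine functions vanish, which forces `D = 0`. -/
lemma KSol.det_eq_zero {φ ψ A B φ' ψ' A' B' : ℝ} (h : KSol U k φ ψ A B)
    (h' : KSol U k φ' ψ' A' B') (hU : IsOpen U) (hk : ContDiffOn ℝ ∞ k U)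
    (hn : ∃ u ∈ U, deriv (deriv k) u ≠ 0) : φ * ψ' - φ' * ψ = 0 := by
  by_contra hD
  have key : ∀ u ∈ U, deriv k u ≠ 0 →
      φ * ψ' - φ' * ψ = B * (φ' * u + ψ') - B' * (φ * u + ψ) := by
    intro u hu hne
    apply mul_right_cancel₀ hne
    linear_combination (φ' * u + ψ') * h.deriv_eq hU hk hu - (φ * u + ψ) * h'.deriv_eq hU hk hu
  obtain ⟨v, hv, hne⟩ := exists_deriv_ne_zero hU hn
  have hev : {u | u ∈ U ∧ deriv k u ≠ 0} ∈ nhds v :=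
    Filter.Eventually.and (hU.mem_nhds hv)
      (((contDiffOn_deriv hU hk).continuousOn.continuousAt (hU.mem_nhds hv)).eventually_ne hne)
  obtain ⟨w, ⟨hw, hwne⟩, hwv⟩ := exists_ne_mem_of_mem_nhds hev
  have e1 := key v hv hne
  have e2 := key w hw hwne
  have e3 : B * φ' - B' * φ = 0 := by
    apply (mul_eq_zero.1 (_ : (B * φ' - B' * φ) * (w - v) = 0)).resolve_right (sub_ne_zero.2 hwv)
    linear_combination e1 - e2
  have e4 : φ = B := mul_right_cancel₀ hD (by linear_combination φ * e1 + (φ * v + ψ) * e3)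
  have e5 : φ' = B' := mul_right_cancel₀ hD (by linear_combination φ' * e1 + (φ' * v + ψ') * e3)
  obtain ⟨u, hu, hune⟩ := hn
  have l1 : φ * u + ψ = 0 := (mul_eq_zero.1 (by
    linear_combination h.deriv_eq hU hk hu - deriv k u * e4 :
      (φ * u + ψ) * deriv (deriv k) u = 0)).resolve_right hune
  have l2 : φ' * u + ψ' = 0 := (mul_eq_zero.1 (by
    linear_combination h'.deriv_eq hU hk hu - deriv k u * e5 :
      (φ' * u + ψ') * deriv (deriv k) u = 0)).resolve_right hune
  exact hD (by linear_combination φ * l2 - φ' * l1)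

/-- The solution space is at most one-dimensional. -/
lemma KSol.exists_eq_mul {φ ψ A B φ' ψ' A' B' : ℝ} (h : KSol U k φ ψ A B)
    (h' : KSol U k φ' ψ' A' B') (h0 : φ ≠ 0 ∨ ψ ≠ 0) (hU : IsOpen U) (hk : ContDiffOn ℝ ∞ k U)
    (hn : ∃ u ∈ U, deriv (deriv k) u ≠ 0) :
    ∃ s, φ' = s * φ ∧ ψ' = s * ψ ∧ A' = s * A ∧ B' = s * B := by
  have hD := h.det_eq_zero h' hU hk hn
  obtain ⟨s, hs, hs'⟩ : ∃ s, φ' = s * φ ∧ ψ' = s * ψ := by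
    rcases h0 with h0 | h0
    · refine ⟨φ' / φ, by field_simp, ?_⟩
      field_simp
      linear_combination hD
    · refine ⟨ψ' / ψ, ?_, by field_simp⟩
      field_simp
      linear_combination -hD
  have h2 := h.sub_mul h' s
  rw [← hs, ← hs', sub_self, sub_self] at h2
  obtain ⟨hA, hB⟩ := h2.eq_zero hU hk hn
  exact ⟨s, hs, hs', sub_eq_zero.1 hA, sub_eq_zero.1 hB⟩

/-! ### Reduction of `k` to the listed forms -/

/-- `k` is reduced to the form `κ` by affine transformations of `k` and `u`. -/
def KNF (κ : KType) (U : Set ℝ) (k : ℝ → ℝ) : Prop :=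
  ∃ p q α β : ℝ, p ≠ 0 ∧ α ≠ 0 ∧
    κ.Matches ((fun u => p * u + q) '' U) (fun v => α * k ((v - q) / p) + β)

lemma eqOn_affine_iff {p q α β : ℝ} (hp : p ≠ 0) {h : ℝ → ℝ} :
    (∀ v ∈ (fun u => p * u + q) '' U, α * k ((v - q) / p) + β = h v) ↔
      ∀ u ∈ U, α * k u + β = h (p * u + q) := by
  have : ∀ u : ℝ, (p * u + q - q) / p = u := fun u => by field_simp; ring
  exact Set.forall_mem_image.trans (by simp only [this])

lemma kNF_power {n p q α β : ℝ} (hp : p ≠ 0) (hα : α ≠ 0) (h0 : n ≠ 0) (h1 : n ≠ 1)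
    (hn : (∀ u ∈ U, 0 < p * u + q) ∨ ∃ m : ℕ, n = m)
    (h : ∀ u ∈ U, α * k u + β = (p * u + q) ^ n) : KNF (.power n) U k :=
  ⟨p, q, α, β, hp, hα, h0, h1, hn.imp_left fun h => by rintro _ ⟨u, hu, rfl⟩; exact h u hu,
    (eqOn_affine_iff hp (h := fun v => v ^ n)).2 h⟩

lemma kNF_exp {p q α β : ℝ} (hp : p ≠ 0) (hα : α ≠ 0)
    (h : ∀ u ∈ U, α * k u + β = Real.exp (p * u + q)) : KNF .exp U k :=
  ⟨p, q, α, β, hp, hα, (eqOn_affine_iff hp).2 h⟩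

lemma kNF_log {p q α β : ℝ} (hp : p ≠ 0) (hα : α ≠ 0) (hn : ∀ u ∈ U, 0 < p * u + q)
    (h : ∀ u ∈ U, α * k u + β = Real.log (p * u + q)) : KNF .log U k :=
  ⟨p, q, α, β, hp, hα, by rintro _ ⟨u, hu, rfl⟩; exact hn u hu, (eqOn_affine_iff hp).2 h⟩

lemma deriv_eq_of_affine (hU : IsOpen U) {α β : ℝ} (hα : α ≠ 0) {h : ℝ → ℝ}
    (e : ∀ u ∈ U, α * k u + β = h u) {u d : ℝ} (hu : u ∈ U) (hd : HasDerivAt h d u) :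
    deriv k u = d / α :=
  deriv_eqOn_of_eqOn hU (h := fun u => (h u - β) / α)
    (fun v hv => by simp only [← e v hv]; field_simp; ring) hu ((hd.sub_const β).div_const α)

lemma hasDerivAt_affine (p q u : ℝ) : HasDerivAt (fun u => p * u + q) p u := by
  simpa using ((hasDerivAt_id' u).const_mul p).add_const q

/-- Euler's relation for a power of `p u + q`; the shift `β` of `k` contributes the constant term.
-/
lemma kSol_power (hU : IsOpen U) {n p q α β : ℝ} (hα : α ≠ 0) (h0 : n ≠ 0)
    (hn : (∀ u ∈ U, 0 < p * u + q) ∨ ∃ m : ℕ, n = m)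
    (h : ∀ u ∈ U, α * k u + β = (p * u + q) ^ n) : KSol U k p q (n * p * β / α) (n * p) := by
  intro u hu
  -- The base may vanish only when `n` is a natural number; being nonzero it is then at least `1`,
  -- so the power is differentiable at zero as well.
  have h1 : p * u + q ≠ 0 ∨ 1 ≤ n := by
    rcases hn with hn | ⟨m, rfl⟩
    · exact Or.inl (hn u hu).ne'
    · exact Or.inr (by exact_mod_cast Nat.one_le_iff_ne_zero.2 (by simpa using h0))
  rw [deriv_eq_of_affine hU hα h hu ((hasDerivAt_affine p q u).rpow_const h1)]
  have h2 : (p * u + q) * (p * u + q) ^ (n - 1) = (p * u + q) ^ n := by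
    by_cases hx : p * u + q = 0
    · rw [hx, zero_mul, Real.zero_rpow h0]
    · rw [Real.rpow_sub_one hx]; field_simp
  have h3 : k u = ((p * u + q) ^ n - β) / α := by
    field_simp
    linear_combination h u hu
  rw [h3, ← h2]
  ring

lemma kSol_exp (hU : IsOpen U) {p q α β : ℝ} (hα : α ≠ 0)
    (h : ∀ u ∈ U, α * k u + β = Real.exp (p * u + q)) : KSol U k 0 1 (p * β / α) p := by
  intro u hu
  rw [deriv_eq_of_affine hU hα h hu (hasDerivAt_affine p q u).exp]
  have h3 : k u = (Real.exp (p * u + q) - β) / α := by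
    field_simp
    linear_combination h u hu
  rw [h3]
  ring

lemma kSol_log (hU : IsOpen U) {p q α β : ℝ} (hα : α ≠ 0) (hn : ∀ u ∈ U, 0 < p * u + q)
    (h : ∀ u ∈ U, α * k u + β = Real.log (p * u + q)) : KSol U k p q (p / α) 0 := by
  intro u hu
  have := (hn u hu).ne'
  rw [deriv_eq_of_affine hU hα h hu ((hasDerivAt_affine p q u).log this)]
  field_simp
  ring

/-- Each form has a nontrivial solution from which it can be recognised: `φ = 0` for the
exponential, `B / φ = n ≠ 0` for a power, `B / φ = 0` for the logarithm. These data do not change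
when the solution is rescaled. -/
lemma KNF.exists_kSol (hU : IsOpen U) {κ : KType} (hκ : κ ≠ .arbitrary) (h : KNF κ U k) :
    ∃ φ ψ A B, KSol U k φ ψ A B ∧ (φ ≠ 0 ∨ ψ ≠ 0) ∧
      ((∃ n, κ = .power n ∧ n ≠ 0 ∧ φ ≠ 0 ∧ B = n * φ) ∨ (κ = .exp ∧ φ = 0) ∨
        (κ = .log ∧ φ ≠ 0 ∧ B = 0)) := by
  obtain ⟨p, q, α, β, hp, hα, h⟩ := h
  have pos : ∀ {s : Set ℝ}, (fun u => p * u + q) '' U ⊆ s → ∀ u ∈ U, p * u + q ∈ s :=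
    fun h u hu => h ⟨u, hu, rfl⟩
  cases κ with
  | arbitrary => exact absurd rfl hκ
  | power n =>
    obtain ⟨h0, h1, hn, h⟩ := h
    exact ⟨p, q, _, _, kSol_power hU hα h0 (hn.imp_left pos)
      ((eqOn_affine_iff hp (h := fun v => v ^ n)).1 h), Or.inl hp, Or.inl ⟨n, rfl, h0, hp, rfl⟩⟩
  | exp =>
    exact ⟨0, 1, _, _, kSol_exp hU hα ((eqOn_affine_iff hp).1 h), Or.inr one_ne_zero,
      Or.inr (Or.inl ⟨rfl, rfl⟩)⟩
  | log =>
    exact ⟨p, q, _, _, kSol_log hU hα (pos h.1) ((eqOn_affine_iff hp).1 h.2), Or.inl hp,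
      Or.inr (Or.inr ⟨rfl, hp, rfl⟩)⟩

/-- Solutions for the same `k` are proportional, so the data of `KNF.exists_kSol` for the two forms
coincide. -/
lemma KNF.unique (hU : IsOpen U) (hk : ContDiffOn ℝ ∞ k U)
    (hn : ∃ u ∈ U, deriv (deriv k) u ≠ 0) {κ κ' : KType} (hκ : κ ≠ .arbitrary)
    (hκ' : κ' ≠ .arbitrary) (h : KNF κ U k) (h' : KNF κ' U k) : κ = κ' := by
  obtain ⟨φ, ψ, A, B, hS, h0, hc⟩ := h.exists_kSol hU hκ
  obtain ⟨φ', ψ', A', B', hS', h0', hc'⟩ := h'.exists_kSol hU hκ'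
  obtain ⟨s, rfl, rfl, rfl, rfl⟩ := hS.exists_eq_mul hS' h0 hU hk hn
  have hs : s ≠ 0 := by rintro rfl; simp at h0'
  rcases hc with ⟨n, rfl, hn0, hφ, rfl⟩ | ⟨rfl, rfl⟩ | ⟨rfl, hφ, rfl⟩ <;>
  rcases hc' with ⟨n', rfl, hn0', hφ', hB⟩ | ⟨rfl, hφ'⟩ | ⟨rfl, hφ', hB⟩ <;>
  simp_all [mul_left_comm]

/-! ### The solution of `(u - c) h_u = B h` -/

lemma exists_sign {c : ℝ} (hU : IsOpenInterval U) (hc : c ∉ U) :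
    ∃ σ : ℝ, σ ≠ 0 ∧ ∀ u ∈ U, 0 < σ * (u - c) := by
  obtain ⟨v, hv⟩ := hU.2.2
  rcases lt_or_gt_of_ne (fun h => hc (h ▸ hv) : v ≠ c) with h | h
  · refine ⟨-1, by simp, fun u hu => ?_⟩
    by_contra h'
    exact hc (hU.2.1.out hv hu ⟨h.le, by linarith⟩)
  · refine ⟨1, by simp, fun u hu => ?_⟩
    by_contra h'
    exact hc (hU.2.1.out hu hv ⟨by linarith, h.le⟩)

/-- Solutions of `(u - c) h_u = B h` away from the singular point. -/
lemma exists_eq_mul_rpow (hU : IsOpenInterval U) {h : ℝ → ℝ} {c B σ : ℝ}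
    (hσ : ∀ u ∈ U, 0 < σ * (u - c)) (hd : ∀ u ∈ U, HasDerivAt h (deriv h u) u)
    (e : ∀ u ∈ U, (u - c) * deriv h u = B * h u) :
    ∃ C, ∀ u ∈ U, h u = C * (σ * (u - c)) ^ B := by
  obtain ⟨C, hC⟩ : ∃ C, ∀ u ∈ U, h u * (σ * (u - c)) ^ (-B) = C := by
    refine exists_eq_const_of_deriv hU fun u hu => ?_
    have hpos := hσ u hu
    have h1 : HasDerivAt (fun u => σ * (u - c)) σ u := by
      simpa using ((hasDerivAt_id' u).sub_const c).const_mul σ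
    refine ((hd u hu).mul (h1.rpow_const (p := -B) (Or.inl hpos.ne'))).congr_deriv ?_
    rw [Real.rpow_sub_one hpos.ne']
    have h2 := (mul_ne_zero_iff.1 hpos.ne').1
    have h3 := (mul_ne_zero_iff.1 hpos.ne').2
    have h4 : deriv h u = B * h u / (u - c) := by
      field_simp
      linear_combination e u hu
    rw [h4]
    generalize (σ * (u - c)) ^ (-B) = y
    field_simp
    ring
  refine ⟨C, fun u hu => ?_⟩
  rw [← hC u hu, mul_assoc, ← Real.rpow_add (hσ u hu)]
  simp

/-- The equation gives `h c = 0` and `(u - c) (h ^ 2)_u = 2 B h ^ 2 ≤ 0`. Thus `h ^ 2` does not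
increase away from `c`, where it vanishes. -/
lemma eq_zero_of_neg (hU : IsOpenInterval U) {h : ℝ → ℝ} {c B : ℝ} (hc : c ∈ U) (hB : B < 0)
    (hd : ∀ u ∈ U, HasDerivAt h (deriv h u) u)
    (e : ∀ u ∈ U, (u - c) * deriv h u = B * h u) : ∀ u ∈ U, h u = 0 := by
  have hc0 : h c = 0 := by
    have := e c hc
    simp only [sub_self, zero_mul] at this
    exact (mul_eq_zero.1 this.symm).resolve_left hB.ne
  intro u hu
  have d2 : ∀ v ∈ U, HasDerivAt (fun v => h v ^ 2) (2 * h v * deriv h v) v := fun v hv => by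
    simpa using (hd v hv).fun_pow 2
  suffices h u ^ 2 ≤ 0 by nlinarith [sq_nonneg (h u)]
  rcases le_total c u with hcu | hcu
  · have hsub := hU.2.1.out hc hu
    have := antitoneOn_of_deriv_nonpos (convex_Icc c u) (f := fun v => h v ^ 2)
      (fun v hv => (d2 v (hsub hv)).continuousAt.continuousWithinAt)
      (fun v hv => (d2 v (hsub (interior_subset hv))).differentiableAt.differentiableWithinAt)
      (fun v hv => by
        rw [(d2 v (hsub (interior_subset hv))).deriv]
        rw [interior_Icc] at hv
        have h1 := e v (hsub ⟨hv.1.le, hv.2.le⟩)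
        have h2 : 0 < v - c := sub_pos.2 hv.1
        refine nonpos_of_mul_nonpos_right (?_ : (v - c) * _ ≤ 0) h2
        rw [show (v - c) * (2 * h v * deriv h v) = B * (2 * h v ^ 2) by
          linear_combination 2 * h v * h1]
        exact mul_nonpos_of_nonpos_of_nonneg hB.le (by positivity))
      (Set.left_mem_Icc.2 hcu) (Set.right_mem_Icc.2 hcu) hcu
    simpa [hc0] using this
  · have hsub := hU.2.1.out hu hc
    have := monotoneOn_of_deriv_nonneg (convex_Icc u c) (f := fun v => h v ^ 2)
      (fun v hv => (d2 v (hsub hv)).continuousAt.continuousWithinAt)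
      (fun v hv => (d2 v (hsub (interior_subset hv))).differentiableAt.differentiableWithinAt)
      (fun v hv => by
        rw [(d2 v (hsub (interior_subset hv))).deriv]
        rw [interior_Icc] at hv
        have h1 := e v (hsub ⟨hv.1.le, hv.2.le⟩)
        have h2 : 0 < c - v := sub_pos.2 hv.2
        refine nonneg_of_mul_nonneg_right (?_ : 0 ≤ (c - v) * _) h2
        rw [show (c - v) * (2 * h v * deriv h v) = -B * (2 * h v ^ 2) by
          linear_combination -2 * h v * h1]
        exact mul_nonneg (neg_nonneg.2 hB.le) (by positivity))
      (Set.left_mem_Icc.2 hcu) (Set.right_mem_Icc.2 hcu) hcu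
    simpa [hc0] using this

/-- Smooth solutions of `(u - c) h_u = B h` on a neighbourhood of the singular point. -/
lemma eq_mul_pow_or_eq_zero (hU : IsOpenInterval U) {c : ℝ} (hc : c ∈ U) (N : ℕ) :
    ∀ {h : ℝ → ℝ} {B : ℝ}, ContDiffOn ℝ ∞ h U → B ≤ N →
      (∀ u ∈ U, (u - c) * deriv h u = B * h u) →
      (∃ (m : ℕ) (C : ℝ), B = m ∧ ∀ u ∈ U, h u = C * (u - c) ^ m) ∨ ∀ u ∈ U, h u = 0 := by
  have base : ∀ {h : ℝ → ℝ}, ContDiffOn ℝ ∞ h U → (∀ u ∈ U, deriv h u = 0) →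
      ∃ C, ∀ u ∈ U, h u = C := fun hs hd =>
    exists_eq_const_of_deriv hU fun u hu => hd u hu ▸ hasDerivAt_of_smooth hU.1 hs hu
  -- The derivative of a solution solves the same equation with `B - 1`. Repeated differentiation
  -- leads to `B ≤ 0`; integrating back produces powers of `u - c`, the integration constant being
  -- zero because `h c = 0`. Smoothness at `c` is what excludes non-integer exponents and different
  -- constants on the two sides.
  induction N with
  | zero =>
    intro h B hs hB e
    rcases (by simpa using hB : B ≤ 0).lt_or_eq with hB | rfl
    · exact Or.inr (eq_zero_of_neg hU hc hB (fun u hu => hasDerivAt_of_smooth hU.1 hs hu) e)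
    · left
      have hd : ∀ u ∈ U, u ≠ c → deriv h u = 0 := fun u hu hne => by
        have := e u hu
        rw [zero_mul] at this
        exact (mul_eq_zero.1 this).resolve_left (sub_ne_zero.2 hne)
      have hdc : deriv h c = 0 := by
        by_contra hne
        have hev : {u | u ∈ U ∧ deriv h u ≠ 0} ∈ nhds c :=
          Filter.Eventually.and (hU.1.mem_nhds hc)
            (((contDiffOn_deriv hU.1 hs).continuousOn.continuousAt
              (hU.1.mem_nhds hc)).eventually_ne hne)
        obtain ⟨w, ⟨hw, hwne⟩, hwc⟩ := exists_ne_mem_of_mem_nhds hev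
        exact hwne (hd w hw hwc)
      obtain ⟨C, hC⟩ := base hs fun u hu => by
        by_cases hne : u = c
        · rw [hne, hdc]
        · exact hd u hu hne
      exact ⟨0, C, by simp, by simpa using hC⟩
  | succ N ih =>
    intro h B hs hB e
    by_cases hBN : B ≤ N
    · exact ih hs hBN e
    have hB0 : B ≠ 0 := (lt_of_le_of_lt (Nat.cast_nonneg N) (not_le.1 hBN)).ne'
    have hc0 : h c = 0 := by
      have := e c hc
      simp only [sub_self, zero_mul] at this
      exact (mul_eq_zero.1 this.symm).resolve_left hB0
    have hs' := contDiffOn_deriv hU.1 hs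
    have S : KSol U h 1 (-c) 0 B := fun u hu => by linear_combination e u hu
    rcases ih (B := B - 1) hs' (by push_cast at hB; linarith)
      (fun u hu => by linear_combination S.deriv_eq hU.1 hs hu) with ⟨m, C, hm, hC⟩ | h0
    · left
      obtain ⟨D, hD⟩ : ∃ D, ∀ u ∈ U, h u - C / (m + 1) * (u - c) ^ (m + 1) = D := by
        refine exists_eq_const_of_deriv hU fun u hu => ?_
        have h1 := (((hasDerivAt_id' u).sub_const c).pow (m + 1)).const_mul (C / (m + 1))
        refine ((hasDerivAt_of_smooth hU.1 hs hu).sub h1).congr_deriv ?_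
        have : (m : ℝ) + 1 ≠ 0 := by positivity
        rw [hC u hu]
        push_cast
        field_simp
        simp
      have hD0 : D = 0 := by
        have := hD c hc
        simpa [hc0] using this.symm
      exact ⟨m + 1, C / (m + 1), by push_cast; linarith, fun u hu => by
        linear_combination hD u hu + hD0⟩
    · right
      obtain ⟨C, hC⟩ := base hs h0
      intro u hu
      rw [hC u hu, ← hC c hc, hc0]

/-- If the solution space is nontrivial, then `k` is reduced to one of the listed forms. -/
lemma exists_kNF_of_kSol (hU : IsOpenInterval U) (hk : ContDiffOn ℝ ∞ k U)
    (hn : ∃ u ∈ U, deriv (deriv k) u ≠ 0) {φ ψ A B : ℝ} (hS : KSol U k φ ψ A B)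
    (h0 : φ ≠ 0 ∨ ψ ≠ 0) : ∃ κ, κ ≠ .arbitrary ∧ KNF κ U k := by
  have naff : ∀ a b : ℝ, ¬ ∀ u ∈ U, k u = a * u + b := fun a b h => by
    obtain ⟨u, hu, hne⟩ := hn
    exact hne (deriv_deriv_eq_zero_of_affine hU.1 h u hu)
  have hd := fun u (hu : u ∈ U) => hasDerivAt_of_smooth hU.1 hk hu
  by_cases hφ : φ = 0
  · subst hφ
    have hψ : ψ ≠ 0 := by simpa using h0
    have hB : B ≠ 0 := by
      rintro rfl
      obtain ⟨C, hC⟩ := exists_eq_const_of_deriv (k := fun u => k u - A / ψ * u) hU fun u hu => by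
        refine ((hd u hu).sub ((hasDerivAt_id' u).const_mul (A / ψ))).congr_deriv ?_
        have := hS u hu
        field_simp
        linear_combination this
      exact naff (A / ψ) C fun u hu => by linear_combination hC u hu
    -- Integrating factor for `ψ k_u = A + B k`, shifted by `A / B` to be homogeneous.
    obtain ⟨C, hC⟩ := exists_eq_const_of_deriv
        (k := fun u => (k u + A / B) * Real.exp (-(B / ψ) * u)) hU fun u hu => by
      refine (((hd u hu).add_const (A / B)).mul
        ((hasDerivAt_id' u).const_mul (-(B / ψ))).exp).congr_deriv ?_
      have := hS u hu
      generalize Real.exp (-(B / ψ) * u) = y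
      field_simp
      linear_combination y * this
    have hC' : ∀ u ∈ U, k u + A / B = C * Real.exp (B / ψ * u + 0) := fun u hu => by
      rw [← hC u hu, mul_assoc, ← Real.exp_add]
      simp
    have hC0 : C ≠ 0 := by
      rintro rfl
      exact naff 0 (-(A / B)) fun u hu => by linear_combination hC' u hu
    refine ⟨.exp, by simp, kNF_exp (p := B / ψ) (q := 0) (α := C⁻¹) (β := C⁻¹ * (A / B))
      (div_ne_zero hB hψ) (inv_ne_zero hC0) fun u hu => ?_⟩
    rw [← mul_add, hC' u hu, inv_mul_cancel_left₀ hC0]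
  -- After division by `φ` the equation is `(u - c) k_u = a + b k`, with the singular point `c`.
  · obtain ⟨c, hc⟩ : ∃ c, c = -(ψ / φ) := ⟨_, rfl⟩
    obtain ⟨a, ha⟩ : ∃ a, a = A / φ := ⟨_, rfl⟩
    obtain ⟨b, hb⟩ : ∃ b, b = B / φ := ⟨_, rfl⟩
    have hS' : ∀ u ∈ U, (u - c) * deriv k u = a + b * k u := fun u hu => by
      rw [ha, hb, hc]
      field_simp
      linear_combination hS u hu
    -- By continuity `k_uu` is nonzero on a neighbourhood, which contains points other than `c`.
    obtain ⟨w, hw, hwne, hwc⟩ : ∃ w ∈ U, deriv (deriv k) w ≠ 0 ∧ w ≠ c := by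
      obtain ⟨v, hv, hne⟩ := hn
      have hev : {u | u ∈ U ∧ deriv (deriv k) u ≠ 0} ∈ nhds v :=
        Filter.Eventually.and (hU.1.mem_nhds hv) (((contDiffOn_deriv hU.1
          (contDiffOn_deriv hU.1 hk)).continuousOn.continuousAt (hU.1.mem_nhds hv)).eventually_ne
          hne)
      by_cases hvc : v = c
      · subst hvc
        obtain ⟨w, ⟨hw, hwne⟩, hwc⟩ := exists_ne_mem_of_mem_nhds hev
        exact ⟨w, hw, hwne, hwc⟩
      · exact ⟨v, hv, hne, hvc⟩
    have hwc' := sub_ne_zero.2 hwc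
    have hS1 : KSol U k 1 (-c) a b := fun u hu => by linear_combination hS' u hu
    have hw1 := hS1.deriv_eq hU.1 hk hw
    by_cases hb0 : b = 0
    · have ha0 : a ≠ 0 := by
        rintro rfl
        have h1 := hS' w hw
        rw [hb0, zero_mul, add_zero] at h1
        have h2 : deriv k w = 0 := (mul_eq_zero.1 h1).resolve_left hwc'
        rw [h2, hb0] at hw1
        exact mul_ne_zero hwc' hwne (by linear_combination hw1)
      have hcU : c ∉ U := fun hcU => ha0 (by
        have := hS' c hcU
        rw [hb0] at this
        linear_combination -this)
      obtain ⟨σ, hσ0, hσ⟩ := exists_sign hU hcU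
      obtain ⟨C, hC⟩ := exists_eq_const_of_deriv
          (k := fun u => k u - a * Real.log (σ * (u - c))) hU fun u hu => by
        have h1 : HasDerivAt (fun u => σ * (u - c)) σ u := by
          simpa using ((hasDerivAt_id' u).sub_const c).const_mul σ
        refine ((hd u hu).sub ((h1.log (hσ u hu).ne').const_mul a)).congr_deriv ?_
        have h2 := hS' u hu
        have h3 := (mul_ne_zero_iff.1 (hσ u hu).ne').2
        rw [hb0] at h2
        field_simp
        linear_combination h2
      refine ⟨.log, by simp, kNF_log (p := σ) (q := -σ * c) (α := a⁻¹) (β := -C / a)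
        hσ0 (inv_ne_zero ha0) (fun u hu => by linarith [hσ u hu]) fun u hu => ?_⟩
      rw [← hC u hu, show σ * u + -σ * c = σ * (u - c) by ring]
      field_simp
      ring
    -- For `b ≠ 0` the shifted function `k + a / b` satisfies the homogeneous equation with exponent
    -- `b`.
    · have hd' : ∀ u ∈ U, deriv (fun u => k u + a / b) u = deriv k u := fun u hu =>
        ((hd u hu).add_const (a / b)).deriv
      have hS2 : ∀ u ∈ U, (u - c) * deriv (fun u => k u + a / b) u = b * (k u + a / b) :=
        fun u hu => by
          rw [hd' u hu, hS' u hu]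
          field_simp
          ring
      have hb1 : b ≠ 1 := by
        rintro rfl
        exact mul_ne_zero hwc' hwne (by linear_combination hw1)
      -- If the singular point lies in `U`, smoothness makes the exponent a natural number.
      -- Otherwise `U` lies on one side of `c`, and every real exponent is possible.
      by_cases hcU : c ∈ U
      · obtain ⟨N, hN⟩ := exists_nat_ge b
        rcases eq_mul_pow_or_eq_zero hU hcU N (hk.add contDiffOn_const) hN hS2 with
          ⟨m, C, rfl, hC⟩ | h0
        · have hC0 : C ≠ 0 := by
            rintro rfl
            exact naff 0 (-(a / m)) fun u hu => by linear_combination hC u hu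
          refine ⟨.power m, by simp, kNF_power (p := 1) (q := -c) (α := C⁻¹) (β := C⁻¹ * (a / m))
            one_ne_zero (inv_ne_zero hC0) hb0 hb1 (Or.inr ⟨m, rfl⟩) fun u hu => ?_⟩
          rw [← mul_add, hC u hu, inv_mul_cancel_left₀ hC0, Real.rpow_natCast]
          ring
        · exact absurd (fun u hu => by linear_combination h0 u hu) (naff 0 (-(a / b)))
      · obtain ⟨σ, hσ0, hσ⟩ := exists_sign hU hcU
        obtain ⟨C, hC⟩ := exists_eq_mul_rpow hU hσ
          (fun u hu => (hd' u hu).symm ▸ (hd u hu).add_const (a / b)) hS2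
        have hC0 : C ≠ 0 := by
          rintro rfl
          exact naff 0 (-(a / b)) fun u hu => by linear_combination hC u hu
        refine ⟨.power b, by simp, kNF_power (p := σ) (q := -σ * c) (α := C⁻¹) (β := C⁻¹ * (a / b))
          hσ0 (inv_ne_zero hC0) hb0 hb1 (Or.inl fun u hu => by linarith [hσ u hu]) fun u hu => ?_⟩
        rw [← mul_add, hC u hu, inv_mul_cancel_left₀ hC0]
        congr 1
        ring
end

/-! ### Solutions of `(c₁ t + c₀) f_t = (2 a - c₁) f` -/

/-- `(c₁ t + c₀) f_t = (2 a - c₁) f` on `T`. -/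
def TSol (T : Set ℝ) (f : ℝ → ℝ) (c₀ c₁ a : ℝ) : Prop :=
  ∀ t ∈ T, (c₁ * t + c₀) * deriv f t = (2 * a - c₁) * f t

/-- `f` is reduced to the form `ν` by affine transformations of `t` and scalings. -/
def FNF (ν : FType) (T : Set ℝ) (f : ℝ → ℝ) : Prop :=
  ∃ p q d : ℝ, p ≠ 0 ∧ d ≠ 0 ∧
    ν.Matches ((fun t => p * t + q) '' T) (fun s => d ^ 2 / p * f ((s - q) / p))

section
variable {T : Set ℝ} {f : ℝ → ℝ}

/-- If `(c₀, c₁)` and `(c₀', c₁')` were independent, elimination would give `f_t = l f` with a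
constant `l`, nonzero since `f` is not constant. Then `(c₁ t + c₀) l` is constant, so `c₁ = 0`, and
likewise `c₁' = 0`: a contradiction. The proportionality of `a` follows because `f` has no zeros. -/
lemma TSol.exists_eq_mul (hT : IsOpenInterval T) (hf0 : ∀ t ∈ T, f t ≠ 0)
    (hn : ∃ t ∈ T, deriv f t ≠ 0) {c₀ c₁ a c₀' c₁' a' : ℝ} (h : TSol T f c₀ c₁ a)
    (h' : TSol T f c₀' c₁' a') (h0 : c₀ ≠ 0 ∨ c₁ ≠ 0) :
    ∃ s, c₀' = s * c₀ ∧ c₁' = s * c₁ ∧ a' = s * a := by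
  obtain ⟨t₀, ht₀, hne⟩ := hn
  obtain ⟨t₁, ht₁, ht⟩ := exists_ne_mem_of_mem_nhds (hT.1.mem_nhds ht₀)
  have hD : c₁ * c₀' - c₁' * c₀ = 0 := by
    by_contra hD
    obtain ⟨l, hl⟩ : ∃ l, ∀ t ∈ T, deriv f t = l * f t :=
      ⟨(c₁ * (2 * a' - c₁') - c₁' * (2 * a - c₁)) / (c₁ * c₀' - c₁' * c₀), fun t ht => by
        field_simp
        linear_combination c₁ * h' t ht - c₁' * h t ht⟩
    have hl0 : l ≠ 0 := by
      rintro rfl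
      exact hne (by simpa using hl t₀ ht₀)
    have key : ∀ {c₀ c₁ a : ℝ}, TSol T f c₀ c₁ a → c₁ = 0 := fun {c₀ c₁ a} h => by
      have e : ∀ t ∈ T, (c₁ * t + c₀) * l = 2 * a - c₁ := fun t ht =>
        mul_right_cancel₀ (hf0 t ht) (by linear_combination h t ht - (c₁ * t + c₀) * hl t ht)
      have : c₁ * (l * (t₁ - t₀)) = 0 := by linear_combination e t₁ ht₁ - e t₀ ht₀
      exact (mul_eq_zero.1 this).resolve_right (mul_ne_zero hl0 (sub_ne_zero.2 ht))
    rw [key h, key h'] at hD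
    simp at hD
  obtain ⟨s, hs, hs'⟩ : ∃ s, c₀' = s * c₀ ∧ c₁' = s * c₁ := by
    rcases h0 with h0 | h0
    · refine ⟨c₀' / c₀, by field_simp, ?_⟩
      field_simp
      linear_combination -hD
    · refine ⟨c₁' / c₁, ?_, by field_simp⟩
      field_simp
      linear_combination hD
  refine ⟨s, hs, hs', mul_right_cancel₀ (hf0 t₀ ht₀) ?_⟩
  subst hs hs'
  linear_combination (s * h t₀ ht₀ - h' t₀ ht₀) / 2

lemma tSol_iff_of_const (hT : IsOpenInterval T) (hf0 : ∀ t ∈ T, f t ≠ 0)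
    (hn : ∀ t ∈ T, deriv f t = 0) {c₀ c₁ a : ℝ} : TSol T f c₀ c₁ a ↔ c₁ = 2 * a := by
  constructor
  · intro h
    obtain ⟨t, ht⟩ := hT.2.2
    have := h t ht
    rw [hn t ht, mul_zero] at this
    have := (mul_eq_zero.1 this.symm).resolve_right (hf0 t ht)
    linarith
  · rintro rfl t ht
    rw [hn t ht]
    ring

/-! ### Reduction of `f` to the listed forms -/

lemma exists_units_mul_abs (x : ℝ) (hx : x ≠ 0) : ∃ ε : ℤˣ, x = ((ε : ℤ) : ℝ) * |x| := by
  rcases lt_or_gt_of_ne hx with h | h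
  · exact ⟨-1, by simp [abs_of_neg h]⟩
  · exact ⟨1, by simp [abs_of_pos h]⟩

lemma units_eq_of_mul_pos {ε ε' : ℤˣ} {x : ℝ} (h : 0 < ((ε : ℤ) : ℝ) * x)
    (h' : 0 < ((ε' : ℤ) : ℝ) * x) : ε = ε' := by
  rcases Int.units_eq_one_or ε with rfl | rfl <;> rcases Int.units_eq_one_or ε' with rfl | rfl <;>
    simp at h h' ⊢ <;> linarith

lemma eqOn_scale_iff {p q d : ℝ} (hp : p ≠ 0) {h : ℝ → ℝ} :
    (∀ v ∈ (fun t => p * t + q) '' T, d ^ 2 / p * f ((v - q) / p) = h v) ↔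
      ∀ t ∈ T, d ^ 2 / p * f t = h (p * t + q) := by
  have : ∀ u : ℝ, (p * u + q - q) / p = u := fun u => by field_simp; ring
  exact Set.forall_mem_image.trans (by simp only [this])

lemma fNF_power {p q C ρ : ℝ} (hp : p ≠ 0) (hC : C ≠ 0) (hρ : ρ ≠ 0) (hn : ∀ t ∈ T, 0 < p * t + q)
    (h : ∀ t ∈ T, f t = C * (p * t + q) ^ ρ) : ∃ ε, FNF (.power ρ ε) T f := by
  obtain ⟨ε, hε⟩ := exists_units_mul_abs (C / p) (div_ne_zero hC hp)
  have hpos : 0 < |C / p| := abs_pos.2 (div_ne_zero hC hp)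
  -- The scaling `d` is chosen so that `d ^ 2 C / p` is the sign of `C / p`.
  refine ⟨ε, p, q, (√|C / p|)⁻¹, hp, inv_ne_zero (Real.sqrt_pos.2 hpos).ne', hρ, ?_,
    (eqOn_scale_iff hp (h := fun t => _ * t ^ ρ)).2 fun t ht => ?_⟩
  · rintro _ ⟨t, ht, rfl⟩; exact hn t ht
  · rw [h t ht, inv_pow, Real.sq_sqrt hpos.le]
    have : C = p * (((ε : ℤ) : ℝ) * |C / p|) := by rw [← hε]; field_simp
    generalize |C / p| = y at *
    rw [this]
    field_simp

lemma fNF_exp {p q C : ℝ} (hp : p ≠ 0) (hC : C ≠ 0)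
    (h : ∀ t ∈ T, f t = C * Real.exp (p * t + q)) : ∃ ε, FNF (.exp ε) T f := by
  obtain ⟨ε, hε⟩ := exists_units_mul_abs (C / p) (div_ne_zero hC hp)
  have hpos : 0 < |C / p| := abs_pos.2 (div_ne_zero hC hp)
  refine ⟨ε, p, q, (√|C / p|)⁻¹, hp, inv_ne_zero (Real.sqrt_pos.2 hpos).ne',
    (eqOn_scale_iff hp (h := fun t => _ * Real.exp t)).2 fun t ht => ?_⟩
  rw [h t ht, inv_pow, Real.sq_sqrt hpos.le]
  have : C = p * (((ε : ℤ) : ℝ) * |C / p|) := by rw [← hε]; field_simp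
  generalize |C / p| = y at *
  rw [this]
  field_simp

lemma fNF_one {C : ℝ} (hC : C ≠ 0) (h : ∀ t ∈ T, f t = C) : FNF .one T f :=
  ⟨C, 0, 1, hC, one_ne_zero, (eqOn_scale_iff hC (h := fun _ => 1)).2 fun t ht => by
    rw [h t ht]; field_simp⟩

/-- If the equation has a nontrivial solution, then `f` is reduced to one of the listed forms. -/
lemma exists_fNF_of_tSol (hT : IsOpenInterval T) (hf : DifferentiableOn ℝ f T)
    (hf0 : ∀ t ∈ T, f t ≠ 0) {c₀ c₁ a : ℝ} (h : TSol T f c₀ c₁ a) (h0 : c₀ ≠ 0 ∨ c₁ ≠ 0) :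
    ∃ ν, ν ≠ .arbitrary ∧ FNF ν T f := by
  have hd : ∀ t ∈ T, HasDerivAt f (deriv f t) t := fun t ht =>
    (hf.differentiableAt (hT.1.mem_nhds ht)).hasDerivAt
  obtain ⟨t₀, ht₀⟩ := hT.2.2
  have const : ∀ C, (∀ t ∈ T, f t = C) → ∃ ν, ν ≠ FType.arbitrary ∧ FNF ν T f := fun C hC =>
    ⟨.one, by simp, fNF_one (hC t₀ ht₀ ▸ hf0 t₀ ht₀) hC⟩
  by_cases hc₁ : c₁ = 0
  · subst hc₁
    have hc₀ : c₀ ≠ 0 := by simpa using h0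
    obtain ⟨l, hl⟩ : ∃ l, l = 2 * a / c₀ := ⟨_, rfl⟩
    have e : ∀ t ∈ T, deriv f t = l * f t := fun t ht => by
      rw [hl]
      field_simp
      linear_combination h t ht
    obtain ⟨C, hC⟩ := exists_eq_const_of_deriv (k := fun t => f t * Real.exp (-l * t)) hT
      fun t ht => by
        refine ((hd t ht).mul ((hasDerivAt_id' t).const_mul (-l)).exp).congr_deriv ?_
        rw [e t ht]
        ring
    have hC' : ∀ t ∈ T, f t = C * Real.exp (l * t + 0) := fun t ht => by
      rw [← hC t ht, mul_assoc, ← Real.exp_add]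
      simp
    by_cases hl0 : l = 0
    · exact const C fun t ht => by rw [hC' t ht, hl0]; simp
    · have hC0 : C ≠ 0 := by
        rintro rfl
        exact hf0 t₀ ht₀ (by rw [hC' t₀ ht₀, zero_mul])
      obtain ⟨ε, hε⟩ := fNF_exp hl0 hC0 hC'
      exact ⟨_, by simp, hε⟩
  · obtain ⟨c, hc⟩ : ∃ c, c = -(c₀ / c₁) := ⟨_, rfl⟩
    obtain ⟨b, hb⟩ : ∃ b, b = (2 * a - c₁) / c₁ := ⟨_, rfl⟩
    have e : ∀ t ∈ T, (t - c) * deriv f t = b * f t := fun t ht => by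
      rw [hc, hb]
      field_simp
      linear_combination h t ht
    -- At the singular point the equation reads `0 = b f c` with `f c ≠ 0`. So a singular point
    -- inside `T` forces `b = 0` and a constant `f`.
    by_cases hcT : c ∈ T
    · have hb0 : b = 0 := by
        have := e c hcT
        rw [sub_self, zero_mul] at this
        exact (mul_eq_zero.1 this.symm).resolve_right (hf0 c hcT)
      have hz : ∀ t ∈ T, t ≠ c → HasDerivAt f 0 t := fun t ht hne => by
        have := e t ht
        rw [hb0, zero_mul] at this
        exact (mul_eq_zero.1 this).resolve_left (sub_ne_zero.2 hne) ▸ hd t ht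
      -- The equation says nothing about `f_t` at `c` itself, so the mean value theorem is applied
      -- on each side of `c`.
      refine const (f c) fun t ht => ?_
      rcases lt_trichotomy t c with hlt | rfl | hlt
      · by_contra hne
        have hsub := hT.2.1.out ht hcT
        obtain ⟨s, hs, hs'⟩ := exists_hasDerivAt_eq_slope f (deriv f) hlt
          (hf.continuousOn.mono hsub) (fun s hs => hd s (hsub ⟨hs.1.le, hs.2.le⟩))
        rw [(hz s (hsub ⟨hs.1.le, hs.2.le⟩) hs.2.ne).deriv, eq_comm, div_eq_zero_iff] at hs'
        rcases hs' with h1 | h1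
        · exact hne (by linarith)
        · linarith
      · rfl
      · by_contra hne
        have hsub := hT.2.1.out hcT ht
        obtain ⟨s, hs, hs'⟩ := exists_hasDerivAt_eq_slope f (deriv f) hlt
          (hf.continuousOn.mono hsub) (fun s hs => hd s (hsub ⟨hs.1.le, hs.2.le⟩))
        rw [(hz s (hsub ⟨hs.1.le, hs.2.le⟩) hs.1.ne').deriv, eq_comm, div_eq_zero_iff] at hs'
        rcases hs' with h1 | h1
        · exact hne (by linarith)
        · linarith
    · obtain ⟨σ, hσ0, hσ⟩ := exists_sign hT hcT
      obtain ⟨C, hC⟩ := exists_eq_mul_rpow hT hσ hd e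
      by_cases hb0 : b = 0
      · exact const C fun t ht => by rw [hC t ht, hb0]; simp
      · have hC0 : C ≠ 0 := by
          rintro rfl
          exact hf0 t₀ ht₀ (by rw [hC t₀ ht₀, zero_mul])
        obtain ⟨ε, hε⟩ := fNF_power (f := f) (p := σ) (q := -σ * c) hσ0 hC0 hb0
          (fun t ht => by linarith [hσ t ht])
          (fun t ht => by rw [hC t ht]; congr 2; ring)
        exact ⟨_, by simp, hε⟩

/-- The logarithmic derivatives of the listed functions. -/
lemma FNF.exists_log_deriv (hT : IsOpen T) {ν : FType} (hν : ν ≠ .arbitrary) (h : FNF ν T f) :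
    (∃ ρ ε p q, ν = .power ρ ε ∧ ρ ≠ 0 ∧ p ≠ 0 ∧ ∀ t ∈ T, 0 < p * t + q ∧
        0 < ((ε : ℤ) : ℝ) * (p * f t) ∧ (p * t + q) * deriv f t = ρ * p * f t) ∨
      (∃ ε p, ν = .exp ε ∧ p ≠ 0 ∧ ∀ t ∈ T, 0 < ((ε : ℤ) : ℝ) * (p * f t) ∧
        deriv f t = p * f t) ∨
      (ν = .one ∧ ∀ t ∈ T, f t ≠ 0 ∧ deriv f t = 0) := by
  obtain ⟨p, q, d, hp, hd, h⟩ := h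
  have hdp : d ^ 2 / p ≠ 0 := div_ne_zero (pow_ne_zero 2 hd) hp
  have pos : ∀ {ε : ℤˣ} {t y : ℝ}, 0 < y → d ^ 2 / p * f t = ((ε : ℤ) : ℝ) * y →
      0 < ((ε : ℤ) : ℝ) * (p * f t) := fun {ε t y} hy h => by
    have h1 : ((ε : ℤ) : ℝ) * (p * f t) = (p / d) ^ 2 * (((ε : ℤ) : ℝ) * ((ε : ℤ) : ℝ)) * y := by
      have : f t = p * (((ε : ℤ) : ℝ) * y) / d ^ 2 := by
        rw [← h]; field_simp
      rw [this]; field_simp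
    have h2 : ((ε : ℤ) : ℝ) * ((ε : ℤ) : ℝ) = 1 := by
      rcases Int.units_eq_one_or ε with rfl | rfl <;> simp
    rw [h1, h2]
    positivity
  cases ν with
  | arbitrary => exact absurd rfl hν
  | power ρ ε =>
    obtain ⟨hρ, hn, h⟩ := h
    have h := (eqOn_scale_iff hp (h := fun t => _ * t ^ ρ)).1 h
    refine Or.inl ⟨ρ, ε, p, q, rfl, hρ, hp, fun t ht => ?_⟩
    have hn' : 0 < p * t + q := hn ⟨t, ht, rfl⟩
    refine ⟨hn', pos (Real.rpow_pos_of_pos hn' ρ) (h t ht), ?_⟩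
    rw [deriv_eq_of_affine hT (β := 0) hdp (fun t ht => by rw [add_zero]; exact h t ht) ht
      (((hasDerivAt_affine p q t).rpow_const (Or.inl hn'.ne')).const_mul _),
      Real.rpow_sub_one hn'.ne']
    have : f t = p * (((ε : ℤ) : ℝ) * (p * t + q) ^ ρ) / d ^ 2 := by
      rw [← h t ht]; field_simp
    rw [this]
    field_simp
  | exp ε =>
    have h := (eqOn_scale_iff hp (h := fun t => _ * Real.exp t)).1 h
    refine Or.inr (Or.inl ⟨ε, p, rfl, hp, fun t ht => ⟨pos (Real.exp_pos _) (h t ht), ?_⟩⟩)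
    rw [deriv_eq_of_affine hT (β := 0) hdp (fun t ht => by rw [add_zero]; exact h t ht) ht
      ((hasDerivAt_affine p q t).exp.const_mul _)]
    have : f t = p * (((ε : ℤ) : ℝ) * Real.exp (p * t + q)) / d ^ 2 := by
      rw [← h t ht]; field_simp
    rw [this]
    field_simp
  | one =>
    have h := (eqOn_scale_iff hp (h := fun t => 1)).1 h
    refine Or.inr (Or.inr ⟨rfl, fun t ht => ⟨fun h0 => ?_, ?_⟩⟩)
    · have := h t ht
      simp [h0] at this
    · rw [deriv_eq_of_affine hT (β := 0) hdp (fun t ht => by rw [add_zero]; exact h t ht) ht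
        (hasDerivAt_const _ _)]
      simp

/-- The quotient `f_t / f` equals `ρ p / (p t + q)`, `p` or `0` for the three forms, and these
functions of `t` differ from each other on an interval. The quotient determines `ρ` and, for the
exponential, `p`; the sign `ε` is that of `p f`. -/
lemma FNF.unique (hT : IsOpenInterval T) {ν ν' : FType} (hν : ν ≠ .arbitrary)
    (hν' : ν' ≠ .arbitrary) (H : FNF ν T f) (H' : FNF ν' T f) : ν = ν' := by
  obtain ⟨t₀, ht₀⟩ := hT.2.2
  obtain ⟨t₁, ht₁, ht⟩ := exists_ne_mem_of_mem_nhds (hT.1.mem_nhds ht₀)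
  have nz : ∀ {ε : ℤˣ} {p t : ℝ}, 0 < ((ε : ℤ) : ℝ) * (p * f t) → f t ≠ 0 := fun h h0 => by
    simp [h0] at h
  have pe : ∀ {ρ p q p' : ℝ}, p ≠ 0 → p' ≠ 0 → ¬ ∀ t ∈ T, f t ≠ 0 ∧
      (p * t + q) * deriv f t = ρ * p * f t ∧ deriv f t = p' * f t := fun {ρ p q p'} hp hp' h => by
    have e : ∀ t ∈ T, (p * t + q) * p' = ρ * p := fun t ht =>
      mul_right_cancel₀ (h t ht).1 (by
        linear_combination (h t ht).2.1 - (p * t + q) * (h t ht).2.2)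
    have : p * p' * (t₁ - t₀) = 0 := by linear_combination e t₁ ht₁ - e t₀ ht₀
    exact mul_ne_zero (mul_ne_zero hp hp') (sub_ne_zero.2 ht) this
  rcases H.exists_log_deriv hT.1 hν with ⟨ρ, ε, p, q, rfl, hρ, hp, h⟩ | ⟨ε, p, rfl, hp, h⟩ |
      ⟨rfl, h⟩ <;>
    rcases H'.exists_log_deriv hT.1 hν' with ⟨ρ', ε', p', q', rfl, hρ', hp', h'⟩ |
      ⟨ε', p', rfl, hp', h'⟩ | ⟨rfl, h'⟩
  · have e : ∀ t ∈ T, (p * t + q) * (ρ' * p') = (p' * t + q') * (ρ * p) := fun t ht =>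
      mul_right_cancel₀ (nz (h t ht).2.1) (by
        linear_combination (p' * t + q') * (h t ht).2.2 - (p * t + q) * (h' t ht).2.2)
    have e1 : p * p' * (ρ' - ρ) * (t₁ - t₀) = 0 := by
      linear_combination e t₁ ht₁ - e t₀ ht₀
    obtain rfl : ρ' = ρ := by
      simpa [hp, hp', sub_ne_zero.2 ht, sub_eq_zero] using e1
    have e2 : (p * t₀ + q) * p' = (p' * t₀ + q') * p := mul_left_cancel₀ hρ (by
      linear_combination e t₀ ht₀)
    -- By `e2` the products `(p t₀ + q) p'` and `(p' t₀ + q') p` are equal. Both affine factors are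
    -- positive, so `p` and `p'` have the same sign.
    have hs : 0 < p' * p := by
      have h1 := (h t₀ ht₀).1
      have h2 := (h' t₀ ht₀).1
      have : 0 < (p' * p) * ((p * t₀ + q) * (p' * t₀ + q')) := by
        rw [show (p' * p) * ((p * t₀ + q) * (p' * t₀ + q')) = ((p' * t₀ + q') * p) ^ 2 by
          linear_combination p * (p' * t₀ + q') * e2]
        positivity
      exact pos_of_mul_pos_left this (by positivity)
    obtain rfl : ε = ε' := by
      refine units_eq_of_mul_pos (h t₀ ht₀).2.1 ?_
      have h3 := mul_pos hs (h' t₀ ht₀).2.1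
      rw [show p' * p * (((ε' : ℤ) : ℝ) * (p' * f t₀)) = p' ^ 2 * (((ε' : ℤ) : ℝ) * (p * f t₀)) by
        ring] at h3
      exact pos_of_mul_pos_right h3 (by positivity)
    rfl
  · exact (pe hp hp' fun t ht => ⟨nz (h t ht).2.1, (h t ht).2.2, (h' t ht).2⟩).elim
  · have := (h t₀ ht₀).2.2
    rw [(h' t₀ ht₀).2] at this
    simp [hρ, hp, (h' t₀ ht₀).1] at this
  · exact (pe hp' hp fun t ht => ⟨nz (h t ht).1, (h' t ht).2.2, (h t ht).2⟩).elim
  · obtain rfl : p = p' := mul_right_cancel₀ (nz (h t₀ ht₀).1)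
      ((h t₀ ht₀).2.symm.trans (h' t₀ ht₀).2)
    rw [units_eq_of_mul_pos (h t₀ ht₀).1 (h' t₀ ht₀).1]
  · have := (h t₀ ht₀).2
    rw [(h' t₀ ht₀).2] at this
    simp [hp, (h' t₀ ht₀).1] at this
  · have := (h' t₀ ht₀).2.2
    rw [(h t₀ ht₀).2] at this
    simp [hρ', hp', (h t₀ ht₀).1] at this
  · have := (h' t₀ ht₀).2
    rw [(h t₀ ht₀).2] at this
    simp [hp', (h t₀ ht₀).1] at this
  · rfl
end

/-! ### Bases -/

lemma isBasisOn_of {Ω : Set Pt} {S : VF → Prop} {b : List VF}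
    (hb : ∀ c : Fin b.length → ℝ, (∀ z ∈ Ω, ∑ i, c i • b.get i z = 0) → ∀ i, c i = 0)
    (hS : ∀ Q, S Q ↔ ∃ c : Fin b.length → ℝ, ∀ z ∈ Ω, Q z = ∑ i, c i • b.get i z) :
    IsBasisOn Ω S b := by
  refine ⟨Fintype.linearIndependent_iff.2 fun c hc => hb c fun z hz => ?_, hS⟩
  have := congrFun hc ⟨z, hz⟩
  simpa using this

lemma IsBasisOn.eq_zero {Ω : Set Pt} {S : VF → Prop} {b : List VF} (h : IsBasisOn Ω S b)
    {c : Fin b.length → ℝ} (hc : ∀ z ∈ Ω, ∑ i, c i • b.get i z = 0) : ∀ i, c i = 0 := by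
  refine Fintype.linearIndependent_iff.1 h.1 c ?_
  ext1 ⟨z, hz⟩
  simpa using hc z hz

lemma isBasisOn_nil {Ω : Set Pt} {S : VF → Prop} (hS : ∀ Q, S Q ↔ ∀ z ∈ Ω, Q z = 0) :
    IsBasisOn Ω S [] :=
  isBasisOn_of (fun _ _ i => i.elim0) fun Q => by simp [hS]

lemma isBasisOn_singleton {Ω : Set Pt} {S : VF → Prop} {v : VF}
    (hv : ∀ c : ℝ, (∀ z ∈ Ω, c • v z = 0) → c = 0)
    (hS : ∀ Q, S Q ↔ ∃ c : ℝ, ∀ z ∈ Ω, Q z = c • v z) : IsBasisOn Ω S [v] := by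
  refine isBasisOn_of (fun c hc i => ?_) fun Q => (hS Q).trans ⟨?_, ?_⟩
  · fin_cases i
    exact hv _ fun z hz => by simpa using hc z hz
  · rintro ⟨c, hc⟩
    exact ⟨fun _ => c, fun z hz => by simpa using hc z hz⟩
  · rintro ⟨c, hc⟩
    exact ⟨c 0, fun z hz => by simpa using hc z hz⟩

/-- The hypothesis `h0` says that the two spans intersect trivially on `Ω`, so their sum is direct.
-/
lemma isBasisOn_append {Ω : Set Pt} {S S₁ S₂ : VF → Prop} {b₁ b₂ : List VF}
    (h₁ : IsBasisOn Ω S₁ b₁) (h₂ : IsBasisOn Ω S₂ b₂)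
    (h0 : ∀ Q₁ Q₂, S₁ Q₁ → S₂ Q₂ → (∀ z ∈ Ω, Q₁ z + Q₂ z = 0) → ∀ z ∈ Ω, Q₁ z = 0)
    (hS : ∀ Q, S Q ↔ ∃ Q₁ Q₂, S₁ Q₁ ∧ S₂ Q₂ ∧ ∀ z ∈ Ω, Q z = Q₁ z + Q₂ z) :
    IsBasisOn Ω S (b₁ ++ b₂) := by
  let e : Fin b₁.length ⊕ Fin b₂.length ≃ Fin (b₁ ++ b₂).length :=
    finSumFinEquiv.trans (finCongr List.length_append.symm)
  have hsum : ∀ (c : Fin (b₁ ++ b₂).length → ℝ) (z : Pt), ∑ i, c i • (b₁ ++ b₂).get i z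
      = ∑ i, c (e (.inl i)) • b₁.get i z + ∑ i, c (e (.inr i)) • b₂.get i z := fun c z => by
    rw [← e.sum_comp, Fintype.sum_sum_type]
    have e₁ : ∀ i, (b₁ ++ b₂).get (e (.inl i)) = b₁.get i := fun i => by simp [e]
    have e₂ : ∀ i, (b₁ ++ b₂).get (e (.inr i)) = b₂.get i := fun i => by
      simp only [e, Equiv.trans_apply, finSumFinEquiv_apply_right, finCongr_apply,
        List.get_eq_getElem, Fin.val_cast, Fin.val_natAdd]
      rw [List.getElem_append_right (by simp)]
      simp
    simp only [e₁, e₂]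
  refine isBasisOn_of (fun c hc => ?_) fun Q => (hS Q).trans ⟨?_, ?_⟩
  · have h3 : ∀ z ∈ Ω, ∑ i, c (e (.inl i)) • b₁.get i z = 0 :=
      h0 (fun z => ∑ i, c (e (.inl i)) • b₁.get i z) (fun z => ∑ i, c (e (.inr i)) • b₂.get i z)
        ((h₁.2 _).2 ⟨_, fun _ _ => rfl⟩) ((h₂.2 _).2 ⟨_, fun _ _ => rfl⟩)
        fun z hz => by rw [← hsum, hc z hz]
    have h4 : ∀ z ∈ Ω, ∑ i, c (e (.inr i)) • b₂.get i z = 0 := fun z hz => by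
      have := hc z hz
      rwa [hsum, h3 z hz, zero_add] at this
    have h5 := h₁.eq_zero (c := fun i => c (e (.inl i))) h3
    have h6 := h₂.eq_zero (c := fun i => c (e (.inr i))) h4
    intro i
    obtain ⟨j, rfl⟩ := e.surjective i
    cases j with
    | inl j => exact h5 j
    | inr j => exact h6 j
  · rintro ⟨Q₁, Q₂, hQ₁, hQ₂, hQ⟩
    obtain ⟨c₁, hc₁⟩ := (h₁.2 _).1 hQ₁
    obtain ⟨c₂, hc₂⟩ := (h₂.2 _).1 hQ₂
    refine ⟨fun i => Sum.elim c₁ c₂ (e.symm i), fun z hz => ?_⟩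
    rw [hsum, hQ z hz, hc₁ z hz, hc₂ z hz]
    simp
  · rintro ⟨c, hc⟩
    exact ⟨_, _, (h₁.2 _).2 ⟨fun i => c (e (.inl i)), fun _ _ => rfl⟩,
      (h₂.2 _).2 ⟨fun i => c (e (.inr i)), fun _ _ => rfl⟩, fun z hz => by rw [hc z hz, hsum]⟩

/-- Transfer of a basis under a local diffeomorphism. -/
lemma IsBasisOn.pullback {Ω : Set Pt} {Φ : Pt → Pt} {S S' : VF → Prop} {b : List VF}
    (h : IsBasisOn (Φ '' Ω) S' b) (hΦ : ∀ z ∈ Ω, ∀ v, fderiv ℝ Φ z v = 0 → v = 0)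
    (hS : ∀ Q, S Q ↔ ∃ Q', S' Q' ∧ ∀ z ∈ Ω, fderiv ℝ Φ z (Q z) = Q' (Φ z)) :
    IsBasisOn Ω S (b.map (VectorField.pullback ℝ Φ)) := by
  -- An injective endomorphism of a finite-dimensional space is invertible, so the pullback is a
  -- genuine inverse of the push-forward.
  have hinv : ∀ z ∈ Ω, (fderiv ℝ Φ z).IsInvertible := fun z hz => by
    have hinj : Function.Injective (fderiv ℝ Φ z : Pt →ₗ[ℝ] Pt) :=
      (injective_iff_map_eq_zero _).2 (hΦ z hz)
    exact ⟨(LinearEquiv.ofInjectiveEndo _ hinj).toContinuousLinearEquiv, by ext1 v; rfl⟩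
  let e : Fin b.length ≃ Fin (b.map (VectorField.pullback ℝ Φ)).length :=
    finCongr (List.length_map _).symm
  have hsum : ∀ (c : Fin (b.map (VectorField.pullback ℝ Φ)).length → ℝ), ∀ z ∈ Ω,
      fderiv ℝ Φ z (∑ i, c i • (b.map (VectorField.pullback ℝ Φ)).get i z)
        = ∑ i, c (e i) • b.get i (Φ z) := fun c z hz => by
    rw [← e.sum_comp, map_sum]
    refine Finset.sum_congr rfl fun i _ => ?_
    rw [map_smul]
    congr 1
    simp only [e, finCongr_apply, List.get_eq_getElem, Fin.val_cast, List.getElem_map]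
    exact VectorField.fderiv_pullback Φ _ z (hinv z hz)
  have hinj : ∀ z ∈ Ω, ∀ v w, fderiv ℝ Φ z v = fderiv ℝ Φ z w → v = w := fun z hz v w hvw =>
    sub_eq_zero.1 (hΦ z hz _ (by rw [map_sub, hvw, sub_self]))
  refine isBasisOn_of (fun c hc i => ?_) fun Q => (hS Q).trans ⟨?_, ?_⟩
  · obtain ⟨j, rfl⟩ := e.surjective i
    refine h.eq_zero (c := fun j => c (e j)) ?_ j
    rintro _ ⟨z, hz, rfl⟩
    rw [← hsum c z hz, hc z hz, map_zero]
  · rintro ⟨Q', hQ', hQ⟩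
    obtain ⟨c, hc⟩ := (h.2 _).1 hQ'
    refine ⟨fun i => c (e.symm i), fun z hz => hinj z hz _ _ ?_⟩
    rw [hsum _ z hz, hQ z hz, hc _ ⟨z, hz, rfl⟩]
    simp
  · rintro ⟨c, hc⟩
    exact ⟨_, (h.2 _).2 ⟨fun i => c (e i), fun _ _ => rfl⟩, fun z hz => by rw [hc z hz, hsum c z hz]⟩

/-! ### The listed bases -/

/-- The symmetry fields of an equation with `g = 1`. -/
noncomputable abbrev gaugedField (ξ₀ η₀ φ ψ A B c₀ c₁ a : ℝ) : VF :=
  symField (fun _ => 1) (fun t => t) ξ₀ η₀ φ ψ A B c₀ c₁ a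

lemma gaugedField_add (ξ₀ η₀ φ ψ A B c₀ c₁ a ξ₀' η₀' φ' ψ' A' B' c₀' c₁' a' : ℝ) (z : Pt) :
    gaugedField ξ₀ η₀ φ ψ A B c₀ c₁ a z + gaugedField ξ₀' η₀' φ' ψ' A' B' c₀' c₁' a' z
      = gaugedField (ξ₀ + ξ₀') (η₀ + η₀') (φ + φ') (ψ + ψ') (A + A') (B + B') (c₀ + c₀') (c₁ + c₁')
        (a + a') z := by
  ext i
  fin_cases i <;> simp [symField] <;> ring

/-- On `Ω`, a field `gaugedField` determines its parameters. -/
def Separating (Ω : Set Pt) : Prop :=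
  ∀ ξ₀ η₀ φ ψ A B c₀ c₁ a : ℝ, (∀ z ∈ Ω, gaugedField ξ₀ η₀ φ ψ A B c₀ c₁ a z = 0) →
    ξ₀ = 0 ∧ η₀ = 0 ∧ φ = 0 ∧ ψ = 0 ∧ A = 0 ∧ B = 0 ∧ c₀ = 0 ∧ c₁ = 0 ∧ a = 0

/-- The parameters `(φ, ψ, A, B)` of the fields spanned by `κ.extension`. -/
def KType.Span : KType → ℝ → ℝ → ℝ → ℝ → Prop
  | .arbitrary, φ, ψ, A, B => φ = 0 ∧ ψ = 0 ∧ A = 0 ∧ B = 0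
  | .power n, φ, ψ, A, B => ψ = 0 ∧ A = 0 ∧ B = n * φ
  | .exp, φ, ψ, A, B => φ = 0 ∧ A = 0 ∧ B = ψ
  | .log, φ, ψ, A, B => ψ = 0 ∧ A = φ ∧ B = 0

/-- The parameters `(c₀, c₁, a)` of the fields spanned by `ν.extension`. -/
def FType.Span : FType → ℝ → ℝ → ℝ → Prop
  | .arbitrary, c₀, c₁, a => c₀ = 0 ∧ c₁ = 0 ∧ a = 0
  | .power ρ _, c₀, c₁, a => c₀ = 0 ∧ 2 * a = (ρ + 1) * c₁
  | .exp _, c₀, c₁, a => c₁ = 0 ∧ c₀ = 2 * a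
  | .one, _, c₁, a => c₁ = 2 * a

lemma isBasisOn_dx_dy {Ω : Set Pt} (hΩ : Separating Ω) :
    IsBasisOn Ω (fun Q => ∃ ξ₀ η₀, ∀ z ∈ Ω, Q z = gaugedField ξ₀ η₀ 0 0 0 0 0 0 0 z) [dx, dy] := by
  have e : ∀ c : Fin [dx, dy].length → ℝ, ∀ z, ∑ i, c i • [dx, dy].get i z
      = gaugedField (c 0) (c 1) 0 0 0 0 0 0 0 z := fun c z => by
    ext i
    fin_cases i <;> simp [Fin.sum_univ_succ, dx, dy, symField]
  refine isBasisOn_of (fun c hc i => ?_) fun Q => ⟨?_, ?_⟩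
  · simp only [e] at hc
    have := hΩ _ _ _ _ _ _ _ _ _ hc
    fin_cases i
    exacts [this.1, this.2.1]
  · rintro ⟨ξ₀, η₀, h⟩
    exact ⟨![ξ₀, η₀], fun z hz => by rw [e, h z hz]; rfl⟩
  · rintro ⟨c, h⟩
    exact ⟨c 0, c 1, fun z hz => by rw [← e, h z hz]⟩

lemma KType.isBasisOn_extension {Ω : Set Pt} (hΩ : Separating Ω) (κ : KType) :
    IsBasisOn Ω (fun Q => ∃ φ ψ A B, κ.Span φ ψ A B ∧
      ∀ z ∈ Ω, Q z = gaugedField 0 0 φ ψ A B 0 0 0 z) κ.extension := by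
  have zero : ∀ z, gaugedField 0 0 0 0 0 0 0 0 0 z = 0 := fun z => by
    ext i; fin_cases i <;> simp [symField]
  cases κ with
  | arbitrary =>
    refine isBasisOn_nil fun Q => ⟨?_, fun h => ⟨0, 0, 0, 0, ⟨rfl, rfl, rfl, rfl⟩, ?_⟩⟩
    · rintro ⟨_, _, _, _, ⟨rfl, rfl, rfl, rfl⟩, h⟩ z hz
      rw [h z hz, zero]
    · intro z hz
      rw [h z hz, zero]
  | power n =>
    have e : ∀ (c : ℝ) (z : Pt), c • (![0, n * z 1, 0, z 3] : Pt)
        = gaugedField 0 0 c 0 0 (n * c) 0 0 0 z := fun c z => by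
      ext i; fin_cases i <;> simp [symField]; ring
    refine isBasisOn_singleton (fun c hc => ?_) fun Q => ⟨?_, ?_⟩
    · simp only [e] at hc
      exact (hΩ _ _ _ _ _ _ _ _ _ hc).2.2.1
    · rintro ⟨φ, _, _, _, ⟨rfl, rfl, rfl⟩, h⟩
      exact ⟨φ, fun z hz => by rw [e, h z hz]⟩
    · rintro ⟨c, hc⟩
      exact ⟨c, 0, 0, n * c, ⟨rfl, rfl, rfl⟩, fun z hz => by rw [hc z hz, e]⟩
  | exp =>
    have e : ∀ (c : ℝ) (z : Pt), c • (![0, z 1, 0, 1] : Pt)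
        = gaugedField 0 0 0 c 0 c 0 0 0 z := fun c z => by
      ext i; fin_cases i <;> simp [symField]
    refine isBasisOn_singleton (fun c hc => ?_) fun Q => ⟨?_, ?_⟩
    · simp only [e] at hc
      exact (hΩ _ _ _ _ _ _ _ _ _ hc).2.2.2.1
    · rintro ⟨_, ψ, _, _, ⟨rfl, rfl, rfl⟩, h⟩
      exact ⟨_, fun z hz => by rw [e, h z hz]⟩
    · rintro ⟨c, hc⟩
      exact ⟨0, c, 0, c, ⟨rfl, rfl, rfl⟩, fun z hz => by rw [hc z hz, e]⟩
  | log =>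
    have e : ∀ (c : ℝ) (z : Pt), c • (![0, z 0, 0, z 3] : Pt)
        = gaugedField 0 0 c 0 c 0 0 0 0 z := fun c z => by
      ext i; fin_cases i <;> simp [symField]
    refine isBasisOn_singleton (fun c hc => ?_) fun Q => ⟨?_, ?_⟩
    · simp only [e] at hc
      exact (hΩ _ _ _ _ _ _ _ _ _ hc).2.2.1
    · rintro ⟨φ, _, _, _, ⟨rfl, rfl, rfl⟩, h⟩
      exact ⟨_, fun z hz => by rw [e, h z hz]⟩
    · rintro ⟨c, hc⟩
      exact ⟨c, 0, c, 0, ⟨rfl, rfl, rfl⟩, fun z hz => by rw [hc z hz, e]⟩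

lemma FType.isBasisOn_extension {Ω : Set Pt} (hΩ : Separating Ω) (ν : FType) :
    IsBasisOn Ω (fun Q => ∃ c₀ c₁ a, ν.Span c₀ c₁ a ∧
      ∀ z ∈ Ω, Q z = gaugedField 0 0 0 0 0 0 c₀ c₁ a z) ν.extension := by
  have zero : ∀ z, gaugedField 0 0 0 0 0 0 0 0 0 z = 0 := fun z => by
    ext i; fin_cases i <;> simp [symField]
  cases ν with
  | arbitrary =>
    refine isBasisOn_nil fun Q => ⟨?_, fun h => ⟨0, 0, 0, ⟨rfl, rfl, rfl⟩, ?_⟩⟩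
    · rintro ⟨_, _, _, ⟨rfl, rfl, rfl⟩, h⟩ z hz
      rw [h z hz, zero]
    · intro z hz
      rw [h z hz, zero]
  | power ρ ε =>
    have e : ∀ (c : ℝ) (z : Pt), c • (![2 * z 0, 2 * z 1, (ρ + 1) * z 2, 0] : Pt)
        = gaugedField 0 0 0 0 0 0 0 (2 * c) ((ρ + 1) * c) z := fun c z => by
      ext i; fin_cases i <;> simp [symField] <;> ring
    refine isBasisOn_singleton (fun c hc => ?_) fun Q => ⟨?_, ?_⟩
    · simp only [e] at hc
      linarith [(hΩ _ _ _ _ _ _ _ _ _ hc).2.2.2.2.2.2.2.1]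
    · rintro ⟨_, c₁, a, ⟨rfl, ha⟩, h⟩
      refine ⟨c₁ / 2, fun z hz => ?_⟩
      rw [e, h z hz]
      congr 1 <;> linarith
    · rintro ⟨c, hc⟩
      exact ⟨0, 2 * c, (ρ + 1) * c, ⟨rfl, by ring⟩, fun z hz => by rw [hc z hz, e]⟩
  | exp ε =>
    have e : ∀ (c : ℝ) (z : Pt), c • (![2, 0, z 2, 0] : Pt)
        = gaugedField 0 0 0 0 0 0 (2 * c) 0 c z := fun c z => by
      ext i; fin_cases i <;> simp [symField]; ring
    refine isBasisOn_singleton (fun c hc => ?_) fun Q => ⟨?_, ?_⟩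
    · simp only [e] at hc
      exact (hΩ _ _ _ _ _ _ _ _ _ hc).2.2.2.2.2.2.2.2
    · rintro ⟨_, _, a, ⟨rfl, rfl⟩, h⟩
      exact ⟨a, fun z hz => by rw [e, h z hz]⟩
    · rintro ⟨c, hc⟩
      exact ⟨2 * c, 0, c, ⟨rfl, rfl⟩, fun z hz => by rw [hc z hz, e]⟩
  | one =>
    have e : ∀ (c : Fin FType.one.extension.length → ℝ) (z : Pt),
        ∑ i, c i • FType.one.extension.get i z
          = gaugedField 0 0 0 0 0 0 (c ⟨0, Nat.zero_lt_two⟩) (2 * c ⟨1, Nat.one_lt_two⟩)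
            (c ⟨1, Nat.one_lt_two⟩) z := fun c z => by
      rw [show ∑ i, c i • FType.one.extension.get i z = _ from Fin.sum_univ_two _]
      ext i
      fin_cases i <;> simp [symField, FType.extension, dt] <;> ring
    refine isBasisOn_of (fun c hc i => ?_) fun Q => ⟨?_, ?_⟩
    · simp only [e] at hc
      have := (hΩ _ _ _ _ _ _ _ _ _ hc).2.2.2.2.2.2
      fin_cases i
      exacts [this.1, this.2.2]
    · rintro ⟨c₀, _, a, rfl, h⟩
      exact ⟨![c₀, a], fun z hz => (h z hz).trans (e ![c₀, a] z).symm⟩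
    · rintro ⟨c, hc⟩
      exact ⟨_, _, _, rfl, fun z hz => by rw [hc z hz, e]⟩

/-- The fields `∂_x, ∂_y`, the `k`-extension and the `f`-extension occupy disjoint groups of
parameters. Since `Ω` separates the parameters, the sum of the three spans is direct. -/
lemma isBasisOn_tableBasis {Ω : Set Pt} (hΩ : Separating Ω) (c : KType × FType) :
    IsBasisOn Ω (fun Q => ∃ ξ₀ η₀ φ ψ A B c₀ c₁ a, c.1.Span φ ψ A B ∧ c.2.Span c₀ c₁ a ∧
      ∀ z ∈ Ω, Q z = gaugedField ξ₀ η₀ φ ψ A B c₀ c₁ a z) (tableBasis c) := by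
  refine isBasisOn_append
    (isBasisOn_append (S := fun Q => ∃ ξ₀ η₀ φ ψ A B, c.1.Span φ ψ A B ∧
      ∀ z ∈ Ω, Q z = gaugedField ξ₀ η₀ φ ψ A B 0 0 0 z) (isBasisOn_dx_dy hΩ)
      (c.1.isBasisOn_extension hΩ) ?_ ?_) (c.2.isBasisOn_extension hΩ) ?_ ?_
  · rintro Q₁ Q₂ ⟨ξ₀, η₀, h₁⟩ ⟨φ, ψ, A, B, -, h₂⟩ h
    have key : ∀ z ∈ Ω, _ := fun z hz => (congrArg₂ (· + ·) (h₁ z hz) (h₂ z hz)).symm.trans (h z hz)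
    simp only [gaugedField_add] at key
    have := hΩ _ _ _ _ _ _ _ _ _ key
    simp only [add_zero, zero_add] at this
    obtain ⟨rfl, rfl, rfl, rfl, rfl, rfl, -⟩ := this
    -- With all parameters zero, `Q₁` and `Q₂` are given by the same expression, so their sum is `2
    -- Q₁`.
    intro z hz
    have := h z hz
    rwa [h₂ z hz, ← h₁ z hz, ← two_smul ℝ, smul_eq_zero_iff_right two_ne_zero] at this
  · intro Q
    constructor
    · rintro ⟨ξ₀, η₀, φ, ψ, A, B, hs, h⟩
      exact ⟨_, _, ⟨ξ₀, η₀, fun _ _ => rfl⟩, ⟨φ, ψ, A, B, hs, fun _ _ => rfl⟩, fun z hz => by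
        rw [h z hz, gaugedField_add]; simp⟩
    · rintro ⟨Q₁, Q₂, ⟨ξ₀, η₀, h₁⟩, ⟨φ, ψ, A, B, hs, h₂⟩, h⟩
      exact ⟨ξ₀, η₀, φ, ψ, A, B, hs, fun z hz => by
        rw [h z hz, h₁ z hz, h₂ z hz, gaugedField_add]; simp⟩
  · rintro Q₁ Q₂ ⟨ξ₀, η₀, φ, ψ, A, B, -, h₁⟩ ⟨c₀, c₁, a, -, h₂⟩ h
    have key : ∀ z ∈ Ω, _ := fun z hz => (congrArg₂ (· + ·) (h₁ z hz) (h₂ z hz)).symm.trans (h z hz)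
    simp only [gaugedField_add] at key
    have := hΩ _ _ _ _ _ _ _ _ _ key
    simp only [add_zero, zero_add] at this
    obtain ⟨rfl, rfl, rfl, rfl, rfl, rfl, rfl, rfl, rfl⟩ := this
    intro z hz
    have := h z hz
    rwa [h₂ z hz, ← h₁ z hz, ← two_smul ℝ, smul_eq_zero_iff_right two_ne_zero] at this
  · intro Q
    constructor
    · rintro ⟨ξ₀, η₀, φ, ψ, A, B, c₀, c₁, a, hs, hs', h⟩
      exact ⟨_, _, ⟨ξ₀, η₀, φ, ψ, A, B, hs, fun _ _ => rfl⟩, ⟨c₀, c₁, a, hs', fun _ _ => rfl⟩,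
        fun z hz => by rw [h z hz, gaugedField_add]; simp⟩
    · rintro ⟨Q₁, Q₂, ⟨ξ₀, η₀, φ, ψ, A, B, hs, h₁⟩, ⟨c₀, c₁, a, hs', h₂⟩, h⟩
      exact ⟨ξ₀, η₀, φ, ψ, A, B, c₀, c₁, a, hs, hs', fun z hz => by
        rw [h z hz, h₁ z hz, h₂ z hz, gaugedField_add]; simp⟩

/-! ### Changes of variables -/

lemma IsOpenInterval.image {T : Set ℝ} (hT : IsOpenInterval T) {θ θ' : ℝ → ℝ}
    (hθ : ∀ t ∈ T, HasStrictDerivAt θ (θ' t) t) (h0 : ∀ t ∈ T, θ' t ≠ 0) :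
    IsOpenInterval (θ '' T) := by
  refine ⟨?_, ?_, hT.2.2.image θ⟩
  · rw [isOpen_iff_mem_nhds]
    rintro _ ⟨t, ht, rfl⟩
    rw [← (hθ t ht).map_nhds_eq (h0 t ht)]
    exact Filter.image_mem_map (hT.1.mem_nhds ht)
  · exact (hT.2.1.isPreconnected.image θ fun t ht =>
      (hθ t ht).hasDerivAt.continuousAt.continuousWithinAt).ordConnected

lemma hasStrictDerivAt_affine (p q u : ℝ) : HasStrictDerivAt (fun u => p * u + q) p u := by
  simpa using ((hasStrictDerivAt_id u).const_mul p).add_const q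

lemma IsOpenInterval.image_affine {T : Set ℝ} (hT : IsOpenInterval T) {p : ℝ} (hp : p ≠ 0) (q : ℝ) :
    IsOpenInterval ((fun u => p * u + q) '' T) :=
  hT.image (θ' := fun _ => p) (fun t _ => hasStrictDerivAt_affine p q t) fun _ _ => hp

/-- The coefficients of the target equation are known only through their composition with the change
of variable, and no regularity is assumed for them. Their derivatives are obtained through the local
inverse of `θ`. -/
lemma hasDerivAt_of_comp {T : Set ℝ} (hT : IsOpen T) {θ F h : ℝ → ℝ} {t θ' h' : ℝ} (ht : t ∈ T)
    (hθ : HasStrictDerivAt θ θ' t) (h0 : θ' ≠ 0) (hh : HasDerivAt h h' t)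
    (e : ∀ s ∈ T, F (θ s) = h s) : HasDerivAt F (h' / θ') (θ t) := by
  have hl := (hθ.to_localInverse h0).hasDerivAt
  have hlt : hθ.localInverse θ θ' t h0 (θ t) = t :=
    (hθ.hasStrictFDerivAt_equiv h0).localInverse_apply_image
  have hr : ∀ᶠ y in nhds (θ t), θ (hθ.localInverse θ θ' t h0 y) = y :=
    (hθ.hasStrictFDerivAt_equiv h0).eventually_right_inverse
  have hm : ∀ᶠ y in nhds (θ t), hθ.localInverse θ θ' t h0 y ∈ T :=
    hl.continuousAt.preimage_mem_nhds (by rw [hlt]; exact hT.mem_nhds ht)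
  have hc : HasDerivAt (fun y => h (hθ.localInverse θ θ' t h0 y)) (h' / θ') (θ t) := by
    rw [← hlt] at hh
    exact HasDerivAt.comp (h₂ := h) (θ t) hh hl
  refine hc.congr_of_eventuallyEq ?_
  filter_upwards [hr, hm] with y hy hy'
  rw [← e _ hy', hy]

lemma nonlinear_image {U : Set ℝ} (hU : IsOpen U) {k k' : ℝ → ℝ} (hk : ContDiffOn ℝ ∞ k U)
    (hn : ∃ u ∈ U, deriv (deriv k) u ≠ 0) {p q α β : ℝ} (hp : p ≠ 0) (hα : α ≠ 0)
    (e : ∀ u ∈ U, k' (p * u + q) = α * k u + β) :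
    (∀ u ∈ U, deriv k' (p * u + q) = α / p * deriv k u) ∧
      ∃ v ∈ (fun u => p * u + q) '' U, deriv (deriv k') v ≠ 0 := by
  have h1 : ∀ u ∈ U, deriv k' (p * u + q) = α / p * deriv k u := fun u hu => by
    rw [(hasDerivAt_of_comp hU hu (hasStrictDerivAt_affine p q u) hp
      (((hasDerivAt_of_smooth hU hk hu).const_mul α).add_const β) e).deriv]
    ring
  refine ⟨h1, ?_⟩
  obtain ⟨u, hu, hne⟩ := hn
  refine ⟨_, ⟨u, hu, rfl⟩, ?_⟩
  rw [(hasDerivAt_of_comp hU hu (hasStrictDerivAt_affine p q u) hp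
    ((hasDerivAt_of_smooth hU (contDiffOn_deriv hU hk) hu).const_mul (α / p)) h1).deriv]
  exact div_ne_zero (mul_ne_zero (div_ne_zero hα hp) hne) hp

lemma contDiffOn_image {U : Set ℝ} {k k' : ℝ → ℝ} (hk : ContDiffOn ℝ ∞ k U) {p q α β : ℝ}
    (hp : p ≠ 0) (e : ∀ u ∈ U, k' (p * u + q) = α * k u + β) :
    ContDiffOn ℝ ∞ k' ((fun u => p * u + q) '' U) := by
  have e' : ∀ u : ℝ, (p * u + q - q) / p = u := fun u => by field_simp; ring
  have h1 : ContDiffOn ℝ ∞ (fun v => α * k ((v - q) / p) + β) ((fun u => p * u + q) '' U) := by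
    refine (contDiffOn_const.mul (ContDiffOn.comp (g := k) (f := fun v => (v - q) / p) hk ?_ ?_)).add
      contDiffOn_const
    · exact (contDiffOn_id.sub contDiffOn_const).div_const p
    · rintro _ ⟨u, hu, rfl⟩
      simpa only [Set.mem_preimage, e'] using hu
  refine h1.congr ?_
  rintro _ ⟨u, hu, rfl⟩
  simp only [e', e u hu]

/-! ### The solution spaces for the listed forms -/

lemma kSol_iff_span {U : Set ℝ} {k : ℝ → ℝ} (hU : IsOpenInterval U) (hk : ContDiffOn ℝ ∞ k U)
    (hn : ∃ u ∈ U, deriv (deriv k) u ≠ 0) {κ : KType} {φ₀ ψ₀ A₀ B₀ : ℝ}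
    (h0 : φ₀ ≠ 0 ∨ ψ₀ ≠ 0) (hS : KSol U k φ₀ ψ₀ A₀ B₀)
    (hκ : ∀ φ ψ A B, κ.Span φ ψ A B ↔ ∃ s, φ = s * φ₀ ∧ ψ = s * ψ₀ ∧ A = s * A₀ ∧ B = s * B₀)
    (φ ψ A B : ℝ) : KSol U k φ ψ A B ↔ κ.Span φ ψ A B := by
  rw [hκ]
  constructor
  · exact fun h => hS.exists_eq_mul h h0 hU.1 hk hn
  · rintro ⟨s, rfl, rfl, rfl, rfl⟩ u hu
    linear_combination s * hS u hu

/-- The listed form holds up to scaling and adding a constant to `k`. -/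
lemma kSol_iff_span_of_matches {U : Set ℝ} {k : ℝ → ℝ} (hU : IsOpenInterval U)
    (hk : ContDiffOn ℝ ∞ k U) (hn : ∃ u ∈ U, deriv (deriv k) u ≠ 0) {κ : KType}
    (hκ : κ ≠ .arbitrary) {α β : ℝ} (hα : α ≠ 0) (hβ : κ = .log ∧ α = 1 ∨ β = 0)
    (hα' : κ = .log → α = 1)
    (h : κ.Matches U (fun u => α * k u + β)) (φ ψ A B : ℝ) :
    KSol U k φ ψ A B ↔ κ.Span φ ψ A B := by
  cases κ with
  | arbitrary => exact absurd rfl hκ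
  | power n =>
    obtain ⟨h0, h1, hd, h⟩ := h
    obtain rfl : β = 0 := by simpa using hβ
    have := kSol_power hU.1 (k := k) (p := 1) (q := 0) (β := 0) hα h0
      (hd.imp_left fun h u hu => by simpa using h hu) (by simpa using h)
    exact kSol_iff_span hU hk hn (Or.inl one_ne_zero) this (fun φ ψ A B => by
      simp [KType.Span, mul_comm]) φ ψ A B
  | exp =>
    obtain rfl : β = 0 := by simpa using hβ
    have := kSol_exp hU.1 (k := k) (p := 1) (q := 0) (β := 0) hα (by simpa [KType.Matches] using h)
    exact kSol_iff_span hU hk hn (Or.inr one_ne_zero) this (fun φ ψ A B => by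
      simp [KType.Span, and_left_comm, eq_comm]) φ ψ A B
  | log =>
    -- Here `β` is harmless: for the logarithm `B = 0`, so only `k_u` enters the relation. A factor
    -- `α` would rescale `A`, hence `α = 1`.
    obtain rfl := hα' rfl
    have := kSol_log hU.1 (k := k) (p := 1) (q := 0) hα (fun u hu => by simpa using h.1 hu)
      (by simpa using h.2)
    exact kSol_iff_span hU hk hn (Or.inl one_ne_zero) this (fun φ ψ A B => by
      simp [KType.Span, eq_comm]) φ ψ A B

lemma kSol_iff_span_arbitrary {U : Set ℝ} {k : ℝ → ℝ} (hU : IsOpenInterval U)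
    (hk : ContDiffOn ℝ ∞ k U) (hn : ∃ u ∈ U, deriv (deriv k) u ≠ 0)
    (h : ∀ κ, κ ≠ .arbitrary → ¬ KNF κ U k) (φ ψ A B : ℝ) :
    KSol U k φ ψ A B ↔ KType.arbitrary.Span φ ψ A B := by
  constructor
  · intro hS
    by_cases h0 : φ ≠ 0 ∨ ψ ≠ 0
    · obtain ⟨κ, hκ, hκ'⟩ := exists_kNF_of_kSol hU hk hn hS h0
      exact absurd hκ' (h κ hκ)
    · push Not at h0
      obtain ⟨rfl, rfl⟩ := h0
      exact ⟨rfl, rfl, hS.eq_zero hU.1 hk hn⟩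
  · rintro ⟨rfl, rfl, rfl, rfl⟩ u -
    ring

lemma tSol_iff_span {T : Set ℝ} {f : ℝ → ℝ} (hT : IsOpenInterval T) (hf : DifferentiableOn ℝ f T)
    (hf0 : ∀ t ∈ T, f t ≠ 0) {ν : FType} (hm : ν.Matches T f)
    (harb : ν = .arbitrary → ∀ ν', ν' ≠ .arbitrary → ¬ FNF ν' T f) (c₀ c₁ a : ℝ) :
    TSol T f c₀ c₁ a ↔ ν.Span c₀ c₁ a := by
  obtain ⟨t₀, ht₀⟩ := hT.2.2
  have aux : (∃ t ∈ T, deriv f t ≠ 0) → ∀ C₀ C₁ a₀ : ℝ, C₀ ≠ 0 ∨ C₁ ≠ 0 → TSol T f C₀ C₁ a₀ →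
      (TSol T f c₀ c₁ a ↔ ∃ s, c₀ = s * C₀ ∧ c₁ = s * C₁ ∧ a = s * a₀) := by
    intro hn C₀ C₁ a₀ h0 hS
    constructor
    · exact fun h => hS.exists_eq_mul hT hf0 hn h h0
    · rintro ⟨s, rfl, rfl, rfl⟩ t ht
      linear_combination s * hS t ht
  cases ν with
  | arbitrary =>
    constructor
    · intro h
      by_cases h0 : c₀ ≠ 0 ∨ c₁ ≠ 0
      · obtain ⟨ν, hν, hν'⟩ := exists_fNF_of_tSol hT hf hf0 h h0
        exact absurd hν' (harb rfl ν hν)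
      · push Not at h0
        obtain ⟨rfl, rfl⟩ := h0
        have := h t₀ ht₀
        simp [hf0 t₀ ht₀] at this
        exact ⟨rfl, rfl, this⟩
    · rintro ⟨rfl, rfl, rfl⟩ t -
      ring
  | power ρ ε =>
    obtain ⟨hρ, hpos, h⟩ := hm
    have hd : ∀ t ∈ T, t * deriv f t = ρ * f t := fun t ht => by
      have hp : 0 < t := hpos ht
      rw [deriv_eqOn_of_eqOn hT.1 h ht ((Real.hasDerivAt_rpow_const (Or.inl hp.ne')).const_mul _),
        h t ht, Real.rpow_sub_one hp.ne']
      field_simp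
    -- The generating solution `(0, 2, ρ + 1)` consists of the parameters of the listed field.
    rw [aux ⟨t₀, ht₀, fun h0 => ?_⟩ 0 2 (ρ + 1) (Or.inr two_ne_zero) fun t ht => by
      linear_combination 2 * hd t ht]
    · constructor
      · rintro ⟨s, rfl, rfl, rfl⟩
        exact ⟨by ring, by ring⟩
      · rintro ⟨rfl, ha⟩
        exact ⟨c₁ / 2, by ring, by ring, by linarith⟩
    · have := hd t₀ ht₀
      rw [h0, mul_zero] at this
      exact mul_ne_zero hρ (hf0 t₀ ht₀) this.symm
  | exp ε =>
    have hd : ∀ t ∈ T, deriv f t = f t := fun t ht => by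
      rw [deriv_eqOn_of_eqOn hT.1 hm ht ((Real.hasDerivAt_exp t).const_mul _), hm t ht]
    rw [aux ⟨t₀, ht₀, fun h0 => ?_⟩ 2 0 1 (Or.inl two_ne_zero) fun t ht => by
      linear_combination 2 * hd t ht]
    · constructor
      · rintro ⟨s, rfl, rfl, rfl⟩
        exact ⟨by ring, by ring⟩
      · rintro ⟨rfl, rfl⟩
        exact ⟨a, by ring, by ring, by ring⟩
    · exact hf0 t₀ ht₀ ((hd t₀ ht₀).symm.trans h0)
  | one =>
    exact tSol_iff_of_const hT hf0 fun t ht =>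
      deriv_eqOn_of_eqOn hT.1 hm ht (hasDerivAt_const t 1)

/-! ### Symmetries and the listed bases -/

/-- The equation with the coefficients `f`, `g`, `k` is mapped by `φ` to the equation with the
coefficients `f'`, `1`, `k'`. -/
structure OrigTransf.MapsCoeffs (φ : OrigTransf) (ε₀ : ℝ) (T U : Set ℝ) (f g k f' k' : ℝ → ℝ) :
    Prop where
  θ_eq : ∀ t ∈ T, φ.θ t = φ.ε₁ * φ.G t + ε₀
  f_eq : ∀ t ∈ T, f' (φ.θ t) = φ.δ₄ ^ 2 / φ.ε₁ * (f t / g t)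
  k_eq : ∀ u ∈ U, k' (φ.δ₆ * u + φ.δ₇) = 1 / φ.ε₁ * (φ.δ₁ * k u + φ.δ₂)

lemma OrigTransf.ne_zeros (φ : OrigTransf) : φ.δ₁ ≠ 0 ∧ φ.δ₄ ≠ 0 ∧ φ.δ₆ ≠ 0 ∧ φ.ε₁ ≠ 0 := by
  simpa [and_assoc] using φ.ne_zero

section
variable {T X Y U : Set ℝ} {f g k f' k' : ℝ → ℝ} {φ : OrigTransf} {ε₀ : ℝ}

lemma OrigTransf.MapsCoeffs.hasStrictDerivAt (M : φ.MapsCoeffs ε₀ T U f g k f' k')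
    (H : Coeffs T U f g φ.G k) {t : ℝ} (ht : t ∈ T) : HasStrictDerivAt φ.θ (φ.ε₁ * g t) t := by
  have h1 : HasStrictDerivAt φ.G (g t) t := by
    have := (H.contDiffOn_G.contDiffAt (H.isOpenInterval_T.1.mem_nhds ht)).hasStrictDerivAt
      (by simp)
    rwa [(H.hasDerivAt_G t ht).deriv] at this
  have h2 : HasStrictDerivAt (fun t => φ.ε₁ * φ.G t + ε₀) (φ.ε₁ * g t) t :=
    (h1.const_mul φ.ε₁).add_const ε₀
  refine h2.congr_of_eventuallyEq ?_
  filter_upwards [H.isOpenInterval_T.1.mem_nhds ht] with s hs using (M.θ_eq s hs).symm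

lemma OrigTransf.MapsCoeffs.hasDerivAt_f (M : φ.MapsCoeffs ε₀ T U f g k f' k')
    (H : Coeffs T U f g φ.G k) {t : ℝ} (ht : t ∈ T) :
    HasDerivAt f' (φ.δ₄ ^ 2 / φ.ε₁ * deriv (fun s => f s / g s) t / (φ.ε₁ * g t)) (φ.θ t) := by
  have hs : ContDiffOn ℝ ∞ (fun s => f s / g s) T := H.smooth_f.div H.smooth_g H.g_ne_zero
  exact hasDerivAt_of_comp H.isOpenInterval_T.1 ht (M.hasStrictDerivAt H ht)
    (mul_ne_zero φ.ne_zeros.2.2.2 (H.g_ne_zero t ht))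
    ((hasDerivAt_of_smooth H.isOpenInterval_T.1 hs ht).const_mul _) M.f_eq

/-- Transformation of the parameters of symmetries. -/
lemma OrigTransf.MapsCoeffs.symParams_iff (M : φ.MapsCoeffs ε₀ T U f g k f' k')
    (H : Coeffs T U f g φ.G k) (p q A B c₀ c₁ a : ℝ) :
    SymParams T U f g φ.G k p q A B c₀ c₁ a ↔
      KSol ((fun u => φ.δ₆ * u + φ.δ₇) '' U) k' p (φ.δ₆ * q - p * φ.δ₇)
        ((φ.δ₁ * A - B * φ.δ₂) / φ.ε₁) B ∧
      TSol (φ.θ '' T) f' (φ.ε₁ * c₀ - c₁ * ε₀) c₁ a := by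
  obtain ⟨h1, h4, h6, hε⟩ := φ.ne_zeros
  have hk : KSol U k p q A B ↔ KSol ((fun u => φ.δ₆ * u + φ.δ₇) '' U) k' p (φ.δ₆ * q - p * φ.δ₇)
        ((φ.δ₁ * A - B * φ.δ₂) / φ.ε₁) B := by
    unfold KSol
    rw [Set.forall_mem_image]
    refine forall₂_congr fun u hu => ?_
    rw [(nonlinear_image H.isOpenInterval_U.1 H.smooth_k H.nonlinear (k' := k') h6
      (α := φ.δ₁ / φ.ε₁) (β := φ.δ₂ / φ.ε₁) (div_ne_zero h1 hε)
      fun u hu => by rw [M.k_eq u hu]; ring).1 u hu, M.k_eq u hu]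
    constructor
    · intro h
      field_simp
      linear_combination φ.δ₆ * φ.δ₁ * h
    · intro h
      field_simp at h
      apply mul_left_cancel₀ (mul_ne_zero h6 h1)
      linear_combination h
  have hf : FSol T f g φ.G c₀ c₁ a ↔ TSol (φ.θ '' T) f' (φ.ε₁ * c₀ - c₁ * ε₀) c₁ a := by
    unfold FSol TSol
    rw [Set.forall_mem_image]
    refine forall₂_congr fun t ht => ?_
    rw [(M.hasDerivAt_f H ht).deriv, M.f_eq t ht, M.θ_eq t ht]
    have hg := H.g_ne_zero t ht
    generalize deriv (fun s => f s / g s) t = D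
    constructor
    · intro h
      field_simp
      linear_combination φ.ε₁ * h
    · intro h
      field_simp at h
      apply mul_left_cancel₀ hε
      linear_combination h
  exact ⟨fun h => ⟨hk.1 h.kSol, hf.1 h.fSol⟩, fun h => ⟨hk.2 h.1, hf.2 h.2⟩⟩

lemma OrigTransf.MapsCoeffs.fderiv_map (M : φ.MapsCoeffs ε₀ T U f g k f' k')
    (H : Coeffs T U f g φ.G k) {z : Pt} (hz : z 0 ∈ T) (v : Pt) :
    fderiv ℝ φ.map z v = ![φ.ε₁ * g (z 0) * v 0, φ.δ₁ * v 1 + φ.δ₂ * (g (z 0) * v 0), φ.δ₄ * v 2,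
      φ.δ₆ * v 3] := by
  have hc : ∀ i : Fin 4, HasFDerivAt (fun z : Pt => z i)
      (ContinuousLinearMap.proj (R := ℝ) (φ := fun _ : Fin 4 => ℝ) i) z := fun i =>
    hasFDerivAt_apply i z
  have hθ := HasDerivAt.comp_hasFDerivAt (h₂ := φ.θ) z (M.hasStrictDerivAt H hz).hasDerivAt (hc 0)
  have hG := HasDerivAt.comp_hasFDerivAt (h₂ := φ.G) z (H.hasDerivAt_G _ hz) (hc 0)
  have : HasFDerivAt φ.map (ContinuousLinearMap.pi
      ![(φ.ε₁ * g (z 0)) • ContinuousLinearMap.proj (R := ℝ) (φ := fun _ : Fin 4 => ℝ) 0,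
        φ.δ₁ • ContinuousLinearMap.proj (R := ℝ) (φ := fun _ : Fin 4 => ℝ) 1
          + φ.δ₂ • (g (z 0) • ContinuousLinearMap.proj (R := ℝ) (φ := fun _ : Fin 4 => ℝ) 0),
        φ.δ₄ • ContinuousLinearMap.proj (R := ℝ) (φ := fun _ : Fin 4 => ℝ) 2,
        φ.δ₆ • ContinuousLinearMap.proj (R := ℝ) (φ := fun _ : Fin 4 => ℝ) 3]) z := by
    rw [hasFDerivAt_pi']
    intro i
    fin_cases i
    · exact hθ
    · exact (((hc 1).const_mul φ.δ₁).add (hG.const_mul φ.δ₂)).add_const φ.δ₃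
    · exact ((hc 2).const_mul φ.δ₄).add_const φ.δ₅
    · exact ((hc 3).const_mul φ.δ₆).add_const φ.δ₇
  rw [this.fderiv]
  ext i
  fin_cases i <;> simp

/-- The push-forward of a symmetry field. -/
lemma OrigTransf.MapsCoeffs.fderiv_map_symField (M : φ.MapsCoeffs ε₀ T U f g k f' k')
    (H : Coeffs T U f g φ.G k) (ξ₀ η₀ p q A B c₀ c₁ a : ℝ) {z : Pt} (hz : z 0 ∈ T) :
    fderiv ℝ φ.map z (symField g φ.G ξ₀ η₀ p q A B c₀ c₁ a z)
      = gaugedField (φ.δ₁ * ξ₀ + φ.δ₂ * c₀ - (φ.δ₁ * A - B * φ.δ₂) / φ.ε₁ * ε₀ - (B + c₁) * φ.δ₃)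
        (φ.δ₄ * η₀ - a * φ.δ₅) p (φ.δ₆ * q - p * φ.δ₇) ((φ.δ₁ * A - B * φ.δ₂) / φ.ε₁) B
        (φ.ε₁ * c₀ - c₁ * ε₀) c₁ a (φ.map z) := by
  have hg := H.g_ne_zero _ hz
  have hε := φ.ne_zeros.2.2.2
  rw [M.fderiv_map H hz]
  ext i
  fin_cases i
  · simp [symField, OrigTransf.map, M.θ_eq _ hz]
    field_simp
    ring
  · simp [symField, OrigTransf.map, M.θ_eq _ hz]
    field_simp
    ring
  · simp [symField, OrigTransf.map]
    ring
  · simp [symField, OrigTransf.map]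
    ring

/-- By `isLieSymmetry_iff` the symmetries of the source are the fields of the general form whose
parameters satisfy two conditions. The push-forward is a bijection onto the fields `gaugedField`
whose parameters satisfy the corresponding conditions for `f'` and `k'`, which by `hK` and `hF`
describe the span of the listed basis. -/
theorem OrigTransf.MapsCoeffs.isBasisOn (M : φ.MapsCoeffs ε₀ T U f g k f' k')
    (H : Coeffs T U f g φ.G k) (hX : IsOpenInterval X) (hY : IsOpenInterval Y)
    {c : KType × FType}
    (hK : ∀ p q A B, KSol ((fun u => φ.δ₆ * u + φ.δ₇) '' U) k' p q A B ↔ c.1.Span p q A B)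
    (hF : ∀ c₀ c₁ a, TSol (φ.θ '' T) f' c₀ c₁ a ↔ c.2.Span c₀ c₁ a) :
    IsBasisOn (box T X Y U) (IsLieSymmetry (box T X Y U) (kolmogorov f g k))
      ((tableBasis c).map (VectorField.pullback ℝ φ.map)) := by
  obtain ⟨h1, h4, h6, hε⟩ := φ.ne_zeros
  have inj : ∀ z ∈ box T X Y U, ∀ v, fderiv ℝ φ.map z v = 0 → v = 0 := by
    intro z hz v hv
    have hg := H.g_ne_zero _ hz.1
    rw [M.fderiv_map H hz.1] at hv
    have e0 := congrFun hv 0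
    have e1 := congrFun hv 1
    have e2 := congrFun hv 2
    have e3 := congrFun hv 3
    simp [hε, hg, h4, h6] at e0 e1 e2 e3
    simp [e0, h1] at e1
    ext i
    fin_cases i <;> assumption
  -- the parameters of the preimage of a field with given parameters
  have surj : ∀ ξ₀' η₀' p q' A' B c₀' c₁ a : ℝ, ∃ ξ₀ η₀ q A c₀ : ℝ,
      ξ₀' = φ.δ₁ * ξ₀ + φ.δ₂ * c₀ - (φ.δ₁ * A - B * φ.δ₂) / φ.ε₁ * ε₀ - (B + c₁) * φ.δ₃ ∧
      η₀' = φ.δ₄ * η₀ - a * φ.δ₅ ∧ q' = φ.δ₆ * q - p * φ.δ₇ ∧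
      A' = (φ.δ₁ * A - B * φ.δ₂) / φ.ε₁ ∧ c₀' = φ.ε₁ * c₀ - c₁ * ε₀ := by
    intro ξ₀' η₀' p q' A' B c₀' c₁ a
    refine ⟨(ξ₀' - φ.δ₂ * ((c₀' + c₁ * ε₀) / φ.ε₁) + A' * ε₀ + (B + c₁) * φ.δ₃) / φ.δ₁,
      (η₀' + a * φ.δ₅) / φ.δ₄, (q' + p * φ.δ₇) / φ.δ₆, (φ.ε₁ * A' + B * φ.δ₂) / φ.δ₁,
      (c₀' + c₁ * ε₀) / φ.ε₁, ?_, ?_, ?_, ?_, ?_⟩ <;> field_simp <;> ring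
  -- A field of the general form that vanishes on the image is the push-forward of one that vanishes
  -- on the box, where the parameters are determined.
  have hsep : Separating (φ.map '' box T X Y U) := by
    intro ξ₀' η₀' p q' A' B c₀' c₁ a h
    obtain ⟨ξ₀, η₀, q, A, c₀, rfl, rfl, rfl, rfl, rfl⟩ := surj ξ₀' η₀' p q' A' B c₀' c₁ a
    obtain ⟨rfl, rfl, rfl, rfl, rfl, rfl, rfl, rfl, rfl⟩ := symField_eq_zero H hX hY
      (ξ₀ := ξ₀) (η₀ := η₀) (φ := p) (ψ := q) (A := A) (B := B) (c₀ := c₀) (c₁ := c₁) (a := a)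
      fun z hz => inj z hz _ (by rw [M.fderiv_map_symField H _ _ _ _ _ _ _ _ _ hz.1, h _ ⟨z, hz, rfl⟩])
    simp
  refine (isBasisOn_tableBasis hsep c).pullback inj fun Q => ?_
  rw [isLieSymmetry_iff H hX hY]
  constructor
  · rintro ⟨ξ₀, η₀, p, q, A, B, c₀, c₁, a, P, hQ⟩
    obtain ⟨P₁, P₂⟩ := (M.symParams_iff H ..).1 P
    exact ⟨_, ⟨_, _, _, _, _, _, _, _, _, (hK _ _ _ _).1 P₁, (hF _ _ _).1 P₂, fun _ _ => rfl⟩,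
      fun z hz => by rw [hQ z hz]; exact M.fderiv_map_symField H ξ₀ η₀ p q A B c₀ c₁ a hz.1⟩
  · rintro ⟨Q', ⟨ξ₀', η₀', p, q', A', B, c₀', c₁, a, P₁, P₂, hQ'⟩, hQ⟩
    obtain ⟨ξ₀, η₀, q, A, c₀, rfl, rfl, rfl, rfl, rfl⟩ := surj ξ₀' η₀' p q' A' B c₀' c₁ a
    refine ⟨ξ₀, η₀, p, q, A, B, c₀, c₁, a,
      (M.symParams_iff H ..).2 ⟨(hK _ _ _ _).2 P₁, (hF _ _ _).2 P₂⟩, fun z hz => ?_⟩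
    refine sub_eq_zero.1 (inj z hz _ ?_)
    rw [map_sub, hQ z hz, hQ' _ ⟨z, hz, rfl⟩, M.fderiv_map_symField H _ _ _ _ _ _ _ _ _ hz.1,
      sub_self]
end

/-! ### Equivalence of coefficients -/

/-- The functions `k` on `U` and `k'` on `U'` are related by affine transformations of `u` and of
`k`. -/
def KEquiv (U : Set ℝ) (k : ℝ → ℝ) (U' : Set ℝ) (k' : ℝ → ℝ) : Prop :=
  ∃ p q α β : ℝ, p ≠ 0 ∧ α ≠ 0 ∧ U' = (fun u => p * u + q) '' U ∧
    ∀ u ∈ U, k' (p * u + q) = α * k u + β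

/-- The functions `f` on `T` and `f'` on `T'` are related by an affine transformation of `t` and a
scaling of `y`. -/
def FEquiv (T : Set ℝ) (f : ℝ → ℝ) (T' : Set ℝ) (f' : ℝ → ℝ) : Prop :=
  ∃ p q d : ℝ, p ≠ 0 ∧ d ≠ 0 ∧ T' = (fun t => p * t + q) '' T ∧
    ∀ t ∈ T, f' (p * t + q) = d ^ 2 / p * f t

section
variable {U U' U'' T T' T'' : Set ℝ} {k k' k'' f f' f'' : ℝ → ℝ}

lemma KEquiv.refl (U : Set ℝ) (k : ℝ → ℝ) : KEquiv U k U k :=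
  ⟨1, 0, 1, 0, one_ne_zero, one_ne_zero, by simp, by simp⟩

lemma FEquiv.refl (T : Set ℝ) (f : ℝ → ℝ) : FEquiv T f T f :=
  ⟨1, 0, 1, one_ne_zero, one_ne_zero, by simp, by simp⟩

lemma KEquiv.symm (h : KEquiv U k U' k') : KEquiv U' k' U k := by
  obtain ⟨p, q, α, β, hp, hα, rfl, h⟩ := h
  have e : ∀ u : ℝ, p⁻¹ * (p * u + q) + -q / p = u := fun u => by field_simp; ring
  refine ⟨p⁻¹, -q / p, α⁻¹, -β / α, inv_ne_zero hp, inv_ne_zero hα, ?_, ?_⟩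
  · simp [Set.image_image, e]
  · rintro _ ⟨u, hu, rfl⟩
    simp only [e, h u hu]
    field_simp
    ring

lemma KEquiv.trans (h : KEquiv U k U' k') (h' : KEquiv U' k' U'' k'') : KEquiv U k U'' k'' := by
  obtain ⟨p, q, α, β, hp, hα, rfl, h⟩ := h
  obtain ⟨p', q', α', β', hp', hα', rfl, h'⟩ := h'
  have e : ∀ u : ℝ, p' * p * u + (p' * q + q') = p' * (p * u + q) + q' := fun u => by ring
  refine ⟨p' * p, p' * q + q', α' * α, α' * β + β', mul_ne_zero hp' hp, mul_ne_zero hα' hα, ?_,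
    fun u hu => ?_⟩
  · simp [Set.image_image, e]
  · rw [e, h' _ ⟨u, hu, rfl⟩, h u hu]
    ring

lemma FEquiv.symm (h : FEquiv T f T' f') : FEquiv T' f' T f := by
  obtain ⟨p, q, d, hp, hd, rfl, h⟩ := h
  have e : ∀ u : ℝ, p⁻¹ * (p * u + q) + -q / p = u := fun u => by field_simp; ring
  refine ⟨p⁻¹, -q / p, d⁻¹, inv_ne_zero hp, inv_ne_zero hd, ?_, ?_⟩
  · simp [Set.image_image, e]
  · rintro _ ⟨u, hu, rfl⟩
    simp only [e, h u hu]
    field_simp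

lemma FEquiv.trans (h : FEquiv T f T' f') (h' : FEquiv T' f' T'' f'') : FEquiv T f T'' f'' := by
  obtain ⟨p, q, d, hp, hd, rfl, h⟩ := h
  obtain ⟨p', q', d', hp', hd', rfl, h'⟩ := h'
  have e : ∀ u : ℝ, p' * p * u + (p' * q + q') = p' * (p * u + q) + q' := fun u => by ring
  refine ⟨p' * p, p' * q + q', d' * d, mul_ne_zero hp' hp, mul_ne_zero hd' hd, ?_, fun u hu => ?_⟩
  · simp [Set.image_image, e]
  · rw [e, h' _ ⟨u, hu, rfl⟩, h u hu]
    field_simp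

lemma KType.Matches.congr {κ : KType} (h : κ.Matches U k) (e : Set.EqOn k' k U) :
    κ.Matches U k' := by
  cases κ with
  | arbitrary => trivial
  | power n => exact ⟨h.1, h.2.1, h.2.2.1, fun u hu => (e hu).trans (h.2.2.2 u hu)⟩
  | exp => exact fun u hu => (e hu).trans (h u hu)
  | log => exact ⟨h.1, fun u hu => (e hu).trans (h.2 u hu)⟩

lemma FType.Matches.congr {ν : FType} (h : ν.Matches T f) (e : Set.EqOn f' f T) :
    ν.Matches T f' := by
  cases ν with
  | arbitrary => trivial
  | power ρ ε => exact ⟨h.1, h.2.1, fun u hu => (e hu).trans (h.2.2 u hu)⟩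
  | exp ε => exact fun u hu => (e hu).trans (h u hu)
  | one => exact fun u hu => (e hu).trans (h u hu)

/-- In this formulation the reducibility of `k` to a given form is visibly invariant under the
equivalence relation. -/
lemma kNF_iff {κ : KType} : KNF κ U k ↔ ∃ U' k', KEquiv U k U' k' ∧ κ.Matches U' k' := by
  have e : ∀ {p : ℝ} (q u : ℝ), p ≠ 0 → (p * u + q - q) / p = u := fun q u hp => by
    field_simp; ring
  constructor
  · rintro ⟨p, q, α, β, hp, hα, h⟩
    exact ⟨_, _, ⟨p, q, α, β, hp, hα, rfl, fun u _ => by simp only [e q u hp]⟩, h⟩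
  · rintro ⟨_, k', ⟨p, q, α, β, hp, hα, rfl, h⟩, hm⟩
    refine ⟨p, q, α, β, hp, hα, hm.congr ?_⟩
    rintro _ ⟨u, hu, rfl⟩
    simp only [e q u hp, h u hu]

lemma fNF_iff {ν : FType} : FNF ν T f ↔ ∃ T' f', FEquiv T f T' f' ∧ ν.Matches T' f' := by
  have e : ∀ {p : ℝ} (q u : ℝ), p ≠ 0 → (p * u + q - q) / p = u := fun q u hp => by
    field_simp; ring
  constructor
  · rintro ⟨p, q, d, hp, hd, h⟩
    exact ⟨_, _, ⟨p, q, d, hp, hd, rfl, fun u _ => by simp only [e q u hp]⟩, h⟩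
  · rintro ⟨_, f', ⟨p, q, d, hp, hd, rfl, h⟩, hm⟩
    refine ⟨p, q, d, hp, hd, hm.congr ?_⟩
    rintro _ ⟨u, hu, rfl⟩
    simp only [e q u hp, h u hu]

lemma KEquiv.kNF_iff (h : KEquiv U k U' k') {κ : KType} : KNF κ U' k' ↔ KNF κ U k := by
  simp only [Kolmogorov.kNF_iff]
  exact ⟨fun ⟨V, l, h', hm⟩ => ⟨V, l, h.trans h', hm⟩,
    fun ⟨V, l, h', hm⟩ => ⟨V, l, h.symm.trans h', hm⟩⟩

lemma FEquiv.fNF_iff (h : FEquiv T f T' f') {ν : FType} : FNF ν T' f' ↔ FNF ν T f := by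
  simp only [Kolmogorov.fNF_iff]
  exact ⟨fun ⟨V, l, h', hm⟩ => ⟨V, l, h.trans h', hm⟩,
    fun ⟨V, l, h', hm⟩ => ⟨V, l, h.symm.trans h', hm⟩⟩

/-- `k` is reduced to the form `κ`, where `arbitrary` means not to be reducible to any other form. -/
def KType.Of (U : Set ℝ) (k : ℝ → ℝ) (κ : KType) : Prop :=
  (κ ≠ .arbitrary → KNF κ U k) ∧ (κ = .arbitrary → ∀ κ', κ' ≠ .arbitrary → ¬ KNF κ' U k)

/-- `f` is reduced to the form `ν`, where `arbitrary` means not to be reducible to any other form. -/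
def FType.Of (T : Set ℝ) (f : ℝ → ℝ) (ν : FType) : Prop :=
  (ν ≠ .arbitrary → FNF ν T f) ∧ (ν = .arbitrary → ∀ ν', ν' ≠ .arbitrary → ¬ FNF ν' T f)

/-- `arbitrary` is by definition the complement of the other types, which exclude each other by
`KNF.unique`. -/
lemma KType.existsUnique_of (hU : IsOpen U) (hk : ContDiffOn ℝ ∞ k U)
    (hn : ∃ u ∈ U, deriv (deriv k) u ≠ 0) : ∃! κ, KType.Of U k κ := by
  by_cases h : ∃ κ, κ ≠ .arbitrary ∧ KNF κ U k
  · obtain ⟨κ, h0, hκ⟩ := h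
    refine ⟨κ, ⟨fun _ => hκ, fun h => absurd h h0⟩, fun κ' hκ' => ?_⟩
    by_cases h' : κ' = .arbitrary
    · exact absurd hκ (hκ'.2 h' κ h0)
    · exact KNF.unique hU hk hn h' h0 (hκ'.1 h') hκ
  · push Not at h
    exact ⟨.arbitrary, ⟨fun h => absurd rfl h, fun _ => h⟩,
      fun κ' hκ' => by_contra fun h' => h κ' h' (hκ'.1 h')⟩

lemma FType.existsUnique_of (hT : IsOpenInterval T) : ∃! ν, FType.Of T f ν := by
  by_cases h : ∃ ν, ν ≠ .arbitrary ∧ FNF ν T f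
  · obtain ⟨ν, h0, hν⟩ := h
    refine ⟨ν, ⟨fun _ => hν, fun h => absurd h h0⟩, fun ν' hν' => ?_⟩
    by_cases h' : ν' = .arbitrary
    · exact absurd hν (hν'.2 h' ν h0)
    · exact FNF.unique hT h' h0 (hν'.1 h') hν
  · push Not at h
    exact ⟨.arbitrary, ⟨fun h => absurd rfl h, fun _ => h⟩,
      fun ν' hν' => by_contra fun h' => h ν' h' (hν'.1 h')⟩

lemma existsUnique_prod {α β : Type*} {p : α → Prop} {q : β → Prop} (hp : ∃! a, p a)
    (hq : ∃! b, q b) : ∃! c : α × β, p c.1 ∧ q c.2 := by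
  obtain ⟨a, ha, ha'⟩ := hp
  obtain ⟨b, hb, hb'⟩ := hq
  exact ⟨(a, b), ⟨ha, hb⟩, fun c hc => Prod.ext (ha' _ hc.1) (hb' _ hc.2)⟩

/-- The form of `k` is one of the list. -/
def KType.IsExact (U : Set ℝ) (k : ℝ → ℝ) (κ : KType) : Prop :=
  κ.Matches U k ∧ (κ = .arbitrary → ∀ κ', κ' ≠ .arbitrary → ¬ KNF κ' U k)

/-- The form of `f` is one of the list. -/
def FType.IsExact (T : Set ℝ) (f : ℝ → ℝ) (ν : FType) : Prop :=
  ν.Matches T f ∧ (ν = .arbitrary → ∀ ν', ν' ≠ .arbitrary → ¬ FNF ν' T f)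

lemma KType.of_iff {κ : KType} :
    κ.Of U k ↔ ∃ U' k', KEquiv U k U' k' ∧ κ.IsExact U' k' := by
  constructor
  · intro h
    by_cases h0 : κ = .arbitrary
    · exact ⟨U, k, .refl U k, by subst h0; trivial, h.2⟩
    · obtain ⟨U', k', he, hm⟩ := kNF_iff.1 (h.1 h0)
      exact ⟨U', k', he, hm, fun h => absurd h h0⟩
  · rintro ⟨U', k', he, hm, ha⟩
    exact ⟨fun _ => kNF_iff.2 ⟨U', k', he, hm⟩, fun h κ' h' => (ha h κ' h') ∘  he.kNF_iff.2⟩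

lemma FType.of_iff {ν : FType} :
    ν.Of T f ↔ ∃ T' f', FEquiv T f T' f' ∧ ν.IsExact T' f' := by
  constructor
  · intro h
    by_cases h0 : ν = .arbitrary
    · exact ⟨T, f, .refl T f, by subst h0; trivial, h.2⟩
    · obtain ⟨T', f', he, hm⟩ := fNF_iff.1 (h.1 h0)
      exact ⟨T', f', he, hm, fun h => absurd h h0⟩
  · rintro ⟨T', f', he, hm, ha⟩
    exact ⟨fun _ => fNF_iff.2 ⟨T', f', he, hm⟩, fun h ν' h' => ha h ν' h' ∘ he.fNF_iff.2⟩

end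

/-! ### The class with `g = 1` -/

section
variable {e e' : GaugedEq}

lemma GaugedTransf.ne_zeros (φ : GaugedTransf) : φ.δ₁ ≠ 0 ∧ φ.δ₄ ≠ 0 ∧ φ.δ₆ ≠ 0 ∧ φ.ε₁ ≠ 0 := by
  simpa [and_assoc] using φ.ne_zero

lemma GaugedTransf.Maps.kEquiv {φ : GaugedTransf} (h : φ.Maps e e') :
    KEquiv e.U e.k e'.U e'.k := by
  obtain ⟨h1, h4, h6, hε⟩ := φ.ne_zeros
  exact ⟨φ.δ₆, φ.δ₇, φ.δ₁ / φ.ε₁, φ.δ₂ / φ.ε₁, h6, div_ne_zero h1 hε, h.U_eq, fun u hu => by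
    rw [h.k_eq u hu]; ring⟩

lemma GaugedTransf.Maps.fEquiv {φ : GaugedTransf} (h : φ.Maps e e') :
    FEquiv e.T e.f e'.T e'.f := by
  obtain ⟨h1, h4, h6, hε⟩ := φ.ne_zeros
  exact ⟨φ.ε₁, φ.ε₀, φ.δ₄, hε, h4, h.T_eq, h.f_eq⟩

/-- The changes of `k` and of `f` can be prescribed independently: `ε₁` is fixed by the time change,
and its influence on `k` is absorbed by taking `δ₁ = α ε₁` and `δ₂ = β ε₁`. -/
lemma exists_gaugedTransf_maps (hk : KEquiv e.U e.k e'.U e'.k) (hf : FEquiv e.T e.f e'.T e'.f) :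
    ∃ φ : GaugedTransf, φ.Maps e e' := by
  obtain ⟨p, q, α, β, hp, hα, hU, hk⟩ := hk
  obtain ⟨P, Q, d, hP, hd, hT, hf⟩ := hf
  refine ⟨⟨Q, P, α * P, β * P, 0, d, 0, p, q, by simp [*]⟩, hT, hU, hf, fun u hu => ?_⟩
  rw [hk u hu]
  field_simp

lemma GaugedEq.isOfType_iff {c : KType × FType} :
    e.IsOfType c ↔ c.1.IsExact e.U e.k ∧ c.2.IsExact e.T e.f := by
  constructor
  · refine fun h => ⟨⟨h.k_matches, fun h0 κ hκ hn => ?_⟩, ⟨h.f_matches, fun h0 ν hν hn => ?_⟩⟩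
    · obtain ⟨U', k', he, hm⟩ := kNF_iff.1 hn
      obtain ⟨φ, hφ⟩ := exists_gaugedTransf_maps (e := e) (e' := ⟨e.T, U', e.f, k'⟩) he (.refl _ _)
      exact h.k_arbitrary h0 φ _ κ hκ hφ hm
    · obtain ⟨T', f', he, hm⟩ := fNF_iff.1 hn
      obtain ⟨φ, hφ⟩ := exists_gaugedTransf_maps (e := e) (e' := ⟨T', e.U, f', e.k⟩) (.refl _ _) he
      exact h.f_arbitrary h0 φ _ ν hν hφ hm
  · rintro ⟨⟨hk, hk'⟩, ⟨hf, hf'⟩⟩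
    exact ⟨hk, hf, fun h0 φ e' κ hκ hφ hm => hk' h0 κ hκ (kNF_iff.2 ⟨_, _, hφ.kEquiv, hm⟩),
      fun h0 φ e' ν hν hφ hm => hf' h0 ν hν (fNF_iff.2 ⟨_, _, hφ.fEquiv, hm⟩)⟩

lemma GaugedEq.exists_maps_isOfType_iff {c : KType × FType} :
    (∃ (φ : GaugedTransf) (e' : GaugedEq), φ.Maps e e' ∧ e'.IsOfType c) ↔
      c.1.Of e.U e.k ∧ c.2.Of e.T e.f := by
  simp only [KType.of_iff, FType.of_iff, isOfType_iff]
  constructor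
  · rintro ⟨φ, e', hφ, hk, hf⟩
    exact ⟨⟨_, _, hφ.kEquiv, hk⟩, ⟨_, _, hφ.fEquiv, hf⟩⟩
  · rintro ⟨⟨U', k', hk, hk'⟩, ⟨T', f', hf, hf'⟩⟩
    obtain ⟨φ, hφ⟩ := exists_gaugedTransf_maps (e := e) (e' := ⟨T', U', f', k'⟩) hk hf
    exact ⟨φ, _, hφ, hk', hf'⟩

theorem GaugedEq.InClass.existsUnique_type (he : e.InClass) :
    ∃! c : KType × FType, ∃ (φ : GaugedTransf) (e' : GaugedEq), φ.Maps e e' ∧ e'.IsOfType c := by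
  simp only [GaugedEq.exists_maps_isOfType_iff]
  exact existsUnique_prod (KType.existsUnique_of he.isOpenInterval_U.1 he.smooth_k he.nonlinear)
    (FType.existsUnique_of he.isOpenInterval_T)

/-- The corresponding transformation of the class with arbitrary `g`. -/
def GaugedTransf.toOrig (φ : GaugedTransf) : OrigTransf :=
  ⟨fun t => φ.ε₁ * t + φ.ε₀, id, φ.δ₁, φ.δ₂, φ.δ₃, φ.δ₄, φ.δ₅, φ.δ₆, φ.δ₇, φ.ε₁, 0, φ.ne_zero⟩

end

/-- The parameters of symmetries are determined by the form of the coefficients of the image. -/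
theorem OrigTransf.MapsCoeffs.isBasisOn_of_isExact {T X Y U : Set ℝ} {f g k f' k' : ℝ → ℝ}
    {φ : OrigTransf} {ε₀ : ℝ} (M : φ.MapsCoeffs ε₀ T U f g k f' k') (H : Coeffs T U f g φ.G k)
    (hX : IsOpenInterval X) (hY : IsOpenInterval Y) {c : KType × FType} {α β : ℝ} (hα : α ≠ 0)
    (hβ : c.1 = .log ∧ α = 1 ∨ β = 0) (hα' : c.1 = .log → α = 1)
    (hK : c.1.Matches ((fun u => φ.δ₆ * u + φ.δ₇) '' U) (fun u => α * k' u + β))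
    (hK' : c.1 = .arbitrary → ∀ κ, κ ≠ .arbitrary → ¬ KNF κ ((fun u => φ.δ₆ * u + φ.δ₇) '' U) k')
    (hF : c.2.IsExact (φ.θ '' T) f') :
    IsBasisOn (box T X Y U) (IsLieSymmetry (box T X Y U) (kolmogorov f g k))
      ((tableBasis c).map (VectorField.pullback ℝ φ.map)) := by
  obtain ⟨h1, h4, h6, hε⟩ := φ.ne_zeros
  have hU := H.isOpenInterval_U.image_affine h6 φ.δ₇
  have e : ∀ u ∈ U, k' (φ.δ₆ * u + φ.δ₇) = φ.δ₁ / φ.ε₁ * k u + φ.δ₂ / φ.ε₁ := fun u hu => by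
    rw [M.k_eq u hu]; ring
  have hs := contDiffOn_image H.smooth_k h6 e
  have hn := (nonlinear_image H.isOpenInterval_U.1 H.smooth_k H.nonlinear h6
    (div_ne_zero h1 hε) e).2
  refine M.isBasisOn H hX hY (fun p q A B => ?_) fun c₀ c₁ a => ?_
  · by_cases h0 : c.1 = .arbitrary
    · rw [h0]
      exact kSol_iff_span_arbitrary hU hs hn (hK' h0) p q A B
    · exact kSol_iff_span_of_matches hU hs hn h0 hα hβ hα' hK p q A B
  · refine tSol_iff_span (H.isOpenInterval_T.image (fun t ht => M.hasStrictDerivAt H ht)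
      fun t ht => mul_ne_zero hε (H.g_ne_zero t ht)) ?_ ?_ hF.1 hF.2 c₀ c₁ a
    · rintro _ ⟨t, ht, rfl⟩
      exact (M.hasDerivAt_f H ht).differentiableAt.differentiableWithinAt
    · rintro _ ⟨t, ht, rfl⟩
      rw [M.f_eq t ht]
      exact mul_ne_zero (div_ne_zero (pow_ne_zero 2 h4) hε)
        (div_ne_zero (H.f_ne_zero t ht) (H.g_ne_zero t ht))

lemma GaugedEq.InClass.coeffs {e : GaugedEq} (he : e.InClass) :
    Coeffs e.T e.U e.f (fun _ => 1) id e.k where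
  isOpenInterval_T := he.isOpenInterval_T
  isOpenInterval_U := he.isOpenInterval_U
  smooth_f := he.smooth_f
  f_ne_zero := he.f_ne_zero
  smooth_g := contDiffOn_const
  g_ne_zero _ _ := one_ne_zero
  hasDerivAt_G t _ := hasDerivAt_id t
  smooth_k := he.smooth_k
  nonlinear := he.nonlinear

theorem GaugedTransf.Maps.isBasisOn {e e' : GaugedEq} {φ : GaugedTransf} {c : KType × FType}
    (hφ : φ.Maps e e') (he : e.InClass) (hc : e'.IsOfType c) {X Y : Set ℝ} (hX : IsOpenInterval X)
    (hY : IsOpenInterval Y) :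
    IsBasisOn (box e.T X Y e.U) (e.IsSymmetry X Y)
      ((tableBasis c).map (VectorField.pullback ℝ φ.map)) := by
  obtain ⟨hk, hf⟩ := GaugedEq.isOfType_iff.1 hc
  rw [hφ.U_eq] at hk
  rw [hφ.T_eq] at hf
  have M : φ.toOrig.MapsCoeffs φ.ε₀ e.T e.U e.f (fun _ => 1) e.k e'.f e'.k :=
    ⟨fun t _ => rfl, fun t ht => by simpa [toOrig] using hφ.f_eq t ht, hφ.k_eq⟩
  exact M.isBasisOn_of_isExact he.coeffs hX hY one_ne_zero (Or.inr rfl) (fun _ => rfl)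
    (by simpa [toOrig] using hk.1) hk.2 hf

/-- The case of the identity transformation, under which pulling back changes nothing. -/
theorem GaugedEq.IsOfType.isBasisOn {e : GaugedEq} {c : KType × FType} (he : e.InClass)
    (hc : e.IsOfType c) {X Y : Set ℝ} (hX : IsOpenInterval X) (hY : IsOpenInterval Y) :
    IsBasisOn (box e.T X Y e.U) (e.IsSymmetry X Y) (tableBasis c) := by
  have hφ : GaugedTransf.Maps ⟨0, 1, 1, 0, 0, 1, 0, 1, 0, by simp⟩ e e :=
    ⟨by simp, by simp, by simp, by simp⟩
  have := hφ.isBasisOn he hc hX hY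
  have hm : GaugedTransf.map ⟨0, 1, 1, 0, 0, 1, 0, 1, 0, by simp⟩ = id := by
    ext z i
    fin_cases i <;> simp [GaugedTransf.map]
  rw [hm] at this
  have hp : VectorField.pullback ℝ (id : Pt → Pt) = id := by
    ext V z : 2
    simp [VectorField.pullback]
  rwa [hp, List.map_id] at this

/-! ### The kernel -/

lemma cubic_eq_zero {I : Set ℝ} (hI : IsOpenInterval I) {a b c d : ℝ}
    (h : ∀ u ∈ I, a + b * u + c * u ^ 2 + d * u ^ 3 = 0) : a = 0 ∧ b = 0 ∧ c = 0 ∧ d = 0 := by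
  open Polynomial in
  obtain ⟨u₀, hu₀⟩ := hI.2.2
  have h0 : (C a + C b * X + C c * X ^ 2 + C d * X ^ 3 : ℝ[X]) = 0 :=
    eq_zero_of_infinite_isRoot _ ((infinite_of_mem_nhds u₀ (hI.1.mem_nhds hu₀)).mono fun u hu => by
      simpa [IsRoot] using h u hu)
  have hc : ∀ n, (C a + C b * X + C c * X ^ 2 + C d * X ^ 3 : ℝ[X]).coeff n = 0 := fun n => by
    rw [h0, coeff_zero]
  have h1 := hc 0
  have h2 := hc 1
  have h3 := hc 2
  have h4 := hc 3
  simp [coeff_X, coeff_C, coeff_X_pow] at h1 h2 h3 h4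
  exact ⟨h1, h2, h3, h4⟩

lemma deriv_quadratic_add_cubic : deriv (fun u : ℝ => u ^ 2 + u ^ 3) = fun u => 2 * u + 3 * u ^ 2 := by
  ext u
  simp

/-- A sample equation for the kernel. Its coefficients are admissible on all intervals, and for
polynomials both conditions on the parameters can be read off coefficientwise on any interval. -/
lemma inClass_polynomial {T U : Set ℝ} (hT : IsOpenInterval T) (hU : IsOpenInterval U) :
    GaugedEq.InClass ⟨T, U, fun t => 1 + t ^ 2, fun u => u ^ 2 + u ^ 3⟩ where
  isOpenInterval_T := hT
  isOpenInterval_U := hU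
  smooth_f := by fun_prop
  f_ne_zero t _ := by positivity
  smooth_k := by fun_prop
  nonlinear := by
    by_contra! h
    have h2 : ∀ u : ℝ, deriv (fun u : ℝ => 2 * u + 3 * u ^ 2) u = 2 + 6 * u := fun u => by
      have := (((hasDerivAt_id u).const_mul 2).add ((hasDerivAt_pow 2 u).const_mul 3)).deriv
      refine this.trans ?_
      simp
      ring
    simp only [deriv_quadratic_add_cubic, h2] at h
    have := (cubic_eq_zero hU (a := 2) (b := 6) (c := 0) (d := 0) fun u hu => by
      linear_combination h u hu).1
    norm_num at this

theorem isBasisOn_kernel {T X Y U : Set ℝ} (hT : IsOpenInterval T) (hX : IsOpenInterval X)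
    (hY : IsOpenInterval Y) (hU : IsOpenInterval U) :
    IsBasisOn (box T X Y U)
      (fun Q => ∀ f k : ℝ → ℝ, GaugedEq.InClass ⟨T, U, f, k⟩ →
        GaugedEq.IsSymmetry ⟨T, U, f, k⟩ X Y Q) [dx, dy] := by
  have he := inClass_polynomial hT hU
  have hb := isBasisOn_dx_dy (Ω := box T X Y U) fun ξ₀ η₀ φ ψ A B c₀ c₁ a h =>
    symField_eq_zero he.coeffs hX hY h
  refine ⟨hb.1, fun Q => Iff.trans ⟨fun h => ?_, ?_⟩ (hb.2 Q)⟩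
  · obtain ⟨ξ₀, η₀, φ, ψ, A, B, c₀, c₁, a, ⟨hk, hf⟩, hQ⟩ :=
      (isLieSymmetry_iff he.coeffs hX hY Q).1 (h _ _ he)
    -- The condition on `k = u ^ 2 + u ^ 3`, and next the one on `f = 1 + t ^ 2`, written as
    -- polynomial identities; together they leave only `ξ₀` and `η₀`.
    have ek := cubic_eq_zero hU (a := -A) (b := 2 * ψ) (c := 2 * φ + 3 * ψ - B) (d := 3 * φ - B)
      fun u hu => by
        have := hk u hu
        simp only [deriv_quadratic_add_cubic] at this
        linear_combination this
    have ef := cubic_eq_zero hT (a := c₁ - 2 * a) (b := 2 * c₀) (c := 3 * c₁ - 2 * a) (d := 0)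
      fun t ht => by
        have := hf t ht
        simp at this
        linear_combination this
    obtain ⟨k1, k2, k3, k4⟩ := ek
    obtain ⟨f1, f2, f3, -⟩ := ef
    obtain rfl : ψ = 0 := by linarith
    obtain rfl : φ = 0 := by linarith
    obtain rfl : A = 0 := by linarith
    obtain rfl : B = 0 := by linarith
    obtain rfl : c₀ = 0 := by linarith
    obtain rfl : c₁ = 0 := by linarith
    obtain rfl : a = 0 := by linarith
    exact ⟨ξ₀, η₀, hQ⟩
  · rintro ⟨ξ₀, η₀, hQ⟩ f k h
    exact (isLieSymmetry_iff h.coeffs hX hY Q).2 ⟨ξ₀, η₀, 0, 0, 0, 0, 0, 0, 0,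
      ⟨fun u _ => by ring, fun t _ => by ring⟩, hQ⟩

/-! ### The class with arbitrary `g` -/

/-- The fluxes `K` on `U` and `K'` on `U'` are related by a transformation of the class. -/
def FluxEquiv (U : Set ℝ) (K : ℝ → ℝ) (U' : Set ℝ) (K' : ℝ → ℝ) : Prop :=
  ∃ p q α β γ : ℝ, p ≠ 0 ∧ α ≠ 0 ∧ U' = (fun u => p * u + q) '' U ∧
    ∀ u ∈ U, K' (p * u + q) = p * (α * K u + β * u + γ)

section
variable {U U' : Set ℝ} {K K' : ℝ → ℝ}

lemma FluxEquiv.refl (U : Set ℝ) (K : ℝ → ℝ) : FluxEquiv U K U K :=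
  ⟨1, 0, 1, 0, 0, one_ne_zero, one_ne_zero, by simp, by simp⟩

lemma deriv_eq_of_flux (hU : IsOpen U) (hK : DifferentiableOn ℝ K U) {p q α β γ : ℝ} (hp : p ≠ 0)
    (h : ∀ u ∈ U, K' (p * u + q) = p * (α * K u + β * u + γ)) :
    ∀ u ∈ U, deriv K' (p * u + q) = α * deriv K u + β := fun u hu => by
  have h1 : HasDerivAt (fun u => p * (α * K u + β * u + γ)) (p * (α * deriv K u + β * 1)) u :=
    (((((hK.differentiableAt (hU.mem_nhds hu)).hasDerivAt.const_mul α)).add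
      ((hasDerivAt_id' u).const_mul β)).add_const γ).const_mul p
  rw [(hasDerivAt_of_comp hU hu (hasStrictDerivAt_affine p q u) hp h1 h).deriv]
  field_simp

lemma FluxEquiv.kEquiv (hU : IsOpen U) (hK : DifferentiableOn ℝ K U) (h : FluxEquiv U K U' K') :
    KEquiv U (deriv K) U' (deriv K') := by
  obtain ⟨p, q, α, β, γ, hp, hα, hU', h⟩ := h
  exact ⟨p, q, α, β, hp, hα, hU', deriv_eq_of_flux hU hK hp h⟩

/-- The relation between the derivatives is integrated over the interval, the constant of
integration being absorbed by the additive freedom in the flux. The constants `a` and `b` allow for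
listed fluxes whose derivative agrees with the listed `k` only up to a factor and a shift. -/
lemma KEquiv.fluxEquiv (hU : IsOpenInterval U) (hK : DifferentiableOn ℝ K U) {k' : ℝ → ℝ}
    (h : KEquiv U (deriv K) U' k') {a b : ℝ} (ha : a ≠ 0)
    (hK' : ∀ u ∈ U', HasDerivAt K' (a * k' u + b) u) : FluxEquiv U K U' K' := by
  obtain ⟨p, q, α, β, hp, hα, rfl, h⟩ := h
  obtain ⟨γ, hγ⟩ := exists_eq_const_of_deriv hU
    (k := fun u => K' (p * u + q) - p * (a * α * K u + (a * β + b) * u)) fun u hu => by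
      have h1 := HasDerivAt.comp u (hK' _ ⟨u, hu, rfl⟩) (hasDerivAt_affine p q u)
      have h2 := ((((hK.differentiableAt (hU.1.mem_nhds hu)).hasDerivAt.const_mul (a * α))).add
        ((hasDerivAt_id' u).const_mul (a * β + b))).const_mul p
      refine (h1.sub h2).congr_deriv ?_
      rw [h u hu]
      ring
  refine ⟨p, q, a * α, a * β + b, γ / p, hp, mul_ne_zero ha hα, rfl, fun u hu => ?_⟩
  have := hγ u hu
  field_simp
  linear_combination this

/-- The derivative of a listed flux is a listed form of `k`, up to scaling and adding a constant. -/
lemma KType.MatchesFlux.exists_matches_deriv {κ : KType} (hU : IsOpen U)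
    (h : κ.MatchesFlux U K) : ∃ α β : ℝ, α ≠ 0 ∧ (κ = .log ∧ α = 1 ∨ β = 0) ∧
      (κ = .log → α = 1) ∧ κ.Matches U (fun u => α * deriv K u + β) := by
  cases κ with
  | arbitrary => exact ⟨1, 0, one_ne_zero, Or.inr rfl, by simp, trivial⟩
  | power n =>
    obtain ⟨h0, h1, hn, h⟩ := h
    by_cases hn1 : n = -1
    · have hpos : U ⊆ Set.Ioi 0 := hn.resolve_right fun ⟨m, hm⟩ => by
        have : (0 : ℝ) ≤ m := m.cast_nonneg
        linarith
      refine ⟨1, 0, one_ne_zero, Or.inr rfl, by simp, h0, h1, hn, fun u hu => ?_⟩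
      have hu0 : u ≠ 0 := (hpos hu).ne'
      beta_reduce
      rw [deriv_eqOn_of_eqOn hU (fun v hv => (h v hv).2 hn1) hu (Real.hasDerivAt_log hu0), hn1,
        Real.rpow_neg_one]
      ring
    · have hn1' : n + 1 ≠ 0 := fun h => hn1 (by linarith)
      refine ⟨(n + 1)⁻¹, 0, inv_ne_zero hn1', Or.inr rfl, by simp, h0, h1, hn, fun u hu => ?_⟩
      have hd : u ≠ 0 ∨ 1 ≤ n + 1 := by
        rcases hn with hn | ⟨m, rfl⟩
        · exact Or.inl (hn hu).ne'
        · exact Or.inr (by simp)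
      beta_reduce
      rw [deriv_eqOn_of_eqOn hU (fun v hv => (h v hv).1 hn1) hu (Real.hasDerivAt_rpow_const hd)]
      field_simp
      simp
  | exp =>
    exact ⟨1, 0, one_ne_zero, Or.inr rfl, by simp, fun u hu => by
      beta_reduce
      rw [deriv_eqOn_of_eqOn hU h hu (Real.hasDerivAt_exp u)]; ring⟩
  | log =>
    refine ⟨1, -1, one_ne_zero, Or.inl ⟨rfl, rfl⟩, fun _ => rfl, h.1, fun u hu => ?_⟩
    beta_reduce
    rw [deriv_eqOn_of_eqOn hU h.2 hu (Real.hasDerivAt_mul_log (h.1 hu).ne')]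
    ring

/-- For each listed form of `k` there is a listed flux. -/
lemma KType.Matches.exists_flux {κ : KType} (hκ : κ ≠ .arbitrary) {k : ℝ → ℝ}
    (h : κ.Matches U k) :
    ∃ (K : ℝ → ℝ) (a b : ℝ), a ≠ 0 ∧ κ.MatchesFlux U K ∧ ∀ u ∈ U, HasDerivAt K (a * k u + b) u := by
  cases κ with
  | arbitrary => exact absurd rfl hκ
  | power n =>
    obtain ⟨h0, h1, hn, h⟩ := h
    by_cases hn1 : n = -1
    · have hpos : U ⊆ Set.Ioi 0 := hn.resolve_right fun ⟨m, hm⟩ => by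
        have : (0 : ℝ) ≤ m := m.cast_nonneg
        linarith
      refine ⟨Real.log, 1, 0, one_ne_zero, ⟨h0, h1, hn, fun u _ => ⟨fun h => absurd hn1 h,
        fun _ => rfl⟩⟩, fun u hu => (Real.hasDerivAt_log (hpos hu).ne').congr_deriv ?_⟩
      rw [h u hu, hn1, Real.rpow_neg_one]
      ring
    · have hn1' : n + 1 ≠ 0 := fun h => hn1 (by linarith)
      refine ⟨fun u => u ^ (n + 1), n + 1, 0, hn1', ⟨h0, h1, hn, fun u _ => ⟨fun _ => rfl,
        fun h => absurd h hn1⟩⟩, fun u hu => ?_⟩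
      have hd : u ≠ 0 ∨ 1 ≤ n + 1 := by
        rcases hn with hn | ⟨m, rfl⟩
        · exact Or.inl (hn hu).ne'
        · exact Or.inr (by simp)
      refine (Real.hasDerivAt_rpow_const hd).congr_deriv ?_
      rw [h u hu]
      simp
  | exp =>
    exact ⟨Real.exp, 1, 0, one_ne_zero, fun u _ => rfl, fun u hu =>
      (Real.hasDerivAt_exp u).congr_deriv (by rw [h u hu]; ring)⟩
  | log =>
    exact ⟨fun u => u * Real.log u, 1, 1, one_ne_zero, ⟨h.1, fun u _ => rfl⟩, fun u hu =>
      (Real.hasDerivAt_mul_log (h.1 hu).ne').congr_deriv (by rw [h.2 u hu]; ring)⟩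

lemma FluxEquiv.isOpenInterval (h : FluxEquiv U K U' K') (hU : IsOpenInterval U) :
    IsOpenInterval U' := by
  obtain ⟨p, q, α, β, γ, hp, hα, rfl, h⟩ := h
  exact hU.image_affine hp q

/-- Reduces the classification of fluxes to that of their derivatives. -/
lemma kNF_deriv_iff (hU : IsOpenInterval U) (hK : DifferentiableOn ℝ K U) {κ : KType}
    (hκ : κ ≠ .arbitrary) :
    KNF κ U (deriv K) ↔ ∃ U' K', FluxEquiv U K U' K' ∧ κ.MatchesFlux U' K' := by
  rw [kNF_iff]
  constructor
  · rintro ⟨U', k', he, hm⟩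
    obtain ⟨K', a, b, ha, hm', hd⟩ := hm.exists_flux hκ
    exact ⟨U', K', he.fluxEquiv hU hK ha hd, hm'⟩
  · rintro ⟨U', K', he, hm⟩
    obtain ⟨α, β, hα, -, -, hm'⟩ := hm.exists_matches_deriv (he.isOpenInterval hU).1
    refine ⟨U', _, (he.kEquiv hU.1 hK).trans ?_, hm'⟩
    exact ⟨1, 0, α, β, one_ne_zero, hα, by simp, by simp⟩

/-- The flux `K` is one of the list. -/
def KType.IsExactFlux (U : Set ℝ) (K : ℝ → ℝ) (κ : KType) : Prop :=
  κ.MatchesFlux U K ∧ (κ = .arbitrary → ∀ κ', κ' ≠ .arbitrary → ¬ KNF κ' U (deriv K))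

lemma KType.of_deriv_iff (hU : IsOpenInterval U) (hK : DifferentiableOn ℝ K U) {κ : KType} :
    κ.Of U (deriv K) ↔ ∃ U' K', FluxEquiv U K U' K' ∧ κ.IsExactFlux U' K' := by
  constructor
  · intro h
    by_cases h0 : κ = .arbitrary
    · exact ⟨U, K, .refl U K, by subst h0; trivial, h.2⟩
    · obtain ⟨U', K', he, hm⟩ := (kNF_deriv_iff hU hK h0).1 (h.1 h0)
      exact ⟨U', K', he, hm, fun h => absurd h h0⟩
  · rintro ⟨U', K', he, hm, ha⟩
    exact ⟨fun h0 => (kNF_deriv_iff hU hK h0).2 ⟨U', K', he, hm⟩,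
      fun h κ' h' => ha h κ' h' ∘ (he.kEquiv hU.1 hK).kNF_iff.2⟩

end

/-! ### The change of the time variable -/

/-- With the new time `G`, an antiderivative of `g`, the coefficients `f` and `g` become `f'` and
`1`. -/
structure TimeChange (T : Set ℝ) (f g G f' : ℝ → ℝ) : Prop where
  isOpenInterval_T : IsOpenInterval T
  contDiffOn_G : ContDiffOn ℝ ∞ G T
  hasDerivAt_G : ∀ t ∈ T, HasDerivAt G (g t) t
  g_ne_zero : ∀ t ∈ T, g t ≠ 0
  f_eq : ∀ t ∈ T, f' (G t) = f t / g t

lemma exists_antideriv {T : Set ℝ} (hT : IsOpenInterval T) {g : ℝ → ℝ} (hg : ContinuousOn g T) :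
    ∃ G : ℝ → ℝ, ∀ t ∈ T, HasDerivAt G (g t) t := by
  obtain ⟨t₀, ht₀⟩ := hT.2.2
  refine ⟨fun t => ∫ s in t₀..t, g s, fun t ht => ?_⟩
  refine intervalIntegral.integral_hasDerivAt_right
    (hg.mono (hT.2.1.uIcc_subset ht₀ ht)).intervalIntegrable ?_ (hg.continuousAt (hT.1.mem_nhds ht))
  exact hg.stronglyMeasurableAtFilter hT.1 t ht

lemma injOn_of_hasDerivAt {T : Set ℝ} (hT : IsOpenInterval T) {g G : ℝ → ℝ}
    (hG : ∀ t ∈ T, HasDerivAt G (g t) t) (hg : ∀ t ∈ T, g t ≠ 0) : Set.InjOn G T := by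
  have key : ∀ s ∈ T, ∀ t ∈ T, s < t → G s ≠ G t := fun s hs t ht hst h => by
    have hsub : Set.Icc s t ⊆ T := hT.2.1.out hs ht
    obtain ⟨c, hc, hc'⟩ := exists_hasDerivAt_eq_zero hst
      (fun u hu => (hG u (hsub hu)).continuousAt.continuousWithinAt) h
      fun u hu => hG u (hsub (Set.Ioo_subset_Icc_self hu))
    exact hg c (hsub (Set.Ioo_subset_Icc_self hc)) hc'
  intro s hs t ht h
  by_contra hne
  rcases lt_or_gt_of_ne hne with h' | h'
  · exact key s hs t ht h' h
  · exact key t ht s hs h' h.symm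

lemma OrigEq.InClass.exists_timeChange {e : OrigEq} (he : e.InClass) :
    ∃ G f', TimeChange e.T e.f e.g G f' := by
  obtain ⟨G, hG⟩ := exists_antideriv he.isOpenInterval_T he.smooth_g.continuousOn
  -- The new coefficient is `f / g` as a function of the new time; the inverse exists since `g` has
  -- no zeros and `G` is therefore injective.
  refine ⟨G, fun s => e.f (Function.invFunOn G e.T s) / e.g (Function.invFunOn G e.T s),
    he.isOpenInterval_T, ?_, hG, he.g_ne_zero, fun t ht => ?_⟩
  · rw [contDiffOn_infty_iff_deriv_of_isOpen he.isOpenInterval_T.1]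
    exact ⟨fun t ht => (hG t ht).differentiableAt.differentiableWithinAt,
      he.smooth_g.congr fun t ht => (hG t ht).deriv⟩
  · rw [(injOn_of_hasDerivAt he.isOpenInterval_T hG he.g_ne_zero).leftInvOn_invFunOn ht]

lemma TimeChange.isOpenInterval_image {T : Set ℝ} {f g G f' : ℝ → ℝ} (h : TimeChange T f g G f') :
    IsOpenInterval (G '' T) := by
  refine h.isOpenInterval_T.image (fun t ht => ?_) h.g_ne_zero
  have := (h.contDiffOn_G.contDiffAt (h.isOpenInterval_T.1.mem_nhds ht)).hasStrictDerivAt (by simp)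
  rwa [(h.hasDerivAt_G t ht).deriv] at this

/-! ### Transformations of the class with arbitrary `g` -/

section
variable {e e' : OrigEq} {φ : OrigTransf} {c : KType × FType}

lemma OrigEq.IsGauged.timeChange (h : e.IsGauged) (hT : IsOpenInterval e.T) :
    TimeChange e.T e.f e.g id e.f :=
  ⟨hT, contDiffOn_id, fun t ht => by rw [h t ht]; exact hasDerivAt_id t,
    fun t ht => by rw [h t ht]; exact one_ne_zero, fun t ht => by rw [h t ht]; simp⟩

/-- The gauge `g = 1` of the target leaves of the arbitrary function `θ` only affine functions of an
antiderivative of `g`. -/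
lemma OrigTransf.Maps.deriv_θ (h : φ.Maps e e') (hg : e'.IsGauged) {t : ℝ} (ht : t ∈ e.T) :
    deriv φ.θ t = φ.ε₁ * e.g t := by
  have h1 := h.g_eq t ht
  rw [hg _ (h.T_eq ▸ ⟨t, ht, rfl⟩)] at h1
  have h2 := h.deriv_θ_ne_zero t ht
  field_simp at h1
  exact h1

lemma OrigTransf.Maps.exists_θ_eq (h : φ.Maps e e') (hg : e'.IsGauged) (hT : IsOpenInterval e.T)
    {G : ℝ → ℝ} (hG : ∀ t ∈ e.T, HasDerivAt G (e.g t) t) :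
    ∃ ε₀, ∀ t ∈ e.T, φ.θ t = φ.ε₁ * G t + ε₀ := by
  obtain ⟨ε₀, h0⟩ := exists_eq_const_of_deriv hT (k := fun t => φ.θ t - φ.ε₁ * G t) fun t ht => by
    have h1 := hasDerivAt_of_smooth hT.1 h.smooth_θ ht
    rw [h.deriv_θ hg ht] at h1
    exact (h1.sub ((hG t ht).const_mul φ.ε₁)).congr_deriv (sub_self _)
  exact ⟨ε₀, fun t ht => by rw [← h0 t ht]; ring⟩

lemma OrigTransf.Maps.fluxEquiv (h : φ.Maps e e') : FluxEquiv e.U e.K e'.U e'.K := by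
  obtain ⟨h1, h4, h6, hε⟩ := φ.ne_zeros
  refine ⟨φ.δ₆, φ.δ₇, φ.δ₁ / φ.ε₁, φ.δ₂ / φ.ε₁, φ.ε₂ / φ.ε₁, h6, div_ne_zero h1 hε, h.U_eq,
    fun u hu => ?_⟩
  rw [h.K_eq u hu]
  ring

lemma OrigTransf.Maps.fEquiv (h : φ.Maps e e') (hg : e'.IsGauged) {G f' : ℝ → ℝ}
    (H : TimeChange e.T e.f e.g G f') : FEquiv (G '' e.T) f' e'.T e'.f := by
  obtain ⟨h1, h4, h6, hε⟩ := φ.ne_zeros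
  obtain ⟨ε₀, h0⟩ := h.exists_θ_eq hg H.isOpenInterval_T H.hasDerivAt_G
  refine ⟨φ.ε₁, ε₀, φ.δ₄, hε, h4, ?_, ?_⟩
  · rw [h.T_eq, Set.image_image]
    exact Set.image_congr h0
  · rintro _ ⟨t, ht, rfl⟩
    rw [← h0 t ht, h.f_eq t ht, h.deriv_θ hg ht, H.f_eq t ht]
    have := H.g_ne_zero t ht
    field_simp

/-- As for `g = 1`, the factor `P` of the new time serves as `ε₁`, and `δ₁`, `δ₂`, `ε₂` are
multiplied by it to compensate for the division by `ε₁` in the new flux. -/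
lemma exists_origTransf_maps {G f' : ℝ → ℝ} (H : TimeChange e.T e.f e.g G f') {T' U' : Set ℝ}
    {f'' K' : ℝ → ℝ} (hK : FluxEquiv e.U e.K U' K') (hf : FEquiv (G '' e.T) f' T' f'') :
    ∃ φ : OrigTransf, φ.Maps e ⟨T', U', f'', fun _ => 1, K'⟩ := by
  obtain ⟨p, q, α, β, γ, hp, hα, hU, hK⟩ := hK
  obtain ⟨P, Q, d, hP, hd, hT, hf⟩ := hf
  have hθ : ∀ t ∈ e.T, deriv (fun t => P * G t + Q) t = P * e.g t := fun t ht =>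
    (((H.hasDerivAt_G t ht).const_mul P).add_const Q).deriv
  refine ⟨⟨fun t => P * G t + Q, G, α * P, β * P, 0, d, 0, p, q, P, γ * P, by simp [*]⟩,
    (contDiffOn_const.mul H.contDiffOn_G).add contDiffOn_const, fun t ht => ?_, H.hasDerivAt_G,
    hT.trans (Set.image_image ..), hU, fun t ht => ?_, fun t ht => ?_, fun u hu => ?_⟩
  · simpa only [hθ t ht] using mul_ne_zero hP (H.g_ne_zero t ht)
  · have := H.g_ne_zero t ht
    simp only [hθ t ht, hf _ ⟨t, ht, rfl⟩, H.f_eq t ht]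
    field_simp
  · have := H.g_ne_zero t ht
    simp only [hθ t ht]
    field_simp
  · simp only [hK u hu]
    field_simp

lemma OrigEq.isOfType_iff (hT : IsOpenInterval e.T) (hU : IsOpenInterval e.U)
    (hK : DifferentiableOn ℝ e.K e.U) :
    e.IsOfType c ↔ e.IsGauged ∧ c.1.IsExactFlux e.U e.K ∧ c.2.IsExact e.T e.f := by
  constructor
  · refine fun h => ⟨h.gauged, ⟨h.K_matches, fun h0 κ hκ hn => ?_⟩,
      ⟨h.f_matches, fun h0 ν hν hn => ?_⟩⟩
    · obtain ⟨U', K', he, hm⟩ := (kNF_deriv_iff hU hK hκ).1 hn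
      obtain ⟨φ, hφ⟩ := exists_origTransf_maps (h.gauged.timeChange hT) he (.refl _ _)
      exact h.K_arbitrary h0 φ _ κ hκ hφ (fun _ _ => rfl) hm
    · obtain ⟨T', f', he, hm⟩ := fNF_iff.1 hn
      rw [← Set.image_id e.T] at he
      obtain ⟨φ, hφ⟩ := exists_origTransf_maps (h.gauged.timeChange hT) (.refl _ _) he
      exact h.f_arbitrary h0 φ _ ν hν hφ (fun _ _ => rfl) hm
  · rintro ⟨hg, ⟨hk, hk'⟩, ⟨hf, hf'⟩⟩
    refine ⟨hg, hk, hf, fun h0 φ e' κ hκ hφ hg' hm => hk' h0 κ hκ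
      ((kNF_deriv_iff hU hK hκ).2 ⟨_, _, hφ.fluxEquiv, hm⟩), fun h0 φ e' ν hν hφ hg' hm => ?_⟩
    have := hφ.fEquiv hg' (hg.timeChange hT)
    rw [Set.image_id] at this
    exact hf' h0 ν hν (fNF_iff.2 ⟨_, _, this, hm⟩)

lemma FluxEquiv.differentiableOn {U U' : Set ℝ} {K K' : ℝ → ℝ} (h : FluxEquiv U K U' K')
    (hU : IsOpen U) (hK : DifferentiableOn ℝ K U) : DifferentiableOn ℝ K' U' := by
  obtain ⟨p, q, α, β, γ, hp, hα, rfl, h⟩ := h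
  rintro _ ⟨u, hu, rfl⟩
  have h1 : HasDerivAt (fun u => p * (α * K u + β * u + γ)) (p * (α * deriv K u + β * 1)) u :=
    (((((hK.differentiableAt (hU.mem_nhds hu)).hasDerivAt.const_mul α)).add
      ((hasDerivAt_id' u).const_mul β)).add_const γ).const_mul p
  exact (hasDerivAt_of_comp hU hu (hasStrictDerivAt_affine p q u) hp h1
    h).differentiableAt.differentiableWithinAt

lemma OrigEq.InClass.differentiableOn_K (he : e.InClass) : DifferentiableOn ℝ e.K e.U :=
  he.smooth_K.differentiableOn (by simp)

lemma FEquiv.isOpenInterval {T T' : Set ℝ} {f f' : ℝ → ℝ} (h : FEquiv T f T' f')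
    (hT : IsOpenInterval T) : IsOpenInterval T' := by
  obtain ⟨p, q, d, hp, hd, rfl, h⟩ := h
  exact hT.image_affine hp q

lemma OrigTransf.Maps.isOfType_iff (hφ : φ.Maps e e') (he : e.InClass) (hg : e'.IsGauged) :
    e'.IsOfType c ↔ c.1.IsExactFlux e'.U e'.K ∧ c.2.IsExact e'.T e'.f := by
  obtain ⟨G, f', H⟩ := he.exists_timeChange
  rw [OrigEq.isOfType_iff ((hφ.fEquiv hg H).isOpenInterval H.isOpenInterval_image)
    (hφ.fluxEquiv.isOpenInterval he.isOpenInterval_U)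
    (hφ.fluxEquiv.differentiableOn he.isOpenInterval_U.1 he.differentiableOn_K),
    and_iff_right hg]

lemma OrigEq.InClass.exists_maps_isOfType_iff (he : e.InClass) {G f' : ℝ → ℝ}
    (H : TimeChange e.T e.f e.g G f') :
    (∃ (φ : OrigTransf) (e' : OrigEq), φ.Maps e e' ∧ e'.IsOfType c) ↔
      c.1.Of e.U (deriv e.K) ∧ c.2.Of (G '' e.T) f' := by
  rw [KType.of_deriv_iff he.isOpenInterval_U he.differentiableOn_K, FType.of_iff]
  constructor
  · rintro ⟨φ, e', hφ, hc⟩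
    have hg := hc.gauged
    rw [hφ.isOfType_iff he hg] at hc
    exact ⟨⟨_, _, hφ.fluxEquiv, hc.1⟩, ⟨_, _, hφ.fEquiv hg H, hc.2⟩⟩
  · rintro ⟨⟨U', K', hk, hk'⟩, ⟨T', f'', hf, hf'⟩⟩
    obtain ⟨φ, hφ⟩ := exists_origTransf_maps H hk hf
    exact ⟨φ, _, hφ, (hφ.isOfType_iff he fun _ _ => rfl).2 ⟨hk', hf'⟩⟩

lemma OrigEq.InClass.smooth_deriv_K (he : e.InClass) : ContDiffOn ℝ ∞ (deriv e.K) e.U :=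
  contDiffOn_deriv he.isOpenInterval_U.1 he.smooth_K

theorem OrigEq.InClass.existsUnique_type (he : e.InClass) :
    ∃! c : KType × FType, ∃ (φ : OrigTransf) (e' : OrigEq), φ.Maps e e' ∧ e'.IsOfType c := by
  obtain ⟨G, f', H⟩ := he.exists_timeChange
  simp only [he.exists_maps_isOfType_iff H]
  exact existsUnique_prod
    (KType.existsUnique_of he.isOpenInterval_U.1 he.smooth_deriv_K he.nonlinear)
    (FType.existsUnique_of H.isOpenInterval_image)

theorem OrigTransf.Maps.isBasisOn (hφ : φ.Maps e e') (he : e.InClass) (hc : e'.IsOfType c)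
    {X Y : Set ℝ} (hX : IsOpenInterval X) (hY : IsOpenInterval Y) :
    IsBasisOn (box e.T X Y e.U) (e.IsSymmetry X Y)
      ((tableBasis c).map (VectorField.pullback ℝ φ.map)) := by
  obtain ⟨h1, h4, h6, hε⟩ := φ.ne_zeros
  have hg := hc.gauged
  obtain ⟨⟨hm, hk⟩, hf⟩ := (hφ.isOfType_iff he hg).1 hc
  have hU := hφ.fluxEquiv.isOpenInterval he.isOpenInterval_U
  -- The derivative of a listed flux need not be the listed `k`: for instance `u ^ (n + 1)` gives
  -- the factor `n + 1`, and `u ln u` gives the shift `1`. Neither affects the listed basis.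
  obtain ⟨α, β, hα, hβ, hα', hm'⟩ := hm.exists_matches_deriv hU.1
  obtain ⟨ε₀, h0⟩ := hφ.exists_θ_eq hg he.isOpenInterval_T hφ.hasDerivAt_G
  rw [hφ.U_eq] at hm' hk
  rw [hφ.T_eq] at hf
  have hd := deriv_eq_of_flux he.isOpenInterval_U.1 he.differentiableOn_K (K' := e'.K) (p := φ.δ₆)
    (q := φ.δ₇) (α := φ.δ₁ / φ.ε₁) (β := φ.δ₂ / φ.ε₁) (γ := φ.ε₂ / φ.ε₁) h6 fun u hu => by
      rw [hφ.K_eq u hu]; ring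
  have M : φ.MapsCoeffs ε₀ e.T e.U e.f e.g (deriv e.K) e'.f (deriv e'.K) := by
    refine ⟨h0, fun t ht => ?_, fun u hu => ?_⟩
    · have := he.g_ne_zero t ht
      rw [hφ.f_eq t ht, hφ.deriv_θ hg ht]
      field_simp
    · rw [hd u hu]
      ring
  exact M.isBasisOn_of_isExact
    ⟨he.isOpenInterval_T, he.isOpenInterval_U, he.smooth_f, he.f_ne_zero, he.smooth_g,
      he.g_ne_zero, hφ.hasDerivAt_G, he.smooth_deriv_K, he.nonlinear⟩ hX hY hα hβ hα' hm' hk hf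

end

end Kolmogorov

/-! ### The classification theorem -/

theorem mainTheorem1 :
    -- bases of the maximal Lie invariance algebras in the cases of the list
    (∀ (e : Kolmogorov.GaugedEq) (c : Kolmogorov.KType × Kolmogorov.FType),
      e.InClass → e.IsOfType c →
      ∀ X Y : Set ℝ, Kolmogorov.IsOpenInterval X → Kolmogorov.IsOpenInterval Y →
        Kolmogorov.IsBasisOn (Kolmogorov.box e.T X Y e.U) (e.IsSymmetry X Y)
          (Kolmogorov.tableBasis c)) ∧
    -- every equation is equivalent to one in the list, and the cases are pairwise inequivalent
    (∀ e : Kolmogorov.GaugedEq, e.InClass →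
      ∃! c : Kolmogorov.KType × Kolmogorov.FType,
        ∃ (φ : Kolmogorov.GaugedTransf) (e' : Kolmogorov.GaugedEq),
          φ.Maps e e' ∧ e'.IsOfType c) ∧
    -- the algebra of any equation is obtained from the list by the equivalence transformation
    (∀ (e e' : Kolmogorov.GaugedEq) (φ : Kolmogorov.GaugedTransf)
      (c : Kolmogorov.KType × Kolmogorov.FType),
      e.InClass → φ.Maps e e' → e'.IsOfType c →
      ∀ X Y : Set ℝ, Kolmogorov.IsOpenInterval X → Kolmogorov.IsOpenInterval Y →
        Kolmogorov.IsBasisOn (Kolmogorov.box e.T X Y e.U) (e.IsSymmetry X Y)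
          ((Kolmogorov.tableBasis c).map (VectorField.pullback ℝ φ.map))) ∧
    -- the kernel of the maximal Lie invariance algebras
    (∀ T X Y U : Set ℝ, Kolmogorov.IsOpenInterval T → Kolmogorov.IsOpenInterval X →
      Kolmogorov.IsOpenInterval Y → Kolmogorov.IsOpenInterval U →
        Kolmogorov.IsBasisOn (Kolmogorov.box T X Y U)
          (fun Q => ∀ f k : ℝ → ℝ, Kolmogorov.GaugedEq.InClass ⟨T, U, f, k⟩ →
            Kolmogorov.GaugedEq.IsSymmetry ⟨T, U, f, k⟩ X Y Q)
          [Kolmogorov.dx, Kolmogorov.dy]) ∧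
    -- the original class: reduction to the gauge `g = 1` and to the list
    (∀ e : Kolmogorov.OrigEq, e.InClass →
      ∃! c : Kolmogorov.KType × Kolmogorov.FType,
        ∃ (φ : Kolmogorov.OrigTransf) (e' : Kolmogorov.OrigEq),
          φ.Maps e e' ∧ e'.IsOfType c) ∧
    -- the original class: the maximal Lie invariance algebras
    (∀ (e e' : Kolmogorov.OrigEq) (φ : Kolmogorov.OrigTransf)
      (c : Kolmogorov.KType × Kolmogorov.FType),
      e.InClass → φ.Maps e e' → e'.IsOfType c →
      ∀ X Y : Set ℝ, Kolmogorov.IsOpenInterval X → Kolmogorov.IsOpenInterval Y →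
        Kolmogorov.IsBasisOn (Kolmogorov.box e.T X Y e.U) (e.IsSymmetry X Y)
          ((Kolmogorov.tableBasis c).map (VectorField.pullback ℝ φ.map))) := by
  refine ⟨fun e c he hc X Y hX hY => hc.isBasisOn he hX hY, fun e he => he.existsUnique_type,
    fun e e' φ c he hφ hc X Y hX hY => hφ.isBasisOn he hc hX hY,
    fun T X Y U hT hX hY hU => Kolmogorov.isBasisOn_kernel hT hX hY hU,
    fun e he => he.existsUnique_type,
    fun e e' φ c he hφ hc X Y hX hY => hφ.isBasisOn he hc hX hY⟩
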